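/- Let $k$ be a commutative ring. A weak bialgebra over $k$ is a $k$-module $H$ with a $k$-algebra structure and a $k$-coalgebra structure $(\Delta,\varepsilon)$, $\Delta(h)=h_{(1)}\otimes h_{(2)}$, such that, for all $g,h,l\in H$, $\Delta(gh)=\Delta(g)\Delta(h)$, $$(H\otimes\Delta)\Delta(1)=(\Delta(1)\otimes 1)(1\otimes\Delta(1))=(1\otimes\Delta(1))(\Delta(1)\otimes 1),$$ $$\varepsilon(ghl)=\varepsilon(gh_{(1)})\varepsilon(h_{(2)}l)=\varepsilon(gh_{(2)})\varepsilon(h_{(1)}l).$$ Put $\varepsilon_t(h)=\varepsilon(1_{(1)}h)1_{(2)}$, $\varepsilon_s(h)=1_{(1)}\varepsilon(h1_{(2)})$, $\overline{\varepsilon}_s(h)=\varepsilon(1_{(2)}h)1_{(1)}$ and $H_t=\operatorname{Im}\varepsilon_t$. A weak Hopf algebra is a weak bialgebra with a $k$-linear map $S:H\to H$ (the antipode) such that $S(h_{(1)})h_{(2)}=\varepsilon_s(h)$, $h_{(1)}S(h_{(2)})=\varepsilon_t(h)$ and $S(h_{(1)})h_{(2)}S(h_{(3)})=S(h)$. For left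 $H$-modules $M,N$ put $M\otimes_tN=\Delta(1)(M\otimes_k N)$. A left-left Yetter-Drinfeld module is a left $H$-module $M$ with a coassociative and counital left $H$-coaction $\lambda(m)=m_{[-1]}\otimes m_{[0]}$ such that $\lambda(m)\in H\otimes_tM$ and $$h_{(1)}m_{[-1]}\otimes h_{(2)}m_{[0]}=(h_{(1)}m)_{[-1]}h_{(2)}\otimes(h_{(1)}m)_{[0]}\qquad(h\in H,\ m\in M);$$ morphisms are the left $H$-linear, left $H$-colinear maps. **Proposition 5.3.** Let $H$ be a weak Hopf algebra over $k$ with bijective antipode. The category of left-left Yetter-Drinfeld modules over $H$ that are finitely generated and projective as $k$-modules is a monoidal category with the following structure: * the tensor product is $M\otimes_tN$ with action $h(m\otimes n)=h_{(1)}m\otimes h_{(2)}n$ and coaction $\lambda(1_{(1)}m\otimes1_{(2)}n)=m_{[-1]}n_{[-1]}\otimes m_{[0]}\otimes n_{[0]}$, the tensor product of morphisms being the restriction of that of linear maps; * the unit object is $H_t$ with action $h\rightharpoonup z=\varepsilon_t(hz)$ and coaction $\lambda(z)=\Delta(z)$; * the associativity constraint is the restriction of the natural one of $k$-modules, and the unit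 constraints are $l_M(1_{(1)}\rightharpoonup z\otimes1_{(2)}m)=zm$ and $r_M(1_{(1)}m\otimes1_{(2)}\rightharpoonup z)=\overline{\varepsilon}_s(z)m$. This monoidal category has left duality: each object $M$ has a dual object $M^*$ together with morphisms ${\rm ev}_M:M^*\otimes_tM\to H_t$ and ${\rm coev}_M:H_t\to M\otimes_tM^*$ of the category (that is, $H$-linear and $H$-colinear maps) that satisfy the two triangle identities. Explicitly, $M^*=\operatorname{Hom}_k(M,k)$ with the action and the coaction $\lambda(m^*)=m^*_{[-1]}\otimes m^*_{[0]}$ determined by $$\langle h\cdot m^*,m\rangle=\langle m^*,S(h)m\rangle,\qquad \langle m^*_{[0]},m\rangle\,S(m^*_{[-1]})=\langle m^*,m_{[0]}\rangle\,m_{[-1]}$$ for all $h\in H$, $m\in M$, $m^*\in M^*$, and, for every finite dual basis $\{(n_i,n_i^*)\}$ of $M$ and all $z\in H_t$, $${\rm ev}_M(1_{(1)}\cdot m^*\otimes 1_{(2)}m)=\langle m^*,1_{(1)}m\rangle 1_{(2)},\qquad {\rm coev}_M(z)=z\cdot\Bigl(\sum_i n_i\otimes n_i^*\Bigr),$$ where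 $z$ acts through $\Delta(z)$. -/

import Mathlib

open scoped TensorProduct
open CategoryTheory MonoidalCategory

universe u

/-! ### Weak bialgebras and weak Hopf algebras -/

/-- A weak bialgebra over a commutative ring `k`: an algebra and a coalgebra whose
comultiplication is multiplicative (but not necessarily unital) and whose unit and counit satisfy
the weak compatibility conditions. -/
class WeakBialgebra (k H : Type u) [CommRing k] [Ring H] extends Algebra k H, Coalgebra k H where
  /-- `Δ(gh) = Δ(g)Δ(h)` -/
  comul_mul : ∀ g h : H,
    Coalgebra.comul (R := k) (g * h) = Coalgebra.comul (R := k) g * Coalgebra.comul (R := k) h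
  /-- `Δ²(1) = (Δ(1) ⊗ 1)(1 ⊗ Δ(1))` -/
  comul_one_left :
    (Coalgebra.comul (R := k) (A := H)).lTensor H (Coalgebra.comul (R := k) (1 : H)) =
      TensorProduct.assoc k H H H (Coalgebra.comul (R := k) (1 : H) ⊗ₜ[k] (1 : H)) *
        ((1 : H) ⊗ₜ[k] Coalgebra.comul (R := k) (1 : H))
  /-- `Δ²(1) = (1 ⊗ Δ(1))(Δ(1) ⊗ 1)` -/
  comul_one_right :
    (Coalgebra.comul (R := k) (A := H)).lTensor H (Coalgebra.comul (R := k) (1 : H)) =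
      ((1 : H) ⊗ₜ[k] Coalgebra.comul (R := k) (1 : H)) *
        TensorProduct.assoc k H H H (Coalgebra.comul (R := k) (1 : H) ⊗ₜ[k] (1 : H))
  /-- `ε(ghl) = ε(g h₍₁₎) ε(h₍₂₎ l)` -/
  counit_mul_left : ∀ g h l : H,
    Coalgebra.counit (R := k) (g * h * l) =
      LinearMap.mul' k k (TensorProduct.map
        (Coalgebra.counit (R := k) (A := H) ∘ₗ LinearMap.mulLeft k g)
        (Coalgebra.counit (R := k) (A := H) ∘ₗ LinearMap.mulRight k l)
        (Coalgebra.comul (R := k) h))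
  /-- `ε(ghl) = ε(g h₍₂₎) ε(h₍₁₎ l)` -/
  counit_mul_right : ∀ g h l : H,
    Coalgebra.counit (R := k) (g * h * l) =
      LinearMap.mul' k k (TensorProduct.map
        (Coalgebra.counit (R := k) (A := H) ∘ₗ LinearMap.mulRight k l)
        (Coalgebra.counit (R := k) (A := H) ∘ₗ LinearMap.mulLeft k g)
        (Coalgebra.comul (R := k) h))

namespace WeakBialgebra

section Maps

variable (k H : Type u) [CommRing k] [Ring H] [WeakBialgebra k H]

/-- The target map `ε_t(h) = ε(1₍₁₎ h) 1₍₂₎`. -/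
noncomputable def targetMap : H →ₗ[k] H where
  toFun h := TensorProduct.lid k H
    ((Coalgebra.counit (R := k) (A := H) ∘ₗ LinearMap.mulRight k h).rTensor H
      (Coalgebra.comul (R := k) (1 : H)))
  map_add' x y := by
    have : LinearMap.mulRight k (x + y) = LinearMap.mulRight k x + LinearMap.mulRight k y := by
      ext; simp [mul_add]
    simp [this, LinearMap.comp_add, LinearMap.rTensor_add]
  map_smul' c x := by
    have : LinearMap.mulRight k (c • x) = c • LinearMap.mulRight k x := by ext; simp
    simp [this, LinearMap.comp_smul, LinearMap.rTensor_smul]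

/-- The source map `ε_s(h) = 1₍₁₎ ε(h 1₍₂₎)`. -/
noncomputable def sourceMap : H →ₗ[k] H where
  toFun h := TensorProduct.rid k H
    ((Coalgebra.counit (R := k) (A := H) ∘ₗ LinearMap.mulLeft k h).lTensor H
      (Coalgebra.comul (R := k) (1 : H)))
  map_add' x y := by
    have : LinearMap.mulLeft k (x + y) = LinearMap.mulLeft k x + LinearMap.mulLeft k y := by
      ext; simp [add_mul]
    simp [this, LinearMap.comp_add, LinearMap.lTensor_add]
  map_smul' c x := by
    have : LinearMap.mulLeft k (c • x) = c • LinearMap.mulLeft k x := by ext; simp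
    simp [this, LinearMap.comp_smul, LinearMap.lTensor_smul]

/-- The source map of the opposite weak bialgebra, `h ↦ ε(1₍₂₎ h) 1₍₁₎`. -/
noncomputable def sourceMapOp (h : H) : H :=
  TensorProduct.rid k H
    ((Coalgebra.counit (R := k) (A := H) ∘ₗ LinearMap.mulRight k h).lTensor H
      (Coalgebra.comul (R := k) (1 : H)))

/-- The target space `H_t`, the image of the target map. -/
noncomputable def targetSpace : Submodule k H := LinearMap.range (targetMap k H)

end Maps

section Tensor

variable (k : Type u) {H : Type u} [CommRing k] [Ring H] [WeakBialgebra k H]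
variable (M N : Type u) [AddCommGroup M] [Module k M] [Module H M] [IsScalarTower k H M]
  [AddCommGroup N] [Module k N] [Module H N] [IsScalarTower k H N]

/-- The action of `H ⊗ H` on `M ⊗ N`, `(a ⊗ b)(m ⊗ n) = am ⊗ bn`. -/
noncomputable def tensorAct : H ⊗[k] H →ₗ[k] M ⊗[k] N →ₗ[k] M ⊗[k] N :=
  TensorProduct.homTensorHomMap (RingHom.id k) M N M N ∘ₗ
    TensorProduct.map (Algebra.lsmul k k M).toLinearMap (Algebra.lsmul k k N).toLinearMap

/-- The (non-unital) diagonal action of `h` on `M ⊗ N`, `m ⊗ n ↦ h₍₁₎ m ⊗ h₍₂₎ n`. -/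
noncomputable def diagAct (h : H) : M ⊗[k] N →ₗ[k] M ⊗[k] N :=
  tensorAct k M N (Coalgebra.comul (R := k) h)

variable (H) in
/-- `M ⊗_t N = Δ(1)(M ⊗ N)`, as a `k`-submodule of `M ⊗ N`. -/
noncomputable def tensorT : Submodule k (M ⊗[k] N) :=
  LinearMap.range (diagAct k M N (1 : H))

variable (H) in
/-- The projection `π : M ⊗ N → M ⊗_t N`, `m ⊗ n ↦ 1₍₁₎ m ⊗ 1₍₂₎ n`. -/
noncomputable def projT : M ⊗[k] N →ₗ[k] tensorT k H M N :=
  (diagAct k M N (1 : H)).rangeRestrict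

end Tensor

end WeakBialgebra

/-- A weak Hopf algebra: a weak bialgebra with an antipode `S`, that is
`S * H = ε_s`, `H * S = ε_t` and `S * H * S = S` for the convolution product. -/
class WeakHopfAlgebra (k H : Type u) [CommRing k] [Ring H] extends WeakBialgebra k H where
  /-- the antipode -/
  antipode : H →ₗ[k] H
  /-- `S(h₍₁₎) h₍₂₎ = ε_s(h)` -/
  antipode_conv_id :
    LinearMap.mul' k H ∘ₗ TensorProduct.map antipode LinearMap.id ∘ₗ Coalgebra.comul =
      WeakBialgebra.sourceMap k H
  /-- `h₍₁₎ S(h₍₂₎) = ε_t(h)` -/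
  id_conv_antipode :
    LinearMap.mul' k H ∘ₗ TensorProduct.map LinearMap.id antipode ∘ₗ Coalgebra.comul =
      WeakBialgebra.targetMap k H
  /-- `S(h₍₁₎) h₍₂₎ S(h₍₃₎) = S(h)` -/
  antipode_conv_id_conv_antipode :
    LinearMap.mul' k H ∘ₗ TensorProduct.map antipode
        (LinearMap.mul' k H ∘ₗ TensorProduct.map LinearMap.id antipode ∘ₗ Coalgebra.comul) ∘ₗ
      Coalgebra.comul = antipode

/-! ### Yetter-Drinfeld modules -/

/-- For a linear map `c : M → H ⊗ M`, `c(m) = m₍₋₁₎ ⊗ m₍₀₎`, and `m : M`, the map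
`a ⊗ b ↦ (am)₍₋₁₎ b ⊗ (am)₍₀₎`. -/
noncomputable def coactMulRight {k H M : Type u} [CommRing k] [Ring H] [Algebra k H]
    [AddCommGroup M] [Module k M] [Module H M] [IsScalarTower k H M]
    (c : M →ₗ[k] H ⊗[k] M) (m : M) : H ⊗[k] H →ₗ[k] H ⊗[k] M :=
  TensorProduct.lift (LinearMap.mk₂ k
    (fun a b => (LinearMap.mulRight k b).rTensor M (c (a • m)))
    (fun a a' b => by simp [add_smul])
    (fun r a b => by simp)
    (fun a b b' => by
      have : LinearMap.mulRight k (b + b') = LinearMap.mulRight k b + LinearMap.mulRight k b' := by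
        ext; simp [mul_add]
      simp [this, LinearMap.rTensor_add])
    (fun r a b => by
      have : LinearMap.mulRight k (r • b) = r • LinearMap.mulRight k b := by ext; simp
      simp [this, LinearMap.rTensor_smul]))

/-- A left-left Yetter-Drinfeld module over a weak bialgebra `H`. -/
structure YDModule (k H : Type u) [CommRing k] [Ring H] [WeakBialgebra k H] where
  /-- the underlying set -/
  carrier : Type u
  [addCommGroup : AddCommGroup carrier]
  [moduleBase : Module k carrier]
  /-- the left `H`-action -/
  [module : Module H carrier]
  [isScalarTower : IsScalarTower k H carrier]
  /-- the left `H`-coaction `λ(m) = m₍₋₁₎ ⊗ m₍₀₎` -/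
  coact : carrier →ₗ[k] H ⊗[k] carrier
  /-- `m₍₋₁₎₍₁₎ ⊗ m₍₋₁₎₍₂₎ ⊗ m₍₀₎ = m₍₋₁₎ ⊗ m₍₀₎₍₋₁₎ ⊗ m₍₀₎₍₀₎` -/
  coassoc : ∀ m : carrier,
    TensorProduct.assoc k H H carrier
        ((Coalgebra.comul (R := k) (A := H)).rTensor carrier (coact m)) =
      coact.lTensor H (coact m)
  /-- `ε(m₍₋₁₎) m₍₀₎ = m` -/
  counit : ∀ m : carrier,
    TensorProduct.lid k carrier
      ((Coalgebra.counit (R := k) (A := H)).rTensor carrier (coact m)) = m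
  /-- `λ(m) ∈ H ⊗_t M` -/
  coact_mem : ∀ m : carrier, coact m ∈ WeakBialgebra.tensorT k H H carrier
  /-- `h₍₁₎ m₍₋₁₎ ⊗ h₍₂₎ m₍₀₎ = (h₍₁₎ m)₍₋₁₎ h₍₂₎ ⊗ (h₍₁₎ m)₍₀₎` -/
  compat : ∀ (h : H) (m : carrier),
    WeakBialgebra.diagAct k H carrier h (coact m) =
      coactMulRight coact m (Coalgebra.comul (R := k) h)

namespace YDModule

attribute [instance] YDModule.addCommGroup YDModule.moduleBase YDModule.module
  YDModule.isScalarTower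

section Category

variable {k H : Type u} [CommRing k] [Ring H] [WeakBialgebra k H]

instance : CoeSort (YDModule k H) (Type u) := ⟨YDModule.carrier⟩

/-- A morphism of Yetter-Drinfeld modules: a left `H`-linear, left `H`-colinear map. -/
@[ext]
structure Hom (M N : YDModule k H) where
  /-- the underlying `k`-linear map -/
  toLin : M →ₗ[k] N
  /-- `H`-linearity -/
  map_smul : ∀ (h : H) (m : M), toLin (h • m) = h • toLin m
  /-- `H`-colinearity -/
  map_coact : ∀ m : M, N.coact (toLin m) = toLin.lTensor H (M.coact m)

instance : Category (YDModule k H) where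
  Hom M N := Hom M N
  id M := ⟨LinearMap.id, by simp, by simp⟩
  comp f g := ⟨g.toLin ∘ₗ f.toLin, by simp [f.map_smul, g.map_smul],
    by simp [f.map_coact, g.map_coact, LinearMap.lTensor_comp]⟩

end Category

/-- The map `M ⊗ N → H ⊗ (M ⊗ N)`, `m ⊗ n ↦ m₍₋₁₎ n₍₋₁₎ ⊗ m₍₀₎ ⊗ n₍₀₎`. -/
noncomputable def tensorCoact {k H : Type u} [CommRing k] [Ring H] [WeakBialgebra k H]
    (M N : YDModule k H) : M ⊗[k] N →ₗ[k] H ⊗[k] (M ⊗[k] N) :=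
  (LinearMap.mul' k H).rTensor (M ⊗[k] N) ∘ₗ
    (TensorProduct.tensorTensorTensorComm k H M H N).toLinearMap ∘ₗ
      TensorProduct.map M.coact N.coact

end YDModule

/-- The category of left-left Yetter-Drinfeld modules that are finitely generated and projective
as `k`-modules (a full subcategory of the category of Yetter-Drinfeld modules). -/
abbrev FGPYDModule (k H : Type u) [CommRing k] [Ring H] [WeakBialgebra k H] :=
  ObjectProperty.FullSubcategory
    (fun M : YDModule k H => Module.Finite k M ∧ Module.Projective k M)

namespace FGPYDModule

section Lin

variable {k H : Type u} [CommRing k] [Ring H] [WeakBialgebra k H]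

instance : CoeSort (FGPYDModule k H) (Type u) := ⟨fun M => M.obj.carrier⟩

/-- The `k`-linear map underlying a morphism. -/
def lin {M N : FGPYDModule k H} (f : M ⟶ N) : M →ₗ[k] N :=
  YDModule.Hom.toLin f.hom

end Lin

/-- The standard monoidal structure: this structure says that (and how) a given monoidal structure
on finitely generated projective Yetter-Drinfeld modules has the tensor product `⊗_t` with the
diagonal action and the coaction `m₍₋₁₎ n₍₋₁₎ ⊗ m₍₀₎ ⊗ n₍₀₎`, the unit object `H_t`, and the usual
constraints. -/
structure StandardMonoidal (k H : Type u) [CommRing k] [Ring H] [WeakBialgebra k H]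
    [MonoidalCategory (FGPYDModule k H)] where
  /-- the module underlying `M ⊗ N` is `M ⊗_t N` -/
  tensorEquiv : ∀ M N : FGPYDModule k H,
    ((M ⊗ N : FGPYDModule k H) : Type u) ≃ₗ[k] WeakBialgebra.tensorT k H M N
  /-- the module underlying the unit object is `H_t` -/
  unitEquiv : ((𝟙_ (FGPYDModule k H) : FGPYDModule k H) : Type u) ≃ₗ[k]
    WeakBialgebra.targetSpace k H
  /-- the action on `M ⊗_t N` is diagonal -/
  tensor_smul : ∀ (M N : FGPYDModule k H) (h : H) (x : (M ⊗ N : FGPYDModule k H)),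
    (tensorEquiv M N (h • x) : M ⊗[k] N) =
      WeakBialgebra.diagAct k M N h (tensorEquiv M N x : M ⊗[k] N)
  /-- `λ(1₍₁₎ m ⊗ 1₍₂₎ n) = m₍₋₁₎ n₍₋₁₎ ⊗ m₍₀₎ ⊗ n₍₀₎` -/
  tensor_coact : ∀ (M N : FGPYDModule k H) (m : M) (n : N),
    ((WeakBialgebra.tensorT k H M N).subtype ∘ₗ (tensorEquiv M N).toLinearMap).lTensor H
        ((M ⊗ N : FGPYDModule k H).obj.coact
          ((tensorEquiv M N).symm (WeakBialgebra.projT k H M N (m ⊗ₜ[k] n)))) =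
      YDModule.tensorCoact M.obj N.obj (m ⊗ₜ[k] n)
  /-- the tensor product of morphisms is the restriction of the tensor product of linear maps -/
  tensor_hom : ∀ {M M' N N' : FGPYDModule k H} (f : M ⟶ M') (g : N ⟶ N')
      (x : (M ⊗ N : FGPYDModule k H)),
    (tensorEquiv M' N' (lin (f ⊗ₘ g) x) : M' ⊗[k] N') =
      TensorProduct.map (lin f) (lin g) (tensorEquiv M N x : M ⊗[k] N)
  /-- the action on `H_t` is `h ⇀ z = ε_t(hz)` -/
  unit_smul : ∀ (h : H) (x : (𝟙_ (FGPYDModule k H) : FGPYDModule k H)),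
    (unitEquiv (h • x) : H) = WeakBialgebra.targetMap k H (h * (unitEquiv x : H))
  /-- the coaction on `H_t` is the comultiplication -/
  unit_coact : ∀ x : (𝟙_ (FGPYDModule k H) : FGPYDModule k H),
    ((WeakBialgebra.targetSpace k H).subtype ∘ₗ unitEquiv.toLinearMap).lTensor H
        ((𝟙_ (FGPYDModule k H) : FGPYDModule k H).obj.coact x) =
      Coalgebra.comul (R := k) (unitEquiv x : H)
  /-- the associativity constraint is the restriction of `(m ⊗ n) ⊗ p ↦ m ⊗ (n ⊗ p)` -/
  associator : ∀ (M N P : FGPYDModule k H) (x : ((M ⊗ N) ⊗ P : FGPYDModule k H)),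
    TensorProduct.assoc k M N P
        (((WeakBialgebra.tensorT k H M N).subtype ∘ₗ (tensorEquiv M N).toLinearMap).rTensor P
          (tensorEquiv (M ⊗ N) P x :
            ((M ⊗ N : FGPYDModule k H) : Type u) ⊗[k] (P : Type u))) =
      ((WeakBialgebra.tensorT k H N P).subtype ∘ₗ (tensorEquiv N P).toLinearMap).lTensor M
        (tensorEquiv M (N ⊗ P) (lin (α_ M N P).hom x) :
          (M : Type u) ⊗[k] ((N ⊗ P : FGPYDModule k H) : Type u))
  /-- `l_M(1₍₁₎ ⇀ z ⊗ 1₍₂₎ m) = zm` -/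
  leftUnitor : ∀ (M : FGPYDModule k H) (z : (𝟙_ (FGPYDModule k H) : FGPYDModule k H)) (m : M),
    lin (λ_ M).hom ((tensorEquiv (𝟙_ _) M).symm
        (WeakBialgebra.projT k H (𝟙_ (FGPYDModule k H) : FGPYDModule k H) M (z ⊗ₜ[k] m))) =
      (unitEquiv z : H) • m
  /-- `r_M(1₍₁₎ m ⊗ 1₍₂₎ ⇀ z) = ε̄_s(z) m` with `ε̄_s(z) = ε(1₍₂₎ z) 1₍₁₎` -/
  rightUnitor : ∀ (M : FGPYDModule k H) (m : M) (z : (𝟙_ (FGPYDModule k H) : FGPYDModule k H)),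
    lin (ρ_ M).hom ((tensorEquiv M (𝟙_ _)).symm
        (WeakBialgebra.projT k H M (𝟙_ (FGPYDModule k H) : FGPYDModule k H) (m ⊗ₜ[k] z))) =
      WeakBialgebra.sourceMapOp k H (unitEquiv z : H) • m

end FGPYDModule

/-! The two legs of Δ(1) govern everything. The elements φ(1₁)1₂ make up H_t, and the elements
φ(1₂)1₁ the base on the other side. The two commute because the two factorisations of Δ²(1) agree,
and Δ moves such elements into one tensor factor: Δ(z) = 1₁z ⊗ 1₂ = z1₁ ⊗ 1₂ for z in H_t
(`IsRightLeg.sw_comul`, `IsRightLeg.sw_comul'`). On a Yetter-Drinfeld module this becomes λ(zm) =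
zm₋₁ ⊗ m₀, λ(ε̄_s(z)m) = m₋₁z ⊗ m₀ and, for y in the other base, m₋₁ ⊗ ym₀ = m₋₁y ⊗ m₀
(`sw_coact_rightLeg_smul`, `sw_coact_sourceMapOp_smul`, `sw_coact_leftLeg`).

Δ(1) acts on M ⊗ N as an idempotent with image M ⊗_t N, which is spanned by the 1₁m ⊗ 1₂n. Maps are
compared on these generators, and a map on M ⊗ N that respects action and coaction on pure tensors
restricts to a morphism (`homLift`). The moving rules absorb superfluous copies of Δ(1), so on
generators the coaction and the associativity constraint are the naive ones, and naturality and the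
pentagon are immediate. The triangle expresses that M ⊗_t N is balanced over H_t (`pr_triangle`).
Finiteness and projectivity pass to retracts.

For duality, S reverses products and coproducts, so T = S⁻¹ satisfies T(h₂)h₁ = ε̄_t(h) and h₂T(h₁)
= ε̄_s(h). The dual has action through S and coaction through T; its compatibility at h is T applied
to that of M at S(h). A finite dual basis identifies A ⊗ M* with Hom(M, A), so identities are tested
on vectors. Under this identification coev(z) is the endomorphism m ↦ zm, on which h acts by
h₁(·)S(h₂). Linearity of coev is then h₁zS(h₂) = ε_t(hz), and the triangle identities reduce to
ε̄_s(1₂)1₁ = 1 and 1₁zS(1₂) = z (`coev_ev`, `ev_coev`).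

The pairing M* ⊗ M → 1, 1 → M ⊗ M* is an `ExactPairing` of M with M*, which is why this left duality
appears as `RightRigidCategory`. -/

/-! ### Sums over tensors (Sweedler notation) -/

section Sums

variable {k : Type*} [CommSemiring k] {A B P : Type*} [AddCommMonoid A] [Module k A]
  [AddCommMonoid B] [Module k B] [AddCommMonoid P]

/-- `sw t f = ∑ f(tᵢ', tᵢ'')` for a chosen decomposition `t = ∑ tᵢ' ⊗ tᵢ''`. It does not depend on
the decomposition if `f` is bilinear. -/
noncomputable def sw (t : A ⊗[k] B) (f : A → B → P) : P :=
  ∑ p ∈ (TensorProduct.exists_finset t).choose, f p.1 p.2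

theorem sw_congr (t : A ⊗[k] B) {F G : A → B → P} (h : ∀ a b, F a b = G a b) :
    sw t F = sw t G := by
  simp [sw, h]

/-- Both sides are finite sums over fixed decompositions, so independent Sweedler sums can be
exchanged without any linearity condition. -/
theorem sw_comm {A' B' : Type*} [AddCommMonoid A'] [Module k A'] [AddCommMonoid B'] [Module k B']
    (t : A ⊗[k] B) (s : A' ⊗[k] B') (F : A → B → A' → B' → P) :
    sw t (fun a b => sw s (fun c d => F a b c d)) =
      sw s (fun c d => sw t (fun a b => F a b c d)) :=
  Finset.sum_comm

end Sums

section Sweedler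

variable {k : Type*} [CommSemiring k]
variable {A B C P Q X : Type*} [AddCommMonoid A] [Module k A] [AddCommMonoid B] [Module k B]
  [AddCommMonoid C] [Module k C]
  [AddCommMonoid P] [Module k P] [AddCommMonoid Q] [Module k Q] [AddCommMonoid X] [Module k X]

-- Linearity in each Sweedler variable is the side condition of most rewriting rules below; as a
-- `fun_prop` predicate it is discharged automatically.
attribute [fun_prop] IsLinearMap

/-- Bilinearity is what makes the sum independent of the chosen decomposition. -/
theorem sw_eq_lift (t : A ⊗[k] B) (f : A →ₗ[k] B →ₗ[k] P) :
    sw t (fun a b => f a b) = TensorProduct.lift f t := by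
  conv_rhs => rw [(TensorProduct.exists_finset t).choose_spec]
  simp [sw]

/-- A function of two variables that is linear in each of them, as a bilinear map. -/
def bilin (F : A → B → P) (h1 : ∀ b, IsLinearMap k fun a => F a b)
    (h2 : ∀ a, IsLinearMap k fun b => F a b) : A →ₗ[k] B →ₗ[k] P :=
  LinearMap.mk₂ k F (fun a a' b => (h1 b).map_add a a') (fun c a b => (h1 b).map_smul c a)
    (fun a b b' => (h2 a).map_add b b') (fun c a b => (h2 a).map_smul c b)

theorem sw_eq_lift_bilin (t : A ⊗[k] B) (F : A → B → P)
    (h1 : ∀ b, IsLinearMap k fun a => F a b) (h2 : ∀ a, IsLinearMap k fun b => F a b) :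
    sw t F = TensorProduct.lift (bilin F h1 h2) t :=
  sw_eq_lift t (bilin F h1 h2)

theorem sw_tmul_self (t : A ⊗[k] B) : sw t (fun a b => a ⊗ₜ[k] b) = t :=
  (TensorProduct.exists_finset t).choose_spec.symm

theorem sw_tmul (a : A) (b : B) (F : A → B → P)
    (h1 : ∀ b, IsLinearMap k fun a => F a b := by intros; fun_prop)
    (h2 : ∀ a, IsLinearMap k fun b => F a b := by intros; fun_prop) :
    sw (a ⊗ₜ[k] b) F = F a b := by
  rw [sw_eq_lift_bilin _ F h1 h2]; simp [bilin]

@[fun_prop]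
theorem isLinearMap_id' : IsLinearMap k (fun x : A => x) := ⟨fun _ _ => rfl, fun _ _ => rfl⟩

@[fun_prop]
theorem IsLinearMap.comp' {f : B → C} {g : A → B} (hf : IsLinearMap k f) (hg : IsLinearMap k g) :
    IsLinearMap k (fun x => f (g x)) :=
  ⟨fun x y => by rw [hg.map_add, hf.map_add], fun c x => by rw [hg.map_smul, hf.map_smul]⟩

@[fun_prop]
theorem isLinearMap_linearMap (f : A →ₗ[k] B) {g : X → A} (hg : IsLinearMap k g) :
    IsLinearMap k (fun x => f (g x)) :=
  f.isLinear.comp' hg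

@[fun_prop]
theorem isLinearMap_linearEquiv (f : A ≃ₗ[k] B) {g : X → A} (hg : IsLinearMap k g) :
    IsLinearMap k (fun x => f (g x)) :=
  f.toLinearMap.isLinear.comp' hg

@[fun_prop]
theorem isLinearMap_linearMap_apply {f : X → A →ₗ[k] B} (hf : IsLinearMap k f) (a : A) :
    IsLinearMap k (fun x => f x a) :=
  ⟨fun x y => by simp [hf.map_add], fun c x => by simp [hf.map_smul]⟩

-- Here the tensor, hence its chosen decomposition, varies with x; this is why F must be bilinear.
-- In `isLinearMap_sw_right` the tensor is fixed and no such condition is needed.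
@[fun_prop]
theorem isLinearMap_sw_left {t : X → A ⊗[k] B} (ht : IsLinearMap k t) {F : A → B → P}
    (h1 : ∀ b, IsLinearMap k fun a => F a b) (h2 : ∀ a, IsLinearMap k fun b => F a b) :
    IsLinearMap k (fun x => sw (t x) (fun a b => F a b)) := by
  simp_rw [sw_eq_lift_bilin _ F h1 h2]
  exact (TensorProduct.lift (bilin F h1 h2)).isLinear.comp' ht

@[fun_prop]
theorem isLinearMap_sw_right (t : A ⊗[k] B) {F : X → A → B → P}
    (h : ∀ a b, IsLinearMap k fun x => F x a b) :
    IsLinearMap k (fun x => sw t (fun a b => F x a b)) :=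
  ⟨fun x y => by simp [sw, (h _ _).map_add, Finset.sum_add_distrib],
    fun c x => by simp [sw, (h _ _).map_smul, Finset.smul_sum]⟩

@[fun_prop]
theorem isLinearMap_tmul_left {f : X → A} (hf : IsLinearMap k f) (b : B) :
    IsLinearMap k (fun x => f x ⊗ₜ[k] b) :=
  ⟨fun x y => by simp [hf.map_add, TensorProduct.add_tmul],
    fun c x => by simp [hf.map_smul, TensorProduct.smul_tmul']⟩

@[fun_prop]
theorem isLinearMap_tmul_right {f : X → B} (hf : IsLinearMap k f) (a : A) :
    IsLinearMap k (fun x => a ⊗ₜ[k] f x) :=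
  ⟨fun x y => by simp [hf.map_add, TensorProduct.tmul_add],
    fun c x => by simp [hf.map_smul]⟩

section Algebra

variable {R M : Type*} [Semiring R] [Algebra k R] [AddCommMonoid M] [Module k M] [Module R M]
  [IsScalarTower k R M]

@[fun_prop]
theorem isLinearMap_mul_left {f : X → R} (hf : IsLinearMap k f) (b : R) :
    IsLinearMap k (fun x => f x * b) :=
  ⟨fun x y => by simp [hf.map_add, add_mul], fun c x => by simp [hf.map_smul]⟩

@[fun_prop]
theorem isLinearMap_mul_right {f : X → R} (hf : IsLinearMap k f) (b : R) :
    IsLinearMap k (fun x => b * f x) :=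
  ⟨fun x y => by simp [hf.map_add, mul_add], fun c x => by simp [hf.map_smul]⟩

@[fun_prop]
theorem isLinearMap_act_left {f : X → R} (hf : IsLinearMap k f) (m : M) :
    IsLinearMap k (fun x => f x • m) :=
  ⟨fun x y => by simp [hf.map_add, add_smul], fun c x => by simp [hf.map_smul]⟩

@[fun_prop]
theorem isLinearMap_act_right {f : X → M} (hf : IsLinearMap k f) (b : R) :
    IsLinearMap k (fun x => b • f x) :=
  ⟨fun x y => by simp [hf.map_add], fun c x => by
    have := IsScalarTower.to_smulCommClass (R := k) (A := R) (M := M)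
    simp [hf.map_smul, smul_comm c b]⟩

end Algebra

theorem IsLinearMap.map_sw {f : P → Q} (hf : IsLinearMap k f) (t : A ⊗[k] B) (F : A → B → P) :
    f (sw t F) = sw t (fun a b => f (F a b)) := by
  simp only [sw]
  exact map_sum (hf.mk' f) _ _

theorem sw_sw {A' B' : Type*} [AddCommMonoid A'] [Module k A'] [AddCommMonoid B'] [Module k B']
    (t : A ⊗[k] B) (f : A → B → A' ⊗[k] B') (F : A' → B' → P)
    (h1 : ∀ b, IsLinearMap k fun a => F a b := by intros; fun_prop)
    (h2 : ∀ a, IsLinearMap k fun b => F a b := by intros; fun_prop) :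
    sw (sw t f) F = sw t (fun a b => sw (f a b) F) :=
  IsLinearMap.map_sw (f := fun x => sw x F) (by fun_prop) t f

theorem map_sw (f : P → Q) (t : A ⊗[k] B) (F : A → B → P)
    (hf : IsLinearMap k f := by fun_prop) :
    f (sw t F) = sw t (fun a b => f (F a b)) :=
  hf.map_sw t F

theorem linearMap_sw (f : P →ₗ[k] Q) (t : A ⊗[k] B) (F : A → B → P) :
    f (sw t F) = sw t (fun a b => f (F a b)) := map_sw (fun x => f x) t F

theorem linearEquiv_sw (f : P ≃ₗ[k] Q) (t : A ⊗[k] B) (F : A → B → P) :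
    f (sw t F) = sw t (fun a b => f (F a b)) := map_sw (fun x => f x) t F

theorem tmul_sw (x : Q) (t : A ⊗[k] B) (F : A → B → P) :
    x ⊗ₜ[k] sw t F = sw t (fun a b => x ⊗ₜ[k] F a b) := map_sw (fun y => x ⊗ₜ[k] y) t F

theorem sw_tmul_const (x : Q) (t : A ⊗[k] B) (F : A → B → P) :
    sw t F ⊗ₜ[k] x = sw t (fun a b => F a b ⊗ₜ[k] x) := map_sw (fun y => y ⊗ₜ[k] x) t F

theorem smul_sw (x : k) (t : A ⊗[k] B) (F : A → B → P) :
    x • sw t F = sw t (fun a b => x • F a b) := map_sw (fun y => x • y) t F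

theorem sw_smul_const (x : P) (t : A ⊗[k] B) (F : A → B → k) :
    sw t F • x = sw t (fun a b => F a b • x) := map_sw (fun y => y • x) t F

theorem mul_sw {R : Type*} [Semiring R] [Algebra k R] (x : R) (t : A ⊗[k] B) (F : A → B → R) :
    x * sw t F = sw t (fun a b => x * F a b) := map_sw (fun y => x * y) t F

theorem sw_mul_const {R : Type*} [Semiring R] [Algebra k R] (x : R) (t : A ⊗[k] B)
    (F : A → B → R) :
    sw t F * x = sw t (fun a b => F a b * x) := map_sw (fun y => y * x) t F

theorem act_sw {R : Type*} [Semiring R] [Algebra k R] [Module R P] [IsScalarTower k R P] (x : R)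
    (t : A ⊗[k] B) (F : A → B → P) :
    x • sw t F = sw t (fun a b => x • F a b) := map_sw (fun y => x • y) t F

theorem sw_act_const {R : Type*} [Semiring R] [Algebra k R] [Module R P] [IsScalarTower k R P]
    (x : P) (t : A ⊗[k] B) (F : A → B → R) :
    sw t F • x = sw t (fun a b => F a b • x) := map_sw (fun y => y • x) t F

theorem sw_map {A' B' : Type*} [AddCommMonoid A'] [Module k A'] [AddCommMonoid B'] [Module k B']
    (f : A →ₗ[k] A') (g : B →ₗ[k] B') (t : A ⊗[k] B) (F : A' → B' → P)
    (h1 : ∀ b, IsLinearMap k fun a => F a b := by intros; fun_prop)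
    (h2 : ∀ a, IsLinearMap k fun b => F a b := by intros; fun_prop) :
    sw (TensorProduct.map f g t) F = sw t (fun a b => F (f a) (g b)) := by
  conv_lhs => rw [← sw_tmul_self t, map_sw (fun x => sw (TensorProduct.map f g x) F)]
  exact sw_congr _ fun a b => sw_tmul (f a) (g b) F

theorem sw_lTensor (f : B →ₗ[k] C) (t : A ⊗[k] B) (F : A → C → P)
    (h1 : ∀ b, IsLinearMap k fun a => F a b := by intros; fun_prop)
    (h2 : ∀ a, IsLinearMap k fun b => F a b := by intros; fun_prop) :
    sw (f.lTensor A t) F = sw t (fun a b => F a (f b)) :=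
  sw_map LinearMap.id f t F

theorem sw_rTensor (f : A →ₗ[k] C) (t : A ⊗[k] B) (F : C → B → P)
    (h1 : ∀ b, IsLinearMap k fun a => F a b := by intros; fun_prop)
    (h2 : ∀ a, IsLinearMap k fun b => F a b := by intros; fun_prop) :
    sw (f.rTensor B t) F = sw t (fun a b => F (f a) b) :=
  sw_map f LinearMap.id t F

theorem lTensor_eq_sw (f : B →ₗ[k] C) (t : A ⊗[k] B) :
    f.lTensor A t = sw t (fun a b => a ⊗ₜ f b) := by
  rw [← sw_lTensor f t (fun a b => a ⊗ₜ b), sw_tmul_self]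

theorem rTensor_eq_sw (f : A →ₗ[k] C) (t : A ⊗[k] B) :
    f.rTensor B t = sw t (fun a b => f a ⊗ₜ b) := by
  rw [← sw_rTensor f t (fun a b => a ⊗ₜ b), sw_tmul_self]

theorem map_eq_sw {A' B' : Type*} [AddCommMonoid A'] [Module k A'] [AddCommMonoid B'] [Module k B']
    (f : A →ₗ[k] A') (g : B →ₗ[k] B') (t : A ⊗[k] B) :
    TensorProduct.map f g t = sw t (fun a b => f a ⊗ₜ g b) := by
  rw [← sw_map f g t (fun a b => a ⊗ₜ b), sw_tmul_self]

theorem sw_assoc (t : (A ⊗[k] B) ⊗[k] C) (G : A → B ⊗[k] C → P)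
    (h1 : ∀ x, IsLinearMap k fun a => G a x := by intros; fun_prop)
    (h2 : ∀ a, IsLinearMap k fun x => G a x := by intros; fun_prop) :
    sw (TensorProduct.assoc k A B C t) G = sw t (fun x c => sw x (fun a b => G a (b ⊗ₜ c))) := by
  conv_lhs => rw [← sw_tmul_self t, map_sw (fun y => sw (TensorProduct.assoc k A B C y) G)]
  refine sw_congr _ fun x c => ?_
  conv_lhs => rw [← sw_tmul_self x, map_sw (fun y => sw (TensorProduct.assoc k A B C (y ⊗ₜ c)) G)]
  refine sw_congr _ fun a b => ?_
  simp (disch := ((repeat intro _); fun_prop)) only [TensorProduct.assoc_tmul, sw_tmul]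

theorem sw_mul {R S : Type*} [Semiring R] [Algebra k R] [Semiring S] [Algebra k S] (s t : R ⊗[k] S)
    (F : R → S → P)
    (h1 : ∀ b, IsLinearMap k fun a => F a b := by intros; fun_prop)
    (h2 : ∀ a, IsLinearMap k fun b => F a b := by intros; fun_prop) :
    sw (s * t) F = sw s (fun a b => sw t (fun c d => F (a * c) (b * d))) := by
  conv_lhs => rw [← sw_tmul_self s, map_sw (fun x => sw (x * t) F)]
  refine sw_congr _ fun a b => ?_
  conv_lhs => rw [← sw_tmul_self t, map_sw (fun x => sw (a ⊗ₜ b * x) F)]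
  refine sw_congr _ fun c d => ?_
  rw [Algebra.TensorProduct.tmul_mul_tmul, sw_tmul _ _ F]

theorem lid_eq_sw (t : k ⊗[k] A) : TensorProduct.lid k A t = sw t (fun c a => c • a) := by
  conv_lhs => rw [← sw_tmul_self t]
  exact (map_sw (fun x => TensorProduct.lid k A x) t _).trans (by simp)

theorem rid_eq_sw (t : A ⊗[k] k) : TensorProduct.rid k A t = sw t (fun a c => c • a) := by
  conv_lhs => rw [← sw_tmul_self t]
  exact (map_sw (fun x => TensorProduct.rid k A x) t _).trans (by simp)

end Sweedler

/-! ### Weak bialgebras in Sweedler notation -/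

namespace WeakBialgebra

section Calculus

variable {k H P : Type u} [CommRing k] [Ring H] [WeakBialgebra k H] [AddCommGroup P] [Module k P]

local notation "Δ" => Coalgebra.comul (R := k)
local notation "ε" => Coalgebra.counit (R := k)
local notation "εt" => targetMap k H
local notation "εs" => sourceMap k H
local notation "εs'" => sourceMapOp k H

theorem sw_comul_mul (g h : H) (F : H → H → P)
    (h1 : ∀ b, IsLinearMap k fun a => F a b := by intros; fun_prop)
    (h2 : ∀ a, IsLinearMap k fun b => F a b := by intros; fun_prop) :
    sw (Δ (g * h)) F = sw (Δ g) fun a b => sw (Δ h) fun c d => F (a * c) (b * d) := by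
  simp (disch := ((repeat intro _); fun_prop)) only [comul_mul, sw_mul]

/-- Although Δ(1) need not be 1 ⊗ 1, it is neutral for coproducts. This rule inserts or absorbs a
factor Δ(1). -/
theorem sw_comul_one_mul (h : H) (F : H → H → P)
    (h1 : ∀ b, IsLinearMap k fun a => F a b := by intros; fun_prop)
    (h2 : ∀ a, IsLinearMap k fun b => F a b := by intros; fun_prop) :
    (sw (Δ 1) fun a b => sw (Δ h) fun c d => F (a * c) (b * d)) = sw (Δ h) F := by
  rw [← sw_comul_mul _ _ F h1 h2, one_mul]

theorem sw_comul_mul_one (h : H) (F : H → H → P)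
    (h1 : ∀ b, IsLinearMap k fun a => F a b := by intros; fun_prop)
    (h2 : ∀ a, IsLinearMap k fun b => F a b := by intros; fun_prop) :
    (sw (Δ h) fun a b => sw (Δ 1) fun c d => F (a * c) (b * d)) = sw (Δ h) F := by
  rw [← sw_comul_mul _ _ F h1 h2, mul_one]

theorem sw_coassoc (h : H) (T : H → H → H → P)
    (h1 : ∀ b c, IsLinearMap k fun a => T a b c := by intros; fun_prop)
    (h2 : ∀ a c, IsLinearMap k fun b => T a b c := by intros; fun_prop)
    (h3 : ∀ a b, IsLinearMap k fun c => T a b c := by intros; fun_prop) :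
    (sw (Δ h) fun a b => sw (Δ a) fun c d => T c d b) =
      sw (Δ h) fun a b => sw (Δ b) fun c d => T a c d := by
  rw [← sw_lTensor (Coalgebra.comul (R := k)) (Δ h) (fun a x => sw x fun c d => T a c d),
    ← Coalgebra.coassoc_apply]
  simp (disch := ((repeat intro _); fun_prop)) only [sw_assoc, sw_rTensor, sw_tmul]

theorem sw_counit_left (h : H) (F : H → P) (hF : IsLinearMap k F := by fun_prop) :
    (sw (Δ h) fun a b => ε a • F b) = F h := by
  rw [← sw_rTensor (Coalgebra.counit (R := k)) (Δ h) (fun a b => a • F b),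
    Coalgebra.rTensor_counit_comul]
  simp (disch := ((repeat intro _); fun_prop)) only [sw_tmul, one_smul]

theorem sw_counit_right (h : H) (F : H → P) (hF : IsLinearMap k F := by fun_prop) :
    (sw (Δ h) fun a b => ε b • F a) = F h := by
  rw [← sw_lTensor (Coalgebra.counit (R := k)) (Δ h) (fun a b => b • F a),
    Coalgebra.lTensor_counit_comul]
  simp (disch := ((repeat intro _); fun_prop)) only [sw_tmul, one_smul]

theorem sw_comul_one_left (T : H → H → H → P)
    (h1 : ∀ b c, IsLinearMap k fun a => T a b c := by intros; fun_prop)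
    (h2 : ∀ a c, IsLinearMap k fun b => T a b c := by intros; fun_prop)
    (h3 : ∀ a b, IsLinearMap k fun c => T a b c := by intros; fun_prop) :
    (sw (Δ (1 : H)) fun a b => sw (Δ b) fun c d => T a c d) =
      sw (Δ (1 : H)) fun a b => sw (Δ (1 : H)) fun c d => T a (b * c) d := by
  rw [← sw_lTensor (Coalgebra.comul (R := k)) (Δ 1) (fun a x => sw x fun c d => T a c d),
    comul_one_left]
  simp (disch := ((repeat intro _); fun_prop)) only [sw_mul, sw_assoc, sw_tmul, mul_one, one_mul]

theorem sw_comul_one_right (T : H → H → H → P)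
    (h1 : ∀ b c, IsLinearMap k fun a => T a b c := by intros; fun_prop)
    (h2 : ∀ a c, IsLinearMap k fun b => T a b c := by intros; fun_prop)
    (h3 : ∀ a b, IsLinearMap k fun c => T a b c := by intros; fun_prop) :
    (sw (Δ (1 : H)) fun a b => sw (Δ b) fun c d => T a c d) =
      sw (Δ (1 : H)) fun a b => sw (Δ (1 : H)) fun c d => T a (c * b) d := by
  rw [← sw_lTensor (Coalgebra.comul (R := k)) (Δ 1) (fun a x => sw x fun c d => T a c d),
    comul_one_right]
  simp (disch := ((repeat intro _); fun_prop)) only [sw_mul, sw_assoc, sw_tmul, mul_one, one_mul]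

theorem counit_mul_left' (g h l : H) :
    ε (g * h * l) = sw (Δ h) fun a b => ε (g * a) * ε (b * l) := by
  rw [counit_mul_left, map_eq_sw, map_sw (fun x => LinearMap.mul' k k x)]
  simp

theorem counit_mul_right' (g h l : H) :
    ε (g * h * l) = sw (Δ h) fun a b => ε (g * b) * ε (a * l) := by
  rw [counit_mul_right, map_eq_sw, map_sw (fun x => LinearMap.mul' k k x)]
  simp [mul_comm]

theorem targetMap_eq (h : H) : εt h = sw (Δ 1) fun a b => ε (a * h) • b := by
  change TensorProduct.lid k H _ = _
  simp (disch := ((repeat intro _); fun_prop)) only [lid_eq_sw, sw_rTensor]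
  simp

theorem sourceMap_eq (h : H) : εs h = sw (Δ 1) fun a b => ε (h * b) • a := by
  change TensorProduct.rid k H _ = _
  simp (disch := ((repeat intro _); fun_prop)) only [rid_eq_sw, sw_lTensor]
  simp

theorem sourceMapOp_eq (h : H) : εs' h = sw (Δ 1) fun a b => ε (b * h) • a := by
  simp (disch := ((repeat intro _); fun_prop)) only [sourceMapOp, rid_eq_sw, sw_lTensor]
  simp

@[fun_prop]
theorem isLinearMap_sourceMapOp : IsLinearMap k (εs') := by
  have : (εs') = fun h : H => sw (Δ 1) fun a b => ε (b * h) • a := funext sourceMapOp_eq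
  rw [this]
  fun_prop

theorem counit_mul_left'' (g l : H) :
    (sw (Δ 1) fun a b => ε (g * a) * ε (b * l)) = ε (g * l) := by
  rw [← counit_mul_left', mul_one]

theorem counit_mul_right'' (g l : H) :
    (sw (Δ 1) fun a b => ε (g * b) * ε (a * l)) = ε (g * l) := by
  rw [← counit_mul_right', mul_one]

variable (k) in
/-- The target map of the opposite weak bialgebra, `h ↦ ε(h 1₍₁₎) 1₍₂₎`. -/
noncomputable def targetMapOp (h : H) : H := sw (Δ 1) fun a b => ε (h * a) • b

local notation "εt'" => targetMapOp k

/-- By ε(g1₂)ε(1₁h) = ε(gh), the counit does not distinguish h from ε_t(h) in a right factor. The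
next three lemmas are the variants for the other counital maps. -/
theorem counit_mul_targetMap (g h : H) : ε (g * εt h) = ε (g * h) := by
  rw [targetMap_eq, ← counit_mul_right'' g h]
  simp (disch := ((repeat intro _); fun_prop)) only [mul_sw, linearMap_sw, mul_smul_comm, map_smul,
    smul_eq_mul, mul_comm]

theorem counit_mul_sourceMapOp (g h : H) : ε (g * εs' h) = ε (g * h) := by
  rw [sourceMapOp_eq, ← counit_mul_left'' g h]
  simp (disch := ((repeat intro _); fun_prop)) only [mul_sw, linearMap_sw, mul_smul_comm, map_smul,
    smul_eq_mul, mul_comm]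

theorem counit_sourceMap_mul (g h : H) : ε (εs g * h) = ε (g * h) := by
  rw [sourceMap_eq, ← counit_mul_right'' g h]
  simp (disch := ((repeat intro _); fun_prop)) only [sw_mul_const, linearMap_sw, smul_mul_assoc,
    map_smul, smul_eq_mul]

theorem counit_targetMapOp_mul (g h : H) : ε (εt' g * h) = ε (g * h) := by
  rw [targetMapOp, ← counit_mul_left'' g h]
  simp (disch := ((repeat intro _); fun_prop)) only [sw_mul_const, linearMap_sw, smul_mul_assoc,
    map_smul, smul_eq_mul]

/-- `h₍₁₎ ⊗ ε_t(h₍₂₎) = 1₍₁₎ h ⊗ 1₍₂₎` -/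
theorem sw_targetMap_right (h : H) (F : H → H → P)
    (h1 : ∀ b, IsLinearMap k fun a => F a b := by intros; fun_prop)
    (h2 : ∀ a, IsLinearMap k fun b => F a b := by intros; fun_prop) :
    (sw (Δ h) fun a b => F a (εt b)) = sw (Δ 1) fun a b => F (a * h) b := by
  calc (sw (Δ h) fun a b => F a (εt b))
      = sw (Δ 1) fun p q => sw (Δ h) fun a b => F (p * a) (εt (q * b)) :=
        (sw_comul_one_mul h fun a b => F a (εt b)).symm
    _ = sw (Δ h) fun a b => sw (Δ 1) fun p q => sw (Δ 1) fun c d =>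
          ε ((c * q) * b) • F (p * a) d := by
        rw [sw_comm]
        simp (disch := ((repeat intro _); fun_prop)) only [targetMap_eq, (h2 _).map_sw,
          (h2 _).map_smul, mul_assoc]
    -- The two copies of Δ(1) form Δ²(1). Regrouped by coassociativity, its first two legs are Δ(p),
    -- which multiplies Δ(h), so the counit removes the middle leg.
    _ = sw (Δ h) fun a b => sw (Δ 1) fun p q => sw (Δ p) fun c d =>
          ε (d * b) • F (c * a) q := by
        refine sw_congr _ fun a b => ?_
        rw [← sw_comul_one_right fun x y z => ε (y * b) • F (x * a) z]
        simp (disch := ((repeat intro _); fun_prop)) only [sw_coassoc]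
    _ = sw (Δ 1) fun p q => F (p * h) q := by
        rw [sw_comm]
        refine sw_congr _ fun p q => ?_
        rw [sw_comm, ← sw_comul_mul p h fun x y => ε y • F x q]
        exact sw_counit_right (p * h) fun x => F x q

/-- `ε_s(h₍₁₎) ⊗ h₍₂₎ = 1₍₁₎ ⊗ h 1₍₂₎` -/
theorem sw_sourceMap_left (h : H) (F : H → H → P)
    (h1 : ∀ b, IsLinearMap k fun a => F a b := by intros; fun_prop)
    (h2 : ∀ a, IsLinearMap k fun b => F a b := by intros; fun_prop) :
    (sw (Δ h) fun a b => F (εs a) b) = sw (Δ 1) fun a b => F a (h * b) := by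
  calc (sw (Δ h) fun a b => F (εs a) b)
      = sw (Δ h) fun a b => sw (Δ 1) fun p q => F (εs (a * p)) (b * q) :=
        (sw_comul_mul_one h fun a b => F (εs a) b).symm
    _ = sw (Δ h) fun a b => sw (Δ 1) fun c d => sw (Δ 1) fun p q =>
          ε (a * (p * d)) • F c (b * q) := by
        refine sw_congr _ fun a b => ?_
        rw [sw_comm]
        simp (disch := ((repeat intro _); fun_prop)) only [sourceMap_eq, (h1 _).map_sw,
          (h1 _).map_smul, mul_assoc]
    _ = sw (Δ h) fun a b => sw (Δ 1) fun c d => sw (Δ d) fun p q =>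
          ε (a * p) • F c (b * q) := by
        refine sw_congr _ fun a b => ?_
        rw [← sw_comul_one_right fun x y z => ε (a * y) • F x (b * z)]
    _ = sw (Δ 1) fun p q => F p (h * q) := by
        rw [sw_comm]
        refine sw_congr _ fun p q => ?_
        rw [← sw_comul_mul h q fun x y => ε x • F p y]
        exact sw_counit_left (h * q) fun y => F p y

/-- `ε̄_s(h₍₁₎) ⊗ h₍₂₎ = 1₍₁₎ ⊗ 1₍₂₎ h` -/
theorem sw_sourceMapOp_left (h : H) (F : H → H → P)
    (h1 : ∀ b, IsLinearMap k fun a => F a b := by intros; fun_prop)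
    (h2 : ∀ a, IsLinearMap k fun b => F a b := by intros; fun_prop) :
    (sw (Δ h) fun a b => F (εs' a) b) = sw (Δ 1) fun a b => F a (b * h) := by
  calc (sw (Δ h) fun a b => F (εs' a) b)
      = sw (Δ 1) fun p q => sw (Δ h) fun a b => F (εs' (p * a)) (q * b) :=
        (sw_comul_one_mul h fun a b => F (εs' a) b).symm
    _ = sw (Δ h) fun a b => sw (Δ 1) fun c d => sw (Δ 1) fun p q =>
          ε ((d * p) * a) • F c (q * b) := by
        rw [sw_comm]
        refine sw_congr _ fun a b => ?_
        rw [sw_comm]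
        simp (disch := ((repeat intro _); fun_prop)) only [sourceMapOp_eq, (h1 _).map_sw,
          (h1 _).map_smul, mul_assoc]
    _ = sw (Δ h) fun a b => sw (Δ 1) fun c d => sw (Δ d) fun p q =>
          ε (p * a) • F c (q * b) := by
        refine sw_congr _ fun a b => ?_
        rw [← sw_comul_one_left fun x y z => ε (y * a) • F x (z * b)]
    _ = sw (Δ 1) fun p q => F p (q * h) := by
        rw [sw_comm]
        refine sw_congr _ fun p q => ?_
        rw [sw_comm, ← sw_comul_mul q h fun x y => ε x • F p y]
        exact sw_counit_left (q * h) fun y => F p y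

/-- `1₍₁₎ ⊗ ε_t(1₍₂₎) = 1₍₁₎ ⊗ 1₍₂₎` -/
theorem sw_one_targetMap (F : H → H → P)
    (h1 : ∀ b, IsLinearMap k fun a => F a b := by intros; fun_prop)
    (h2 : ∀ a, IsLinearMap k fun b => F a b := by intros; fun_prop) :
    (sw (Δ (1 : H)) fun a b => F a (εt b)) = sw (Δ 1) F := by
  rw [sw_targetMap_right 1 F]; simp only [mul_one]

/-- With `sw_one_targetMap` this replaces the components a, b of Δ(1) by ε̄_s(a), ε_t(b). The
components of a chosen decomposition need not lie in the base algebras, but their images do, so the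
rules for legs become applicable under the sum. -/
theorem sw_one_sourceMapOp (F : H → H → P)
    (h1 : ∀ b, IsLinearMap k fun a => F a b := by intros; fun_prop)
    (h2 : ∀ a, IsLinearMap k fun b => F a b := by intros; fun_prop) :
    (sw (Δ (1 : H)) fun a b => F (εs' a) b) = sw (Δ 1) F := by
  rw [sw_sourceMapOp_left 1 F]; simp only [mul_one]

variable (k) in
/-- `z = φ(1₍₁₎) 1₍₂₎` for some linear form `φ`. -/
def IsRightLeg (z : H) : Prop := ∃ φ : H →ₗ[k] k, z = sw (Δ 1) fun a b => φ a • b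

variable (k) in
/-- `y = φ(1₍₂₎) 1₍₁₎` for some linear form `φ`. -/
def IsLeftLeg (y : H) : Prop := ∃ φ : H →ₗ[k] k, y = sw (Δ 1) fun a b => φ b • a

/-- All four counital maps take values in a leg of Δ(1) and differ only in the linear form, so facts
about legs serve several of them at once. -/
theorem isRightLeg_targetMap (h : H) : IsRightLeg k (εt h) :=
  ⟨Coalgebra.counit ∘ₗ LinearMap.mulRight k h, targetMap_eq h⟩

theorem isRightLeg_targetMapOp (h : H) : IsRightLeg k (εt' h) :=
  ⟨Coalgebra.counit ∘ₗ LinearMap.mulLeft k h, rfl⟩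

theorem isLeftLeg_sourceMap (h : H) : IsLeftLeg k (εs h) :=
  ⟨Coalgebra.counit ∘ₗ LinearMap.mulLeft k h, sourceMap_eq h⟩

theorem isLeftLeg_sourceMapOp (h : H) : IsLeftLeg k (εs' h) :=
  ⟨Coalgebra.counit ∘ₗ LinearMap.mulRight k h, sourceMapOp_eq h⟩

theorem IsRightLeg.targetMap_eq_self {z : H} (hz : IsRightLeg k z) : εt z = z := by
  obtain ⟨φ, rfl⟩ := hz
  simp (disch := ((repeat intro _); fun_prop)) only [linearMap_sw, map_smul]
  exact sw_one_targetMap fun a b => φ a • b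

theorem IsLeftLeg.sourceMapOp_eq_self {y : H} (hy : IsLeftLeg k y) : εs' y = y := by
  obtain ⟨φ, rfl⟩ := hy
  rw [map_sw (εs')]
  simp (disch := ((repeat intro _); fun_prop)) only [isLinearMap_sourceMapOp.map_smul]
  exact sw_one_sourceMapOp fun a b => φ b • a

/-- Applying φ to the first leg of Δ²(1) turns it into Δ(z). The second factorisation of Δ²(1) gives
this form; the first gives `IsRightLeg.sw_comul'`. -/
theorem IsRightLeg.sw_comul {z : H} (hz : IsRightLeg k z) (F : H → H → P)
    (h1 : ∀ b, IsLinearMap k fun a => F a b := by intros; fun_prop)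
    (h2 : ∀ a, IsLinearMap k fun b => F a b := by intros; fun_prop) :
    sw (Δ z) F = sw (Δ 1) fun a b => F (a * z) b := by
  obtain ⟨φ, rfl⟩ := hz
  calc _ = sw (Δ 1) fun a b => sw (Δ b) fun c d => φ a • F c d := by
        simp (disch := ((repeat intro _); fun_prop)) only [linearMap_sw,
          (isLinearMap_sw_left isLinearMap_id' h1 h2).map_sw, map_smul,
          (isLinearMap_sw_left isLinearMap_id' h1 h2).map_smul, smul_sw]
    _ = sw (Δ 1) fun a b => sw (Δ 1) fun c d => φ a • F (c * b) d :=
        sw_comul_one_right fun x y z => φ x • F y z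
    _ = _ := by
        rw [sw_comm]
        simp (disch := ((repeat intro _); fun_prop)) only [mul_sw, mul_smul_comm, (h1 _).map_sw,
          (h1 _).map_smul]

theorem IsRightLeg.sw_comul' {z : H} (hz : IsRightLeg k z) (F : H → H → P)
    (h1 : ∀ b, IsLinearMap k fun a => F a b := by intros; fun_prop)
    (h2 : ∀ a, IsLinearMap k fun b => F a b := by intros; fun_prop) :
    sw (Δ z) F = sw (Δ 1) fun a b => F (z * a) b := by
  obtain ⟨φ, rfl⟩ := hz
  calc _ = sw (Δ 1) fun a b => sw (Δ b) fun c d => φ a • F c d := by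
        simp (disch := ((repeat intro _); fun_prop)) only [linearMap_sw,
          (isLinearMap_sw_left isLinearMap_id' h1 h2).map_sw, map_smul,
          (isLinearMap_sw_left isLinearMap_id' h1 h2).map_smul, smul_sw]
    _ = sw (Δ 1) fun a b => sw (Δ 1) fun c d => φ a • F (b * c) d :=
        sw_comul_one_left fun x y z => φ x • F y z
    _ = _ := by
        rw [sw_comm]
        simp (disch := ((repeat intro _); fun_prop)) only [sw_mul_const, smul_mul_assoc,
          (h1 _).map_sw, (h1 _).map_smul]

/-- As for right legs, with φ applied to the last leg of Δ²(1); coassociativity first brings Δ onto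
the second factor. -/
theorem IsLeftLeg.sw_comul {y : H} (hy : IsLeftLeg k y) (F : H → H → P)
    (h1 : ∀ b, IsLinearMap k fun a => F a b := by intros; fun_prop)
    (h2 : ∀ a, IsLinearMap k fun b => F a b := by intros; fun_prop) :
    sw (Δ y) F = sw (Δ 1) fun a b => F a (b * y) := by
  obtain ⟨φ, rfl⟩ := hy
  calc _ = sw (Δ 1) fun a b => sw (Δ a) fun c d => φ b • F c d := by
        simp (disch := ((repeat intro _); fun_prop)) only [linearMap_sw,
          (isLinearMap_sw_left isLinearMap_id' h1 h2).map_sw, map_smul,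
          (isLinearMap_sw_left isLinearMap_id' h1 h2).map_smul, smul_sw]
    _ = sw (Δ 1) fun a b => sw (Δ 1) fun c d => φ d • F a (b * c) :=
        (sw_coassoc 1 fun x y z => φ z • F x y).trans
          (sw_comul_one_left fun x y z => φ z • F x y)
    _ = _ := by
        simp (disch := ((repeat intro _); fun_prop)) only [mul_sw, mul_smul_comm, (h2 _).map_sw,
          (h2 _).map_smul]

theorem IsLeftLeg.sw_comul' {y : H} (hy : IsLeftLeg k y) (F : H → H → P)
    (h1 : ∀ b, IsLinearMap k fun a => F a b := by intros; fun_prop)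
    (h2 : ∀ a, IsLinearMap k fun b => F a b := by intros; fun_prop) :
    sw (Δ y) F = sw (Δ 1) fun a b => F a (y * b) := by
  obtain ⟨φ, rfl⟩ := hy
  calc _ = sw (Δ 1) fun a b => sw (Δ a) fun c d => φ b • F c d := by
        simp (disch := ((repeat intro _); fun_prop)) only [linearMap_sw,
          (isLinearMap_sw_left isLinearMap_id' h1 h2).map_sw, map_smul,
          (isLinearMap_sw_left isLinearMap_id' h1 h2).map_smul, smul_sw]
    _ = sw (Δ 1) fun a b => sw (Δ 1) fun c d => φ d • F a (c * b) :=
        (sw_coassoc 1 fun x y z => φ z • F x y).trans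
          (sw_comul_one_right fun x y z => φ z • F x y)
    _ = _ := by
        simp (disch := ((repeat intro _); fun_prop)) only [sw_mul_const, smul_mul_assoc,
          (h2 _).map_sw, (h2 _).map_smul]

/-- Since Δ(z) = z1₁ ⊗ 1₂, the leftover Δ(1) is absorbed by Δ(h). In this and the next three lemmas
right legs end in the first tensor factor, left legs in the second. -/
theorem IsRightLeg.sw_comul_mul_left {z : H} (hz : IsRightLeg k z) (h : H) (F : H → H → P)
    (h1 : ∀ b, IsLinearMap k fun a => F a b := by intros; fun_prop)
    (h2 : ∀ a, IsLinearMap k fun b => F a b := by intros; fun_prop) :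
    sw (Δ (z * h)) F = sw (Δ h) fun a b => F (z * a) b := by
  simp (disch := ((repeat intro _); fun_prop)) only [WeakBialgebra.sw_comul_mul]
  rw [hz.sw_comul' fun a b => sw (Δ h) fun c d => F (a * c) (b * d),
    ← sw_comul_one_mul h fun a b => F (z * a) b]
  simp only [mul_assoc]

theorem IsRightLeg.sw_comul_mul_right {z : H} (hz : IsRightLeg k z) (h : H) (F : H → H → P)
    (h1 : ∀ b, IsLinearMap k fun a => F a b := by intros; fun_prop)
    (h2 : ∀ a, IsLinearMap k fun b => F a b := by intros; fun_prop) :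
    sw (Δ (h * z)) F = sw (Δ h) fun a b => F (a * z) b := by
  simp (disch := ((repeat intro _); fun_prop)) only [WeakBialgebra.sw_comul_mul]
  rw [sw_comm, hz.sw_comul fun c d => sw (Δ h) fun a b => F (a * c) (b * d), sw_comm,
    ← sw_comul_mul_one h fun a b => F (a * z) b]
  simp only [mul_assoc]

theorem IsLeftLeg.sw_comul_mul_left {y : H} (hy : IsLeftLeg k y) (h : H) (F : H → H → P)
    (h1 : ∀ b, IsLinearMap k fun a => F a b := by intros; fun_prop)
    (h2 : ∀ a, IsLinearMap k fun b => F a b := by intros; fun_prop) :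
    sw (Δ (y * h)) F = sw (Δ h) fun a b => F a (y * b) := by
  simp (disch := ((repeat intro _); fun_prop)) only [WeakBialgebra.sw_comul_mul]
  rw [hy.sw_comul' fun a b => sw (Δ h) fun c d => F (a * c) (b * d),
    ← sw_comul_one_mul h fun a b => F a (y * b)]
  simp only [mul_assoc]

theorem IsLeftLeg.sw_comul_mul_right {y : H} (hy : IsLeftLeg k y) (h : H) (F : H → H → P)
    (h1 : ∀ b, IsLinearMap k fun a => F a b := by intros; fun_prop)
    (h2 : ∀ a, IsLinearMap k fun b => F a b := by intros; fun_prop) :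
    sw (Δ (h * y)) F = sw (Δ h) fun a b => F a (b * y) := by
  simp (disch := ((repeat intro _); fun_prop)) only [WeakBialgebra.sw_comul_mul]
  rw [sw_comm, hy.sw_comul fun c d => sw (Δ h) fun a b => F (a * c) (b * d), sw_comm,
    ← sw_comul_mul_one h fun a b => F a (b * y)]
  simp only [mul_assoc]

/-- The two factorisations of Δ²(1) differ only in the order of the product in the middle; applying
φ and ψ to the outer legs isolates that product. -/
theorem IsRightLeg.mul_comm {z y : H} (hz : IsRightLeg k z) (hy : IsLeftLeg k y) :
    z * y = y * z := by
  obtain ⟨φ, rfl⟩ := hz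
  obtain ⟨ψ, rfl⟩ := hy
  have key := (sw_comul_one_left (k := k) fun x y z : H => (φ x * ψ z) • y).symm.trans
    (sw_comul_one_right (k := k) fun x y z : H => (φ x * ψ z) • y)
  simp only [sw_mul_const, mul_sw, smul_mul_smul_comm]
  rw [sw_comm, key]
  simp only [_root_.mul_comm (φ _)]

end Calculus
end WeakBialgebra

/-! ### The counital maps and the base algebras. -/

namespace WeakBialgebra

section BaseAlgebras

variable {k H P : Type u} [CommRing k] [Ring H] [WeakBialgebra k H] [AddCommGroup P] [Module k P]

local notation "Δ" => Coalgebra.comul (R := k)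
local notation "ε" => Coalgebra.counit (R := k)
local notation "εt" => targetMap k H
local notation "εs" => sourceMap k H
local notation "εs'" => sourceMapOp k H
local notation "εt'" => targetMapOp k

@[simp]
theorem targetMap_targetMap (h : H) : εt (εt h) = εt h :=
  (isRightLeg_targetMap h).targetMap_eq_self

theorem targetMap_mul_targetMap (g h : H) : εt (g * εt h) = εt (g * h) := by
  simp only [targetMap_eq (g * _), ← mul_assoc, counit_mul_targetMap]

theorem sourceMapOp_targetMap (h : H) : εs' (εt h) = εs' h := by
  simp only [sourceMapOp_eq, counit_mul_targetMap]

theorem targetMap_one : εt (1 : H) = 1 := by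
  rw [targetMap_eq]
  simp only [mul_one]
  exact sw_counit_left (1 : H) fun x => x

theorem sourceMapOp_one : εs' (1 : H) = 1 := by
  rw [sourceMapOp_eq]
  simp only [mul_one]
  exact sw_counit_right (1 : H) fun x => x

theorem sourceMap_one : εs (1 : H) = 1 := by
  rw [sourceMap_eq]
  simp only [one_mul]
  exact sw_counit_right (1 : H) fun x => x

/-- `ε(h₍₁₎ g) h₍₂₎ = h ε_t(g)` -/
theorem sw_counit_mul_smul_right (h g : H) (F : H → P) (hF : IsLinearMap k F := by fun_prop) :
    (sw (Δ h) fun a b => ε (a * g) • F b) = F (h * εt g) := by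
  rw [← sw_counit_left (h * εt g) F,
    (isRightLeg_targetMap g).sw_comul_mul_right h fun a b => ε a • F b]
  simp only [counit_mul_targetMap]

/-- `ε(h₍₂₎ g) h₍₁₎ = h ε̄_s(g)` -/
theorem sw_counit_mul_smul_left (h g : H) (F : H → P) (hF : IsLinearMap k F := by fun_prop) :
    (sw (Δ h) fun a b => ε (b * g) • F a) = F (h * εs' g) := by
  rw [← sw_counit_right (h * εs' g) F,
    (isLeftLeg_sourceMapOp g).sw_comul_mul_right h fun a b => ε b • F a]
  simp only [counit_mul_sourceMapOp]

/-- `ε(g h₍₁₎) h₍₂₎ = ε̄_t(g) h` -/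
theorem sw_counit_mul_left_smul_right (g h : H) (F : H → P)
    (hF : IsLinearMap k F := by fun_prop) :
    (sw (Δ h) fun a b => ε (g * a) • F b) = F (εt' g * h) := by
  rw [← sw_counit_left (εt' g * h) F,
    (isRightLeg_targetMapOp g).sw_comul_mul_left h fun a b => ε a • F b]
  simp only [counit_targetMapOp_mul]

theorem IsRightLeg.targetMap_mul {z : H} (hz : IsRightLeg k z) (h : H) :
    εt (z * h) = z * εt h := by
  rw [← sw_counit_mul_smul_right z h fun x => x, hz.sw_comul fun a b => ε (a * h) • b,
    targetMap_eq]
  simp only [mul_assoc]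

/-- `ε_t(h₍₁₎ z) h₍₂₎ = h z` for `z` in the target space -/
theorem IsRightLeg.sw_targetMap_mul {z : H} (hz : IsRightLeg k z) (h : H) (F : H → P)
    (hF : IsLinearMap k F := by fun_prop) :
    (sw (Δ h) fun a b => F (εt (a * z) * b)) = F (h * z) := by
  have h1 : (sw (Δ h) fun a b => εt (a * z) * b) = h * z := by
    simp only [targetMap_eq, sw_mul_const, smul_mul_assoc, ← mul_assoc]
    rw [sw_comm, sw_comul_one_mul h fun a b => ε (a * z) • b,
      sw_counit_mul_smul_right h z fun x => x, hz.targetMap_eq_self]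
  rw [← h1, hF.map_sw]

/-- `ε̄_s(h₍₂₎ g) h₍₁₎ = h ε̄_s(g)` -/
theorem sw_sourceMapOp_mul (h g : H) (F : H → P) (hF : IsLinearMap k F := by fun_prop) :
    (sw (Δ h) fun a b => F (εs' (b * g) * a)) = F (h * εs' g) := by
  have h1 : (sw (Δ h) fun a b => εs' (b * g) * a) = h * εs' g := by
    simp only [sourceMapOp_eq (_ * g), sw_mul_const, smul_mul_assoc, ← mul_assoc]
    rw [sw_comm, sw_comul_one_mul h fun a b => ε (b * g) • a,
      sw_counit_mul_smul_left h g fun x => x]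
  rw [← h1, hF.map_sw]

theorem sw_sourceMapOp_mul_one (h : H) (F : H → P) (hF : IsLinearMap k F := by fun_prop) :
    (sw (Δ h) fun a b => F (εs' b * a)) = F h := by
  simpa only [mul_one, sourceMapOp_one] using sw_sourceMapOp_mul h 1 F

/-- `ε_t(h₍₁₎) ⊗ h₍₂₎ = ε_t(1₍₁₎) ⊗ 1₍₂₎ h` -/
theorem sw_targetMap_left (h : H) (F : H → H → P)
    (h1 : ∀ b, IsLinearMap k fun a => F a b := by intros; fun_prop)
    (h2 : ∀ a, IsLinearMap k fun b => F a b := by intros; fun_prop) :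
    (sw (Δ h) fun a b => F (εt a) b) = sw (Δ 1) fun a b => F (εt a) (b * h) := by
  -- ε_t(g₁) ⊗ g₂ = 1₂ ⊗ ε̄_t(1₁)g depends on g only through right multiplication in the second
  -- factor. Comparing g = h with g = 1 gives the claim.
  have key : ∀ (g : H) (G : H → H → P) (_ : ∀ b, IsLinearMap k fun a => G a b)
      (_ : ∀ a, IsLinearMap k fun b => G a b), (sw (Δ g) fun a b => G (εt a) b) =
        sw (Δ 1) fun c d => G d (εt' c * g) := by
    intro g G hG1 hG2
    calc (sw (Δ g) fun a b => G (εt a) b) =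
          sw (Δ 1) fun c d => sw (Δ g) fun a b => ε (c * a) • G d b := by
          rw [sw_comm]
          simp (disch := ((repeat intro _); fun_prop)) only [targetMap_eq, (hG1 _).map_sw,
            (hG1 _).map_smul]
      _ = _ := sw_congr _ fun c d => sw_counit_mul_left_smul_right c g fun x => G d x
  rw [key h F h1 h2, key 1 (fun a b => F a (b * h)) (by intros; fun_prop) (by intros; fun_prop)]
  simp only [mul_one]

/-- `1₍₁₎ ⊗ ε_t(1₍₂₎ g) = 1₍₁₎ ε̄_s(g) ⊗ 1₍₂₎` -/
theorem sw_one_targetMap_mul (g : H) (F : H → H → P)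
    (h1 : ∀ b, IsLinearMap k fun a => F a b := by intros; fun_prop)
    (h2 : ∀ a, IsLinearMap k fun b => F a b := by intros; fun_prop) :
    (sw (Δ 1) fun a b => F a (εt (b * g))) = sw (Δ 1) fun a b => F (a * εs' g) b := by
  calc (sw (Δ 1) fun a b => F a (εt (b * g)))
      = sw (Δ 1) fun a b => sw (Δ 1) fun c d => ε ((c * b) * g) • F a d := by
        simp (disch := ((repeat intro _); fun_prop)) only [targetMap_eq, (h2 _).map_sw,
          (h2 _).map_smul, mul_assoc]
    _ = sw (Δ 1) fun a b => sw (Δ a) fun c d => ε (d * g) • F c b :=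
        ((sw_coassoc 1 fun x y z => ε (y * g) • F x z).trans
          (sw_comul_one_right fun x y z => ε (y * g) • F x z)).symm
    _ = _ := sw_congr _ fun a b => sw_counit_mul_smul_left a g fun x => F x b

/-- `1₍₁₎ ⊗ 1₍₂₎ z = 1₍₁₎ ε̄_s(z) ⊗ 1₍₂₎` for `z` in the target space -/
theorem IsRightLeg.sw_one_mul {z : H} (hz : IsRightLeg k z) (F : H → H → P)
    (h1 : ∀ b, IsLinearMap k fun a => F a b := by intros; fun_prop)
    (h2 : ∀ a, IsLinearMap k fun b => F a b := by intros; fun_prop) :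
    (sw (Δ 1) fun a b => F a (b * z)) = sw (Δ 1) fun a b => F (a * εs' z) b := by
  rw [← sw_one_targetMap fun a b => F a (b * z), ← sw_one_targetMap_mul z F,
    ← sw_one_targetMap fun a b => F a (εt (b * z))]
  refine sw_congr _ fun a b => ?_
  rw [(isRightLeg_targetMap b).targetMap_mul, hz.targetMap_eq_self]

end BaseAlgebras
end WeakBialgebra

namespace TensorProduct

theorem assoc_tmul_eq_sw {k A B C : Type*} [CommSemiring k] [AddCommMonoid A] [Module k A]
    [AddCommMonoid B] [Module k B] [AddCommMonoid C] [Module k C] (t : A ⊗[k] B) (c : C) :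
    TensorProduct.assoc k A B C (t ⊗ₜ c) = sw t fun a b => a ⊗ₜ (b ⊗ₜ c) := by
  conv_lhs => rw [← sw_tmul_self t]
  simp only [sw_tmul_const, linearEquiv_sw, assoc_tmul]

end TensorProduct

/-! ### The tensor product of modules over a weak bialgebra -/

namespace WeakBialgebra

section TensorModule

variable {k H : Type u} [CommRing k] [Ring H] [WeakBialgebra k H]
variable {M N Q : Type u} [AddCommGroup M] [Module k M] [Module H M] [IsScalarTower k H M]
  [AddCommGroup N] [Module k N] [Module H N] [IsScalarTower k H N] [AddCommGroup Q] [Module k Q]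

local notation "Δ" => Coalgebra.comul (R := k)

theorem diagAct_tmul (h : H) (m : M) (n : N) :
    diagAct k M N h (m ⊗ₜ n) = sw (Δ h) fun a b => (a • m) ⊗ₜ (b • n) := by
  rw [diagAct]
  conv_lhs => rw [← sw_tmul_self (Δ h)]
  rw [map_sw (fun x => tensorAct k M N x (m ⊗ₜ n))]
  simp [tensorAct]

theorem diagAct_eq_sw (h : H) (x : M ⊗[k] N) :
    diagAct k M N h x = sw (Δ h) fun a b => sw x fun m n => (a • m) ⊗ₜ (b • n) := by
  conv_lhs => rw [← sw_tmul_self x]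
  simp only [linearMap_sw, diagAct_tmul]
  rw [sw_comm]

/-- Multiplicativity of Δ makes the diagonal action associative. In particular Δ(1) acts as an
idempotent, and on its image the action is unital. -/
theorem diagAct_mul (g h : H) (x : M ⊗[k] N) :
    diagAct k M N (g * h) x = diagAct k M N g (diagAct k M N h x) := by
  induction x with
  | zero => simp
  | add x y hx hy => simp [hx, hy]
  | tmul m n =>
    simp only [diagAct_tmul, linearMap_sw]
    simp (disch := ((repeat intro _); fun_prop)) only [sw_comul_mul, mul_smul]
    rw [sw_comm]

theorem diagAct_one_diagAct (h : H) (x : M ⊗[k] N) :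
    diagAct k M N (1 : H) (diagAct k M N h x) = diagAct k M N h x := by
  rw [← diagAct_mul, one_mul]

theorem diagAct_diagAct_one (h : H) (x : M ⊗[k] N) :
    diagAct k M N h (diagAct k M N (1 : H) x) = diagAct k M N h x := by
  rw [← diagAct_mul, mul_one]

theorem diagAct_add (g h : H) (x : M ⊗[k] N) :
    diagAct k M N (g + h) x = diagAct k M N g x + diagAct k M N h x := by
  rw [diagAct, map_add, map_add]; rfl

theorem diagAct_zero (x : M ⊗[k] N) : diagAct k M N (0 : H) x = 0 := by
  rw [diagAct, map_zero, map_zero]; rfl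

theorem diagAct_smul (c : k) (h : H) (x : M ⊗[k] N) :
    diagAct k M N (c • h) x = c • diagAct k M N h x := by
  rw [diagAct, map_smul, map_smul]; rfl

theorem mem_tensorT_iff {x : M ⊗[k] N} : x ∈ tensorT k H M N ↔ diagAct k M N (1 : H) x = x :=
  ⟨by rintro ⟨y, rfl⟩; exact diagAct_one_diagAct 1 y, fun h => ⟨x, h⟩⟩

theorem diagAct_one_coe (x : tensorT k H M N) : diagAct k M N (1 : H) x = x :=
  mem_tensorT_iff.1 x.2

noncomputable instance tensorTModule : Module H (tensorT k H M N) where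
  smul h x := ⟨diagAct k M N h x, mem_tensorT_iff.2 (diagAct_one_diagAct h (x : M ⊗[k] N))⟩
  one_smul x := Subtype.ext (diagAct_one_coe x)
  mul_smul g h x := Subtype.ext (diagAct_mul g h (x : M ⊗[k] N))
  smul_zero _ := Subtype.ext (map_zero _)
  smul_add _ _ _ := Subtype.ext (map_add _ _ _)
  add_smul g h x := Subtype.ext (diagAct_add g h (x : M ⊗[k] N))
  zero_smul x := Subtype.ext (diagAct_zero (H := H) (x : M ⊗[k] N))

theorem tensorT_coe_smul (h : H) (x : tensorT k H M N) :
    ((h • x : tensorT k H M N) : M ⊗[k] N) = diagAct k M N h x := rfl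

instance : IsScalarTower k H (tensorT k H M N) where
  smul_assoc c h x := Subtype.ext (diagAct_smul c h (x : M ⊗[k] N))

theorem coe_projT (x : M ⊗[k] N) : (projT k H M N x : M ⊗[k] N) = diagAct k M N (1 : H) x := rfl

theorem projT_coe (x : tensorT k H M N) : projT k H M N (x : M ⊗[k] N) = x :=
  Subtype.ext (diagAct_one_coe x)

theorem coe_sw {A B : Type*} [AddCommGroup A] [Module k A] [AddCommGroup B] [Module k B]
    (S : Submodule k Q) (t : A ⊗[k] B) (F : A → B → S) :
    ((sw t F : S) : Q) = sw t fun a b => (F a b : Q) :=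
  linearMap_sw S.subtype t F

theorem smul_projT (h : H) (m : M) (n : N) :
    h • projT k H M N (m ⊗ₜ n) = sw (Δ h) fun a b => projT k H M N ((a • m) ⊗ₜ (b • n)) := by
  refine Subtype.ext ?_
  rw [tensorT_coe_smul, coe_projT, diagAct_diagAct_one, coe_sw, ← diagAct_one_diagAct,
    diagAct_tmul, linearMap_sw]
  rfl

/-- The relation between generators by which a superfluous Δ(1) in front of m ⊗ n is inserted or
dropped. -/
theorem projT_one (m : M) (n : N) :
    (sw (Δ (1 : H)) fun a b => projT k H M N ((a • m) ⊗ₜ (b • n))) = projT k H M N (m ⊗ₜ n) := by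
  rw [← smul_projT, one_smul]

/-- Linear maps on `M ⊗_t N` that agree on the elements `1₍₁₎ m ⊗ 1₍₂₎ n` agree. -/
theorem tensorT_ext (f g : tensorT k H M N → Q)
    (h : ∀ m n, f (projT k H M N (m ⊗ₜ n)) = g (projT k H M N (m ⊗ₜ n)))
    (hf : IsLinearMap k f := by fun_prop) (hg : IsLinearMap k g := by fun_prop)
    (x : tensorT k H M N) : f x = g x := by
  have key : hf.mk' f ∘ₗ projT k H M N = hg.mk' g ∘ₗ projT k H M N :=
    TensorProduct.ext' h
  rw [← projT_coe x]
  exact LinearMap.congr_fun key x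

theorem coactMulRight_eq_sw (c : M →ₗ[k] H ⊗[k] M) (m : M) (t : H ⊗[k] H) :
    coactMulRight c m t = sw t fun a b => sw (c (a • m)) fun u n => (u * b) ⊗ₜ n := by
  conv_lhs => rw [← sw_tmul_self t]
  rw [linearMap_sw]
  refine sw_congr _ fun a b => ?_
  simp [coactMulRight, rTensor_eq_sw]

end TensorModule

end WeakBialgebra

/-! ### Yetter-Drinfeld modules in Sweedler notation -/

namespace YDModule

open WeakBialgebra

section Calculus

variable {k H : Type u} [CommRing k] [Ring H] [WeakBialgebra k H] {P : Type u} [AddCommGroup P]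
  [Module k P] (M N : YDModule k H)

local notation "Δ" => Coalgebra.comul (R := k)
local notation "ε" => Coalgebra.counit (R := k)
local notation "εt" => targetMap k H
local notation "εs'" => sourceMapOp k H

theorem sw_coact_coassoc (m : M) (T : H → H → M → P)
    (h1 : ∀ b c, IsLinearMap k fun a => T a b c := by intros; fun_prop)
    (h2 : ∀ a c, IsLinearMap k fun b => T a b c := by intros; fun_prop)
    (h3 : ∀ a b, IsLinearMap k fun c => T a b c := by intros; fun_prop) :
    (sw (M.coact m) fun u n => sw (Δ u) fun p q => T p q n) =
      sw (M.coact m) fun u n => sw (M.coact n) fun v n' => T u v n' := by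
  rw [← sw_lTensor M.coact (M.coact m) (fun a x => sw x fun c d => T a c d), ← M.coassoc]
  simp (disch := ((repeat intro _); fun_prop)) only [sw_assoc, sw_rTensor, sw_tmul]

theorem sw_coact_counit (m : M) (F : M → P) (hF : IsLinearMap k F := by fun_prop) :
    (sw (M.coact m) fun u n => ε u • F n) = F m := by
  conv_rhs => rw [← M.counit m, lid_eq_sw, hF.map_sw]
  simp (disch := ((repeat intro _); fun_prop)) only [sw_rTensor, hF.map_smul]

theorem sw_coact_one (m : M) (F : H → M → P)
    (h1 : ∀ b, IsLinearMap k fun a => F a b := by intros; fun_prop)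
    (h2 : ∀ a, IsLinearMap k fun b => F a b := by intros; fun_prop) :
    (sw (Δ (1 : H)) fun a b => sw (M.coact m) fun u n => F (a * u) (b • n)) =
      sw (M.coact m) F := by
  conv_rhs => rw [← mem_tensorT_iff.1 (M.coact_mem m), diagAct_eq_sw]
  simp (disch := ((repeat intro _); fun_prop)) only
    [(isLinearMap_sw_left isLinearMap_id' h1 h2).map_sw, sw_tmul, smul_eq_mul]

theorem sw_compat (h : H) (m : M) (F : H → M → P)
    (h1 : ∀ b, IsLinearMap k fun a => F a b := by intros; fun_prop)
    (h2 : ∀ a, IsLinearMap k fun b => F a b := by intros; fun_prop) :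
    (sw (Δ h) fun a b => sw (M.coact (a • m)) fun u n => F (u * b) n) =
      sw (Δ h) fun a b => sw (M.coact m) fun u n => F (a * u) (b • n) := by
  have := congrArg (fun x => sw x F) (M.compat h m)
  rw [coactMulRight_eq_sw, diagAct_eq_sw] at this
  simpa (disch := ((repeat intro _); fun_prop)) only
    [(isLinearMap_sw_left isLinearMap_id' h1 h2).map_sw, sw_tmul, smul_eq_mul] using this.symm

/-- Compatibility at h = 1 turns the left side into Δ(1)λ(m), which is λ(m) because λ(m) lies in H
⊗_t M. -/
theorem sw_coact_one' (m : M) (F : H → M → P)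
    (h1 : ∀ b, IsLinearMap k fun a => F a b := by intros; fun_prop)
    (h2 : ∀ a, IsLinearMap k fun b => F a b := by intros; fun_prop) :
    (sw (Δ (1 : H)) fun a b => sw (M.coact (a • m)) fun u n => F (u * b) n) =
      sw (M.coact m) F := by
  rw [sw_compat M 1 m F, sw_coact_one M m F]

/-- `λ(zm) = z m₍₋₁₎ ⊗ m₍₀₎` for `z` in the target space -/
theorem sw_coact_rightLeg_smul {z : H} (hz : IsRightLeg k z) (m : M) (F : H → M → P)
    (h1 : ∀ b, IsLinearMap k fun a => F a b := by intros; fun_prop)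
    (h2 : ∀ a, IsLinearMap k fun b => F a b := by intros; fun_prop) :
    sw (M.coact (z • m)) F = sw (M.coact m) fun u n => F (z * u) n := by
  -- Both sides acquire a Δ(1), which together with z becomes Δ(z), as 1₁z ⊗ 1₂ on the left and as
  -- z1₁ ⊗ 1₂ on the right. The equality is then compatibility at z.
  rw [← sw_coact_one' M (z • m) F, ← sw_coact_one M m fun u n => F (z * u) n]
  simp only [smul_smul, ← mul_assoc]
  rw [← hz.sw_comul fun a b => sw (M.coact (a • m)) fun u n => F (u * b) n, sw_compat M z m F,
    hz.sw_comul' fun a b => sw (M.coact m) fun u n => F (a * u) (b • n)]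

/-- `m₍₋₁₎ ⊗ y m₍₀₎ = m₍₋₁₎ y ⊗ m₍₀₎` for `y` in the source space -/
theorem sw_coact_leftLeg {y : H} (hy : IsLeftLeg k y) (m : M) (F : H → M → P)
    (h1 : ∀ b, IsLinearMap k fun a => F a b := by intros; fun_prop)
    (h2 : ∀ a, IsLinearMap k fun b => F a b := by intros; fun_prop) :
    (sw (M.coact m) fun u n => F u (y • n)) = sw (M.coact m) fun u n => F (u * y) n := by
  have := sw_compat M y m F
  rw [hy.sw_comul fun a b => sw (M.coact (a • m)) fun u n => F (u * b) n,
    hy.sw_comul' fun a b => sw (M.coact m) fun u n => F (a * u) (b • n)] at this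
  simp only [mul_smul, ← mul_assoc] at this
  rw [sw_coact_one' M m fun u n => F (u * y) n, sw_coact_one M m fun u n => F u (y • n)] at this
  exact this.symm

theorem sw_counit_coact_mul_leftLeg {y : H} (hy : IsLeftLeg k y) (m : M) (F : M → P)
    (hF : IsLinearMap k F := by fun_prop) :
    (sw (M.coact m) fun u n => ε (u * y) • F n) = F (y • m) := by
  rw [← sw_coact_leftLeg M hy m fun u n => ε u • F n, sw_coact_counit M m fun n => F (y • n)]

/-- Under ε the factor z may be replaced by ε̄_s(z), a left leg, which then moves from the coaction
to the module. -/
theorem sw_counit_coact_mul (z : H) (m : M) (F : M → P)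
    (hF : IsLinearMap k F := by fun_prop) :
    (sw (M.coact m) fun u n => ε (u * z) • F n) = F (εs' z • m) := by
  rw [← sw_counit_coact_mul_leftLeg M (isLeftLeg_sourceMapOp z) m F]
  simp only [counit_mul_sourceMapOp]

theorem sw_counit_mul_coact {z : H} (hz : IsRightLeg k z) (m : M) (F : M → P)
    (hF : IsLinearMap k F := by fun_prop) :
    (sw (M.coact m) fun u n => ε (z * u) • F n) = F (z • m) := by
  rw [← sw_coact_rightLeg_smul M hz m fun u n => ε u • F n, sw_coact_counit M (z • m) F]

/-- `λ(ε̄_s(z) m) = m₍₋₁₎ z ⊗ m₍₀₎` for `z` in the target space -/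
theorem sw_coact_sourceMapOp_smul {z : H} (hz : IsRightLeg k z) (m : M) (F : H → M → P)
    (h1 : ∀ b, IsLinearMap k fun a => F a b := by intros; fun_prop)
    (h2 : ∀ a, IsLinearMap k fun b => F a b := by intros; fun_prop) :
    sw (M.coact (εs' z • m)) F = sw (M.coact m) fun u n => F (u * z) n := by
  -- Writing ε̄_s(z)m as ε(m₋₁z)m₀ makes coassociativity of the coaction applicable.
  rw [← sw_counit_coact_mul M z m fun n => sw (M.coact n) F]
  simp only [smul_sw]
  rw [← sw_coact_coassoc M m fun u v n => ε (u * z) • F v n]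
  refine sw_congr _ fun u n => ?_
  rw [sw_counit_mul_smul_right u z fun v => F v n, hz.targetMap_eq_self]

theorem tensorCoact_tmul (m : M) (n : N) :
    tensorCoact M N (m ⊗ₜ n) =
      sw (M.coact m) fun u m' => sw (N.coact n) fun v n' => (u * v) ⊗ₜ (m' ⊗ₜ n') := by
  simp only [tensorCoact, LinearMap.comp_apply, TensorProduct.map_tmul, LinearEquiv.coe_coe]
  conv_lhs => rw [← sw_tmul_self (M.coact m), ← sw_tmul_self (N.coact n)]
  simp only [sw_tmul_const, tmul_sw, linearEquiv_sw, linearMap_sw,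
    TensorProduct.tensorTensorTensorComm_tmul, LinearMap.rTensor_tmul, LinearMap.mul'_apply]
  rw [sw_comm]

/-- The coaction on `M ⊗_t N`. -/
noncomputable def coactT : tensorT k H M N →ₗ[k] H ⊗[k] tensorT k H M N :=
  (projT k H M N).lTensor H ∘ₗ tensorCoact M N ∘ₗ (tensorT k H M N).subtype

/-- The coaction is computed on 1₁m ⊗ 1₂n. The factor 1₂, taken in H_t, leaves λ(1₂n) on the left
and produces (1₁m)₋₁1₂, which `sw_coact_one'` reduces to m₋₁. -/
theorem coactT_projT (m : M) (n : N) :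
    coactT M N (projT k H M N (m ⊗ₜ n)) =
      sw (M.coact m) fun u m' => sw (N.coact n) fun v n' =>
        (u * v) ⊗ₜ projT k H M N (m' ⊗ₜ n') := by
  simp only [coactT, LinearMap.comp_apply, Submodule.subtype_apply, coe_projT, diagAct_tmul,
    linearMap_sw, tensorCoact_tmul, LinearMap.lTensor_tmul]
  calc _ = sw (Δ (1 : H)) fun a b => sw (M.coact (a • m)) fun u m' => sw (N.coact (εt b • n))
        fun v n' => (u * v) ⊗ₜ[k] projT k H M N (m' ⊗ₜ n') :=
      (sw_one_targetMap fun a b => sw (M.coact (a • m)) fun u m' => sw (N.coact (b • n))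
        fun v n' => (u * v) ⊗ₜ[k] projT k H M N (m' ⊗ₜ n')).symm
    _ = sw (Δ (1 : H)) fun a b => sw (M.coact (a • m)) fun u m' => sw (N.coact n)
        fun v n' => (u * (εt b * v)) ⊗ₜ[k] projT k H M N (m' ⊗ₜ n') :=
      sw_congr _ fun a b => sw_congr _ fun u m' =>
        sw_coact_rightLeg_smul N (isRightLeg_targetMap b) n fun v n' =>
          (u * v) ⊗ₜ[k] projT k H M N (m' ⊗ₜ n')
    _ = sw (Δ (1 : H)) fun a b => sw (M.coact (a • m)) fun u m' => sw (N.coact n)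
        fun v n' => ((u * b) * v) ⊗ₜ[k] projT k H M N (m' ⊗ₜ n') := by
      simp only [mul_assoc]
      exact sw_one_targetMap fun a b => sw (M.coact (a • m)) fun u m' => sw (N.coact n)
        fun v n' => (u * (b * v)) ⊗ₜ[k] projT k H M N (m' ⊗ₜ n')
    _ = _ := sw_coact_one' M m fun u m' => sw (N.coact n)
        fun v n' => (u * v) ⊗ₜ[k] projT k H M N (m' ⊗ₜ n')

theorem coactT_coassoc (x : tensorT k H M N) :
    TensorProduct.assoc k H H (tensorT k H M N)
        ((Coalgebra.comul (R := k) (A := H)).rTensor (tensorT k H M N) (coactT M N x)) =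
      (coactT M N).lTensor H (coactT M N x) := by
  refine tensorT_ext (fun x => TensorProduct.assoc k H H (tensorT k H M N)
      ((Coalgebra.comul (R := k) (A := H)).rTensor (tensorT k H M N) (coactT M N x)))
      (fun x => (coactT M N).lTensor H (coactT M N x)) (fun m n => ?_) (by fun_prop) (by fun_prop) x
  simp only [coactT_projT, linearMap_sw, linearEquiv_sw, LinearMap.rTensor_tmul,
    LinearMap.lTensor_tmul, TensorProduct.assoc_tmul_eq_sw, tmul_sw]
  simp (disch := ((repeat intro _); fun_prop)) only [sw_comul_mul]
  calc _ = sw (M.coact m) fun u m' => sw (Δ u) fun p q => sw (N.coact n) fun v n' =>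
          sw (Δ v) fun r s => (p * r) ⊗ₜ[k] ((q * s) ⊗ₜ[k] projT k H M N (m' ⊗ₜ n')) :=
        sw_congr _ fun u m' => sw_comm _ _ _
    _ = sw (M.coact m) fun u m' => sw (M.coact m') fun u' m'' => sw (N.coact n) fun v n' =>
          sw (Δ v) fun r s => (u * r) ⊗ₜ[k] ((u' * s) ⊗ₜ[k] projT k H M N (m'' ⊗ₜ n')) :=
        sw_coact_coassoc M m fun p q m' => sw (N.coact n) fun v n' =>
          sw (Δ v) fun r s => (p * r) ⊗ₜ[k] ((q * s) ⊗ₜ[k] projT k H M N (m' ⊗ₜ n'))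
    _ = sw (M.coact m) fun u m' => sw (M.coact m') fun u' m'' => sw (N.coact n) fun v n' =>
          sw (N.coact n') fun v' n'' =>
            (u * v) ⊗ₜ[k] ((u' * v') ⊗ₜ[k] projT k H M N (m'' ⊗ₜ n'')) :=
        sw_congr _ fun u m' => sw_congr _ fun u' m'' => sw_coact_coassoc N n fun p q n' =>
          (u * p) ⊗ₜ[k] ((u' * q) ⊗ₜ[k] projT k H M N (m'' ⊗ₜ n'))
    _ = _ := sw_congr _ fun u m' => sw_comm _ _ _

/-- The counit is not multiplicative, but ε(uv) = ε(u1₁)ε(1₂v). The two factors turn into the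
actions of 1₁ on m and of 1₂ on n, and the projection absorbs this Δ(1). -/
theorem coactT_counit (x : tensorT k H M N) :
    TensorProduct.lid k (tensorT k H M N)
      ((Coalgebra.counit (R := k) (A := H)).rTensor (tensorT k H M N) (coactT M N x)) = x := by
  refine tensorT_ext (fun x => TensorProduct.lid k (tensorT k H M N)
      ((Coalgebra.counit (R := k) (A := H)).rTensor (tensorT k H M N) (coactT M N x)))
      (fun x => x) (fun m n => ?_) (by fun_prop) (by fun_prop) x
  simp only [coactT_projT, linearMap_sw, linearEquiv_sw, LinearMap.rTensor_tmul,
    TensorProduct.lid_tmul]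
  calc _ = sw (Δ (1 : H)) fun a b => sw (M.coact m) fun u m' => ε (u * a) •
          sw (N.coact n) fun v n' => ε (b * v) • projT k H M N (m' ⊗ₜ n') := by
        rw [sw_comm (Δ (1 : H))]
        refine sw_congr _ fun u m' => ?_
        simp only [smul_sw]
        rw [sw_comm (Δ (1 : H))]
        refine sw_congr _ fun v n' => ?_
        rw [← counit_mul_left'' u v, sw_smul_const]
        simp only [mul_smul]
    _ = sw (Δ (1 : H)) fun a b => sw (M.coact m) fun u m' => ε (u * εs' a) •
          sw (N.coact n) fun v n' => ε (b * v) • projT k H M N (m' ⊗ₜ n') :=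
        (sw_one_sourceMapOp fun a b => sw (M.coact m) fun u m' => ε (u * a) •
          sw (N.coact n) fun v n' => ε (b * v) • projT k H M N (m' ⊗ₜ n')).symm
    _ = sw (Δ (1 : H)) fun a b => sw (N.coact n) fun v n' =>
          ε (b * v) • projT k H M N ((εs' a • m) ⊗ₜ n') :=
        sw_congr _ fun a b => sw_counit_coact_mul_leftLeg M (isLeftLeg_sourceMapOp a) m fun m' =>
          sw (N.coact n) fun v n' => ε (b * v) • projT k H M N (m' ⊗ₜ n')
    _ = sw (Δ (1 : H)) fun a b => sw (N.coact n) fun v n' =>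
          ε (εt b * v) • projT k H M N ((a • m) ⊗ₜ n') :=
        (sw_one_sourceMapOp fun a b => sw (N.coact n) fun v n' =>
          ε (b * v) • projT k H M N ((a • m) ⊗ₜ n')).trans
        (sw_one_targetMap fun a b => sw (N.coact n) fun v n' =>
          ε (b * v) • projT k H M N ((a • m) ⊗ₜ n')).symm
    _ = sw (Δ (1 : H)) fun a b => projT k H M N ((a • m) ⊗ₜ (εt b • n)) :=
        sw_congr _ fun a b => sw_counit_mul_coact N (isRightLeg_targetMap b) n fun n' =>
          projT k H M N ((a • m) ⊗ₜ n')
    _ = sw (Δ (1 : H)) fun a b => projT k H M N ((a • m) ⊗ₜ (b • n)) :=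
        sw_one_targetMap fun a b => projT k H M N ((a • m) ⊗ₜ (b • n))
    _ = _ := projT_one m n

/-- In Δ²(1) = (1 ⊗ Δ(1))(Δ(1) ⊗ 1) the first factor is absorbed by the projection and the second by
λ(m) ∈ H ⊗_t M. -/
theorem coactT_mem (x : tensorT k H M N) :
    coactT M N x ∈ tensorT k H H (tensorT k H M N) := by
  refine mem_tensorT_iff.2 (tensorT_ext
    (fun x => diagAct k H (tensorT k H M N) (1 : H) (coactT M N x))
    (fun x => coactT M N x) (fun m n => ?_) (by fun_prop) (by fun_prop) x)
  simp only [coactT_projT, linearMap_sw, diagAct_tmul, smul_projT, tmul_sw, smul_eq_mul]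
  calc _ = sw (M.coact m) fun u m' => sw (N.coact n) fun v n' => sw (Δ (1 : H)) fun a b =>
          (a * (u * v)) ⊗ₜ[k] projT k H M N ((b • m') ⊗ₜ n') := by
        refine sw_congr _ fun u m' => sw_congr _ fun v n' => ?_
        rw [sw_comul_one_right fun a p q =>
          (a * (u * v)) ⊗ₜ[k] projT k H M N ((p • m') ⊗ₜ (q • n'))]
        refine sw_congr _ fun a b => ?_
        rw [← projT_one (b • m') n', tmul_sw]
        simp only [mul_smul]
    _ = sw (Δ (1 : H)) fun a b => sw (M.coact m) fun u m' => sw (N.coact n) fun v n' =>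
          (a * u * v) ⊗ₜ[k] projT k H M N ((b • m') ⊗ₜ n') := by
        rw [sw_comm (Δ (1 : H))]
        simp only [mul_assoc]
        exact sw_congr _ fun u m' => sw_comm _ _ _
    _ = _ := sw_coact_one M m fun u m' => sw (N.coact n) fun v n' =>
          (u * v) ⊗ₜ[k] projT k H M N (m' ⊗ₜ n')

/-- Coassociativity first isolates (h₂n)₋₁h₃, where compatibility of N applies, and then (h₁m)₋₁h₂,
where compatibility of M applies. -/
theorem coactT_compat (h : H) (x : tensorT k H M N) :
    diagAct k H (tensorT k H M N) h (coactT M N x) =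
      coactMulRight (coactT M N) x (Coalgebra.comul (R := k) h) := by
  rw [coactMulRight_eq_sw]
  refine tensorT_ext (fun x => diagAct k H (tensorT k H M N) h (coactT M N x))
    (fun x => sw (Δ h) fun a b => sw (coactT M N (a • x)) fun u n => (u * b) ⊗ₜ n)
    (fun m n => ?_) (by fun_prop) (by fun_prop) x
  simp only [coactT_projT, linearMap_sw, diagAct_tmul, smul_projT, tmul_sw, smul_eq_mul]
  simp (disch := ((repeat intro _); fun_prop)) only [sw_sw, sw_tmul]
  symm
  calc _ = sw (Δ h) fun a b => sw (Δ b) fun p q => sw (M.coact (a • m)) fun u m' =>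
          sw (N.coact (p • n)) fun v n' => (u * v * q) ⊗ₜ[k] projT k H M N (m' ⊗ₜ n') :=
        sw_coassoc h fun a p q => sw (M.coact (a • m)) fun u m' =>
          sw (N.coact (p • n)) fun v n' => (u * v * q) ⊗ₜ[k] projT k H M N (m' ⊗ₜ n')
    _ = sw (Δ h) fun a b => sw (M.coact (a • m)) fun u m' => sw (Δ b) fun p q =>
          sw (N.coact n) fun v n' => (u * (p * v)) ⊗ₜ[k] projT k H M N (m' ⊗ₜ (q • n')) := by
        refine sw_congr _ fun a b => ?_
        rw [sw_comm]
        simp only [mul_assoc]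
        exact sw_congr _ fun u m' => sw_compat N b n fun v n' =>
          (u * v) ⊗ₜ[k] projT k H M N (m' ⊗ₜ n')
    _ = sw (Δ h) fun a b => sw (Δ b) fun p q => sw (M.coact (a • m)) fun u m' =>
          sw (N.coact n) fun v n' => (u * (p * v)) ⊗ₜ[k] projT k H M N (m' ⊗ₜ (q • n')) :=
        sw_congr _ fun a b => sw_comm _ _ _
    _ = sw (Δ h) fun a b => sw (Δ a) fun p q => sw (M.coact (p • m)) fun u m' =>
          sw (N.coact n) fun v n' => (u * (q * v)) ⊗ₜ[k] projT k H M N (m' ⊗ₜ (b • n')) :=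
        (sw_coassoc h fun a p q => sw (M.coact (a • m)) fun u m' =>
          sw (N.coact n) fun v n' =>
            (u * (p * v)) ⊗ₜ[k] projT k H M N (m' ⊗ₜ (q • n'))).symm
    _ = sw (Δ h) fun a b => sw (Δ a) fun p q => sw (M.coact m) fun u m' =>
          sw (N.coact n) fun v n' =>
            (p * u * v) ⊗ₜ[k] projT k H M N ((q • m') ⊗ₜ (b • n')) := by
        simp only [← mul_assoc]
        exact sw_congr _ fun a b => sw_compat M a m fun u m' => sw (N.coact n) fun v n' =>
            (u * v) ⊗ₜ[k] projT k H M N (m' ⊗ₜ (b • n'))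
    _ = sw (Δ h) fun a b => sw (Δ b) fun p q => sw (M.coact m) fun u m' =>
          sw (N.coact n) fun v n' =>
            (a * u * v) ⊗ₜ[k] projT k H M N ((p • m') ⊗ₜ (q • n')) :=
        sw_coassoc h fun a p q => sw (M.coact m) fun u m' =>
          sw (N.coact n) fun v n' =>
            (a * u * v) ⊗ₜ[k] projT k H M N ((p • m') ⊗ₜ (q • n'))
    _ = _ := by
        simp only [mul_assoc]
        refine (sw_congr _ fun a b => sw_comm _ _ _).trans ?_
        refine (sw_congr _ fun a b => sw_congr _ fun u m' => sw_comm _ _ _).trans ?_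
        refine (sw_comm _ _ _).trans ?_
        exact sw_congr _ fun u m' => sw_comm _ _ _

end Calculus

end YDModule

/-! ### The monoidal category of Yetter-Drinfeld modules -/

section Bilin

variable {k A B P : Type*} [CommSemiring k] [AddCommMonoid A] [Module k A] [AddCommMonoid B]
  [Module k B] [AddCommMonoid P] [Module k P]

/-- The linear map `a ⊗ b ↦ F(a, b)`. -/
def liftBilin (F : A → B → P) (h1 : ∀ b, IsLinearMap k fun a => F a b)
    (h2 : ∀ a, IsLinearMap k fun b => F a b) : A ⊗[k] B →ₗ[k] P :=
  TensorProduct.lift (bilin F h1 h2)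

@[simp]
theorem liftBilin_tmul (F : A → B → P) (h1 : ∀ b, IsLinearMap k fun a => F a b)
    (h2 : ∀ a, IsLinearMap k fun b => F a b) (a : A) (b : B) :
    liftBilin F h1 h2 (a ⊗ₜ b) = F a b := by
  simp [liftBilin, bilin]

end Bilin

/-! ### Tensor products of Yetter-Drinfeld modules and the associativity constraint. -/

namespace YDModule

open WeakBialgebra

section Tensor

variable {k H : Type u} [CommRing k] [Ring H] [WeakBialgebra k H] {P : Type u} [AddCommGroup P]
  [Module k P]

local notation "Δ" => Coalgebra.comul (R := k)
local notation "ε" => Coalgebra.counit (R := k)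
local notation "εt" => targetMap k H
local notation "εs'" => sourceMapOp k H

/-- The tensor product `M ⊗_t N` of Yetter-Drinfeld modules. -/
noncomputable def tensor (M N : YDModule k H) : YDModule k H where
  carrier := tensorT k H M N
  coact := coactT M N
  coassoc := coactT_coassoc M N
  counit := coactT_counit M N
  coact_mem := coactT_mem M N
  compat := coactT_compat M N

/-- The projection `m ⊗ n ↦ 1₍₁₎ m ⊗ 1₍₂₎ n`. -/
noncomputable def pr (M N : YDModule k H) : M ⊗[k] N →ₗ[k] tensor M N := projT k H M N

/-- The inclusion of `M ⊗_t N` into `M ⊗ N`. -/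
noncomputable def incl (M N : YDModule k H) : tensor M N →ₗ[k] M ⊗[k] N :=
  (tensorT k H M N).subtype

variable (M N Q : YDModule k H)

theorem incl_pr (x : M ⊗[k] N) : incl M N (pr M N x) = diagAct k M N (1 : H) x := rfl

theorem incl_smul (h : H) (x : tensor M N) : incl M N (h • x) = diagAct k M N h (incl M N x) := rfl

theorem incl_pr_tmul (m : M) (n : N) :
    incl M N (pr M N (m ⊗ₜ n)) = sw (Δ (1 : H)) fun a b => (a • m) ⊗ₜ (b • n) :=
  diagAct_tmul 1 m n

theorem smul_pr (h : H) (m : M) (n : N) :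
    h • pr M N (m ⊗ₜ n) = sw (Δ h) fun a b => pr M N ((a • m) ⊗ₜ (b • n)) :=
  smul_projT h m n

theorem pr_one (m : M) (n : N) :
    (sw (Δ (1 : H)) fun a b => pr M N ((a • m) ⊗ₜ (b • n))) = pr M N (m ⊗ₜ n) :=
  projT_one m n

theorem coact_pr (m : M) (n : N) :
    (tensor M N).coact (pr M N (m ⊗ₜ n)) =
      sw (M.coact m) fun u m' => sw (N.coact n) fun v n' => (u * v) ⊗ₜ pr M N (m' ⊗ₜ n') :=
  coactT_projT M N m n

theorem tensor_ext (f g : tensor M N → P)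
    (h : ∀ m n, f (pr M N (m ⊗ₜ n)) = g (pr M N (m ⊗ₜ n)))
    (hf : IsLinearMap k f := by fun_prop) (hg : IsLinearMap k g := by fun_prop)
    (x : tensor M N) : f x = g x :=
  tensorT_ext (k := k) (H := H) f g h hf hg x

variable {M N Q}

theorem hom_ext {f g : M ⟶ N} (h : ∀ m, Hom.toLin f m = Hom.toLin g m) : f = g :=
  Hom.ext (LinearMap.ext h)

theorem id_toLin (m : M) : Hom.toLin (𝟙 M) m = m := rfl

theorem comp_toLin (f : M ⟶ N) (g : N ⟶ Q) (m : M) :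
    Hom.toLin (f ≫ g) m = Hom.toLin g (Hom.toLin f m) := rfl

/-- A morphism with an inverse linear map is an isomorphism. -/
def isoOfInverse (f : M ⟶ N) (g : N →ₗ[k] M) (hfg : ∀ m, g (Hom.toLin f m) = m)
    (hgf : ∀ n, Hom.toLin f (g n) = n) : M ≅ N where
  hom := f
  inv := ⟨g, fun h n => by
      conv_lhs => rw [← hgf n, ← f.map_smul, hfg],
    fun n => by
      have hid : g ∘ₗ Hom.toLin f = LinearMap.id := LinearMap.ext hfg
      conv_rhs => rw [← hgf n, f.map_coact, ← LinearMap.comp_apply, ← LinearMap.lTensor_comp, hid]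
      simp⟩
  hom_inv_id := hom_ext hfg
  inv_hom_id := hom_ext hgf

/-- A map invariant under Δ(1) does not distinguish m ⊗ n from 1₁m ⊗ 1₂n. -/
theorem lift_pr (φ : M ⊗[k] N →ₗ[k] P)
    (h : ∀ m n, (sw (Δ (1 : H)) fun a b => φ ((a • m) ⊗ₜ (b • n))) = φ (m ⊗ₜ n)) (m : M) (n : N) :
    φ (incl M N (pr M N (m ⊗ₜ n))) = φ (m ⊗ₜ n) := by
  rw [incl_pr_tmul, linearMap_sw, h]

/-- The morphism `M ⊗_t N → Q` induced by a linear map `M ⊗ N → Q`. -/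
noncomputable def homLift (φ : M ⊗[k] N →ₗ[k] Q)
    (hsmul : ∀ (h : H) (m : M) (n : N),
      (sw (Δ h) fun a b => φ ((a • m) ⊗ₜ (b • n))) = h • φ (m ⊗ₜ n))
    (hcoact : ∀ (m : M) (n : N), Q.coact (φ (m ⊗ₜ n)) =
      sw (M.coact m) fun u m' => sw (N.coact n) fun v n' => (u * v) ⊗ₜ φ (m' ⊗ₜ n')) :
    tensor M N ⟶ Q :=
  -- Invariance under Δ(1) is the case h = 1 of `hsmul`.
  have key : ∀ m n, φ (incl M N (pr M N (m ⊗ₜ n))) = φ (m ⊗ₜ n) :=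
    lift_pr φ fun m n => by rw [hsmul, one_smul]
  ⟨φ ∘ₗ incl M N, fun h x => by
      refine tensor_ext M N (fun x => (φ ∘ₗ incl M N) (h • x)) (fun x => h • (φ ∘ₗ incl M N) x)
        (fun m n => ?_) (by fun_prop) (by fun_prop) x
      simp only [smul_pr, linearMap_sw, LinearMap.comp_apply, key, hsmul],
    fun x => by
      refine tensor_ext M N (fun x => Q.coact ((φ ∘ₗ incl M N) x))
        (fun x => (φ ∘ₗ incl M N).lTensor H ((tensor M N).coact x))
        (fun m n => ?_) (by fun_prop) (by fun_prop) x
      simp only [coact_pr, linearMap_sw, LinearMap.comp_apply, key, hcoact,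
        LinearMap.lTensor_tmul]⟩

theorem homLift_pr (φ : M ⊗[k] N →ₗ[k] Q)
    (hsmul : ∀ (h : H) (m : M) (n : N),
      (sw (Δ h) fun a b => φ ((a • m) ⊗ₜ (b • n))) = h • φ (m ⊗ₜ n))
    (hcoact : ∀ (m : M) (n : N), Q.coact (φ (m ⊗ₜ n)) =
      sw (M.coact m) fun u m' => sw (N.coact n) fun v n' => (u * v) ⊗ₜ φ (m' ⊗ₜ n'))
    (m : M) (n : N) :
    Hom.toLin (homLift φ hsmul hcoact) (pr M N (m ⊗ₜ n)) = φ (m ⊗ₜ n) :=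
  lift_pr φ (fun m n => by rw [hsmul, one_smul]) m n

/-- The tensor product of two morphisms. -/
noncomputable def tensorHom {M M' N N' : YDModule k H} (f : M ⟶ M') (g : N ⟶ N') :
    tensor M N ⟶ tensor M' N' :=
  homLift (pr M' N' ∘ₗ TensorProduct.map (Hom.toLin f) (Hom.toLin g))
    (fun h m n => by
      simp only [LinearMap.comp_apply, TensorProduct.map_tmul, smul_pr, f.map_smul, g.map_smul])
    (fun m n => by
      simp only [LinearMap.comp_apply, TensorProduct.map_tmul, coact_pr, f.map_coact, g.map_coact]
      simp (disch := ((repeat intro _); fun_prop)) only [sw_lTensor])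

theorem tensorHom_pr {M M' N N' : YDModule k H} (f : M ⟶ M') (g : N ⟶ N') (m : M) (n : N) :
    Hom.toLin (tensorHom f g) (pr M N (m ⊗ₜ n)) = pr M' N' (Hom.toLin f m ⊗ₜ Hom.toLin g n) :=
  homLift_pr _ _ _ m n

theorem incl_tensorHom {M M' N N' : YDModule k H} (f : M ⟶ M') (g : N ⟶ N') (x : tensor M N) :
    incl M' N' (Hom.toLin (tensorHom f g) x) =
      TensorProduct.map (Hom.toLin f) (Hom.toLin g) (incl M N x) := by
  refine tensor_ext M N (fun x => incl M' N' (Hom.toLin (tensorHom f g) x))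
    (fun x => TensorProduct.map (Hom.toLin f) (Hom.toLin g) (incl M N x))
    (fun m n => ?_) (by fun_prop) (by fun_prop) x
  simp only [tensorHom_pr, incl_pr_tmul, linearMap_sw, TensorProduct.map_tmul, f.map_smul,
    g.map_smul]

section Associator

variable (M N Q : YDModule k H)

/-- The outer projection completes the extra Δ(1) to Δ²(1) = (1 ⊗ Δ(1))(Δ(1) ⊗ 1), whose left factor
the inner projection absorbs. The mirror lemma `pr_assoc_right` uses the other factorisation. -/
theorem pr_assoc_left (m : M) (n : N) (q : Q) :
    (sw (Δ (1 : H)) fun a b => pr M (tensor N Q) ((a • m) ⊗ₜ pr N Q ((b • n) ⊗ₜ q))) =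
      pr M (tensor N Q) (m ⊗ₜ pr N Q (n ⊗ₜ q)) := by
  rw [← pr_one M (tensor N Q)]
  simp only [smul_pr, tmul_sw, linearMap_sw]
  rw [sw_comul_one_right fun a c d => pr M (tensor N Q) ((a • m) ⊗ₜ pr N Q ((c • n) ⊗ₜ (d • q)))]
  refine sw_congr _ fun a b => ?_
  rw [← pr_one N Q, tmul_sw, linearMap_sw]
  simp only [mul_smul]

theorem pr_assoc_right (m : M) (n : N) (q : Q) :
    (sw (Δ (1 : H)) fun a b => pr (tensor M N) Q (pr M N (m ⊗ₜ (a • n)) ⊗ₜ (b • q))) =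
      pr (tensor M N) Q (pr M N (m ⊗ₜ n) ⊗ₜ q) := by
  rw [← pr_one (tensor M N) Q]
  simp only [smul_pr, sw_tmul_const, linearMap_sw]
  rw [sw_coassoc 1 fun a c d => pr (tensor M N) Q (pr M N ((a • m) ⊗ₜ (c • n)) ⊗ₜ (d • q)),
    sw_comul_one_left fun a c d => pr (tensor M N) Q (pr M N ((a • m) ⊗ₜ (c • n)) ⊗ₜ (d • q)),
    sw_comm]
  refine sw_congr _ fun a b => ?_
  rw [← pr_one M N, sw_tmul_const, linearMap_sw]
  simp only [mul_smul]

/-- The map `(m ⊗ n) ⊗ q ↦ m ⊗ (n ⊗ q)` on `(M ⊗_t N) ⊗ Q`. -/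
noncomputable def assocLin : (tensor M N : Type u) ⊗[k] Q →ₗ[k] tensor M (tensor N Q) :=
  pr M (tensor N Q) ∘ₗ (pr N Q).lTensor M ∘ₗ
    (TensorProduct.assoc k M N Q).toLinearMap ∘ₗ (incl M N).rTensor Q

theorem assocLin_pr (m : M) (n : N) (q : Q) :
    assocLin M N Q (pr M N (m ⊗ₜ n) ⊗ₜ q) = pr M (tensor N Q) (m ⊗ₜ pr N Q (n ⊗ₜ q)) := by
  simp only [assocLin, LinearMap.comp_apply, LinearMap.rTensor_tmul, incl_pr_tmul, sw_tmul_const,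
    linearMap_sw, LinearEquiv.coe_coe, TensorProduct.assoc_tmul, LinearMap.lTensor_tmul]
  exact pr_assoc_left M N Q m n q

/-- The map `m ⊗ (n ⊗ q) ↦ (m ⊗ n) ⊗ q` on `M ⊗_t (N ⊗_t Q)`. -/
noncomputable def assocInv : tensor M (tensor N Q) →ₗ[k] tensor (tensor M N) Q :=
  pr (tensor M N) Q ∘ₗ (pr M N).rTensor Q ∘ₗ
    (TensorProduct.assoc k M N Q).symm.toLinearMap ∘ₗ (incl N Q).lTensor M ∘ₗ
      incl M (tensor N Q)

theorem assocInv_pr (m : M) (n : N) (q : Q) :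
    assocInv M N Q (pr M (tensor N Q) (m ⊗ₜ pr N Q (n ⊗ₜ q))) =
      pr (tensor M N) Q (pr M N (m ⊗ₜ n) ⊗ₜ q) := by
  have h : ∀ m n q, pr (tensor M N) Q ((pr M N).rTensor Q ((TensorProduct.assoc k M N Q).symm
      ((incl N Q).lTensor M (m ⊗ₜ pr N Q (n ⊗ₜ q))))) =
        pr (tensor M N) Q (pr M N (m ⊗ₜ n) ⊗ₜ q) := by
    intro m n q
    simp only [LinearMap.lTensor_tmul, incl_pr_tmul, tmul_sw,
      linearMap_sw, linearEquiv_sw, TensorProduct.assoc_symm_tmul, LinearMap.rTensor_tmul]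
    exact pr_assoc_right M N Q m n q
  simp only [assocInv, LinearMap.comp_apply, LinearEquiv.coe_coe, incl_pr_tmul M, smul_pr,
    tmul_sw, linearMap_sw, h]
  rw [← sw_coassoc 1 fun a c d => pr (tensor M N) Q (pr M N ((a • m) ⊗ₜ (c • n)) ⊗ₜ (d • q)),
    ← pr_one (tensor M N) Q]
  simp only [smul_pr, sw_tmul_const, linearMap_sw]

/-- The associativity constraint. -/
noncomputable def assocHom : tensor (tensor M N) Q ⟶ tensor M (tensor N Q) :=
  homLift (assocLin M N Q)
    (fun h x q => by
      refine tensor_ext M N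
        (fun x => sw (Δ h) fun a b => assocLin M N Q ((a • x) ⊗ₜ (b • q)))
        (fun x => h • assocLin M N Q (x ⊗ₜ q)) (fun m n => ?_) (by fun_prop) (by fun_prop) x
      simp only [smul_pr, sw_tmul_const, linearMap_sw, assocLin_pr, tmul_sw]
      exact sw_coassoc h fun a c d =>
        pr M (tensor N Q) ((a • m) ⊗ₜ pr N Q ((c • n) ⊗ₜ (d • q))))
    (fun x q => by
      refine tensor_ext M N
        (fun x => (tensor M (tensor N Q)).coact (assocLin M N Q (x ⊗ₜ q)))
        (fun x => sw ((tensor M N).coact x) fun u y => sw (Q.coact q) fun v q' =>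
          (u * v) ⊗ₜ assocLin M N Q (y ⊗ₜ q')) (fun m n => ?_) (by fun_prop) (by fun_prop) x
      simp only [assocLin_pr, coact_pr]
      simp (disch := ((repeat intro _); fun_prop)) only [sw_sw, sw_tmul]
      simp only [assocLin_pr, mul_assoc])

theorem assocHom_pr (m : M) (n : N) (q : Q) :
    Hom.toLin (assocHom M N Q) (pr (tensor M N) Q (pr M N (m ⊗ₜ n) ⊗ₜ q)) =
      pr M (tensor N Q) (m ⊗ₜ pr N Q (n ⊗ₜ q)) := by
  rw [assocHom, homLift_pr, assocLin_pr]

variable {M N Q}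

theorem tensor_ext_left (f g : tensor (tensor M N) Q → P)
    (h : ∀ m n q, f (pr (tensor M N) Q (pr M N (m ⊗ₜ n) ⊗ₜ q)) =
      g (pr (tensor M N) Q (pr M N (m ⊗ₜ n) ⊗ₜ q)))
    (hf : IsLinearMap k f := by fun_prop) (hg : IsLinearMap k g := by fun_prop)
    (x : tensor (tensor M N) Q) : f x = g x :=
  tensor_ext _ _ f g (fun y q => tensor_ext M N (fun y => f (pr (tensor M N) Q (y ⊗ₜ q)))
    (fun y => g (pr (tensor M N) Q (y ⊗ₜ q))) (fun m n => h m n q)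
    (hf.comp' (by fun_prop)) (hg.comp' (by fun_prop)) y) hf hg x

theorem tensor_ext_right (f g : tensor M (tensor N Q) → P)
    (h : ∀ m n q, f (pr M (tensor N Q) (m ⊗ₜ pr N Q (n ⊗ₜ q))) =
      g (pr M (tensor N Q) (m ⊗ₜ pr N Q (n ⊗ₜ q))))
    (hf : IsLinearMap k f := by fun_prop) (hg : IsLinearMap k g := by fun_prop)
    (x : tensor M (tensor N Q)) : f x = g x :=
  tensor_ext _ _ f g (fun m y => tensor_ext N Q (fun y => f (pr M (tensor N Q) (m ⊗ₜ y)))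
    (fun y => g (pr M (tensor N Q) (m ⊗ₜ y))) (fun n q => h m n q)
    (hf.comp' (by fun_prop)) (hg.comp' (by fun_prop)) y) hf hg x

variable (M N Q)

/-- The associativity constraint as an isomorphism. -/
noncomputable def assocIso : tensor (tensor M N) Q ≅ tensor M (tensor N Q) :=
  isoOfInverse (assocHom M N Q) (assocInv M N Q)
    (tensor_ext_left (fun x => assocInv M N Q (Hom.toLin (assocHom M N Q) x)) (fun x => x)
      (fun m n q => by rw [assocHom_pr, assocInv_pr]) (by fun_prop) (by fun_prop))
    (tensor_ext_right (fun x => Hom.toLin (assocHom M N Q) (assocInv M N Q x)) (fun x => x)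
      (fun m n q => by rw [assocInv_pr, assocHom_pr]) (by fun_prop) (by fun_prop))

end Associator

end Tensor

end YDModule

/-! ### The target space as a module and comodule. -/

namespace WeakBialgebra

section UnitModule

variable {k H P : Type u} [CommRing k] [Ring H] [WeakBialgebra k H] [AddCommGroup P] [Module k P]

local notation "Δ" => Coalgebra.comul (R := k)
local notation "ε" => Coalgebra.counit (R := k)
local notation "εt" => targetMap k H
local notation "εs'" => sourceMapOp k H

variable (k H) in
/-- The target map, with values in the target space. -/
noncomputable def toTarget : H →ₗ[k] targetSpace k H := (targetMap k H).rangeRestrict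

theorem coe_toTarget (h : H) : (toTarget k H h : H) = εt h := rfl

theorem isRightLeg_coe (z : targetSpace k H) : IsRightLeg k (z : H) := by
  obtain ⟨_, h, rfl⟩ := z
  exact isRightLeg_targetMap h

theorem toTarget_coe (z : targetSpace k H) : toTarget k H (z : H) = z :=
  Subtype.ext (isRightLeg_coe z).targetMap_eq_self

/-- This is what makes the action h ⇀ z = ε_t(hz) associative. -/
theorem toTarget_mul_targetMap (g h : H) : toTarget k H (g * εt h) = toTarget k H (g * h) :=
  Subtype.ext (targetMap_mul_targetMap g h)

theorem toTarget_targetMap (h : H) : toTarget k H (εt h) = toTarget k H h :=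
  Subtype.ext (targetMap_targetMap h)

/-- The action `h ⇀ z = ε_t(hz)` on the target space. -/
noncomputable instance targetSpaceModule : Module H (targetSpace k H) where
  smul h z := toTarget k H (h * (z : H))
  one_smul z := by
    change toTarget k H (1 * (z : H)) = z
    rw [one_mul, toTarget_coe]
  mul_smul g h z := by
    change toTarget k H (g * h * (z : H)) = toTarget k H (g * toTarget k H (h * (z : H)))
    rw [coe_toTarget, toTarget_mul_targetMap, mul_assoc]
  smul_zero h := by
    change toTarget k H (h * ((0 : targetSpace k H) : H)) = 0
    simp
  smul_add h z w := by
    change toTarget k H (h * ((z + w : targetSpace k H) : H)) =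
      toTarget k H (h * (z : H)) + toTarget k H (h * (w : H))
    simp [mul_add]
  add_smul g h z := by
    change toTarget k H ((g + h) * (z : H)) =
      toTarget k H (g * (z : H)) + toTarget k H (h * (z : H))
    simp [add_mul]
  zero_smul z := by
    change toTarget k H (0 * (z : H)) = 0
    simp

theorem target_smul (h : H) (z : targetSpace k H) : h • z = toTarget k H (h * (z : H)) := rfl

instance : IsScalarTower k H (targetSpace k H) where
  smul_assoc c h z := by
    change toTarget k H ((c • h) * (z : H)) = c • toTarget k H (h * (z : H))
    simp

theorem smul_toTarget (g h : H) : g • toTarget k H h = toTarget k H (g * h) :=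
  toTarget_mul_targetMap g h

variable (k H) in
/-- The comultiplication as a coaction on the target space. -/
noncomputable def targetCoact : targetSpace k H →ₗ[k] H ⊗[k] targetSpace k H :=
  (toTarget k H).lTensor H ∘ₗ Coalgebra.comul ∘ₗ (targetSpace k H).subtype

theorem targetCoact_eq (z : targetSpace k H) :
    targetCoact k H z = sw (Δ (z : H)) fun a b => a ⊗ₜ toTarget k H b :=
  lTensor_eq_sw _ _

/-- Both sides equal 1₁z ⊗ 1₂. Hence the second leg of Δ(z) may be taken in H_t, and Δ restricts to
a coaction. -/
theorem IsRightLeg.sw_comul_targetMap {z : H} (hz : IsRightLeg k z) (F : H → H → P)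
    (h1 : ∀ b, IsLinearMap k fun a => F a b := by intros; fun_prop)
    (h2 : ∀ a, IsLinearMap k fun b => F a b := by intros; fun_prop) :
    (sw (Δ z) fun a b => F a (εt b)) = sw (Δ z) F := by
  rw [sw_targetMap_right z F, hz.sw_comul F]

theorem targetCoact_coassoc (z : targetSpace k H) :
    TensorProduct.assoc k H H (targetSpace k H)
        ((Coalgebra.comul (R := k) (A := H)).rTensor (targetSpace k H) (targetCoact k H z)) =
      (targetCoact k H).lTensor H (targetCoact k H z) := by
  simp only [targetCoact_eq, linearMap_sw, linearEquiv_sw, LinearMap.rTensor_tmul,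
    LinearMap.lTensor_tmul, TensorProduct.assoc_tmul_eq_sw, tmul_sw, coe_toTarget]
  rw [(isRightLeg_coe z).sw_comul_targetMap fun a b => sw (Δ b) fun c d =>
    a ⊗ₜ[k] (c ⊗ₜ[k] toTarget k H d)]
  exact sw_coassoc (z : H) fun a b c => a ⊗ₜ[k] (b ⊗ₜ[k] toTarget k H c)

theorem targetCoact_counit (z : targetSpace k H) :
    TensorProduct.lid k (targetSpace k H)
      ((Coalgebra.counit (R := k) (A := H)).rTensor (targetSpace k H) (targetCoact k H z)) = z := by
  simp only [targetCoact_eq, linearMap_sw, linearEquiv_sw, LinearMap.rTensor_tmul,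
    TensorProduct.lid_tmul]
  exact (sw_counit_left _ fun b => toTarget k H b).trans (toTarget_coe z)

theorem targetCoact_mem (z : targetSpace k H) :
    targetCoact k H z ∈ tensorT k H H (targetSpace k H) := by
  rw [mem_tensorT_iff]
  simp only [targetCoact_eq, linearMap_sw, diagAct_tmul, smul_toTarget, smul_eq_mul]
  rw [sw_comm]
  exact sw_comul_one_mul (z : H) fun a b => a ⊗ₜ[k] toTarget k H b

/-- Both sides equal 1₁hz ⊗ 1₂: one by h₁ ⊗ ε_t(h₂) = 1₁h ⊗ 1₂ applied to hz, the other by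
ε_t(h₁z)h₂ = hz. -/
theorem targetCoact_compat (h : H) (z : targetSpace k H) :
    diagAct k H (targetSpace k H) h (targetCoact k H z) =
      coactMulRight (targetCoact k H) z (Coalgebra.comul (R := k) h) := by
  rw [coactMulRight_eq_sw]
  simp only [targetCoact_eq, linearMap_sw, diagAct_tmul, smul_toTarget, smul_eq_mul]
  simp (disch := ((repeat intro _); fun_prop)) only [sw_sw, sw_tmul, target_smul, coe_toTarget]
  calc _ = sw (Δ (h * (z : H))) fun a b => a ⊗ₜ[k] toTarget k H (εt b) := by
        rw [sw_comm, ← sw_comul_mul h (z : H) fun a b => a ⊗ₜ[k] toTarget k H b]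
        simp only [toTarget_targetMap]
    _ = sw (Δ 1) fun a b => (a * (h * (z : H))) ⊗ₜ[k] toTarget k H b :=
        sw_targetMap_right _ fun a b => a ⊗ₜ[k] toTarget k H b
    _ = sw (Δ 1) fun a b => sw (Δ h) fun c d =>
          (a * (εt (c * (z : H)) * d)) ⊗ₜ[k] toTarget k H b :=
        (sw_congr _ fun a b => (isRightLeg_coe z).sw_targetMap_mul h fun x =>
          (a * x) ⊗ₜ[k] toTarget k H b).symm
    _ = _ := by
        rw [sw_comm]
        refine sw_congr _ fun c d => ?_
        rw [(isRightLeg_targetMap (c * (z : H))).sw_comul fun p q =>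
          (p * d) ⊗ₜ[k] toTarget k H q]
        simp only [mul_assoc]

end UnitModule

end WeakBialgebra

/-! ### The unit object, the unit constraints and coherence. -/

namespace YDModule

open WeakBialgebra

section Unit

variable {k H : Type u} [CommRing k] [Ring H] [WeakBialgebra k H]

local notation "Δ" => Coalgebra.comul (R := k)
local notation "ε" => Coalgebra.counit (R := k)
local notation "εt" => targetMap k H
local notation "εs'" => sourceMapOp k H

variable (k H) in
/-- The target space as a Yetter-Drinfeld module. -/
noncomputable def unit : YDModule k H where
  carrier := targetSpace k H
  coact := targetCoact k H
  coassoc := targetCoact_coassoc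
  counit := targetCoact_counit
  coact_mem := targetCoact_mem
  compat := targetCoact_compat

variable (k H) in
/-- The target map with values in the unit object. -/
noncomputable def toUnit : H →ₗ[k] unit k H := toTarget k H

/-- The inclusion of the unit object into `H`. -/
noncomputable def unitVal : unit k H →ₗ[k] H := (targetSpace k H).subtype

theorem unitVal_toUnit (h : H) : unitVal (toUnit k H h) = εt h := rfl

theorem isRightLeg_unitVal (z : unit k H) : IsRightLeg k (unitVal z) := isRightLeg_coe z

theorem toUnit_unitVal (z : unit k H) : toUnit k H (unitVal z) = z := toTarget_coe z

theorem toUnit_targetMap (h : H) : toUnit k H (εt h) = toUnit k H h := toTarget_targetMap h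

theorem unit_smul (h : H) (z : unit k H) : h • z = toUnit k H (h * unitVal z) := rfl

theorem smul_toUnit (g h : H) : g • toUnit k H h = toUnit k H (g * h) := smul_toTarget g h

theorem unit_coact (z : unit k H) :
    (unit k H).coact z = sw (Δ (unitVal z)) fun a b => a ⊗ₜ toUnit k H b :=
  targetCoact_eq z

variable (M N : YDModule k H)

/-- The left unit constraint. -/
noncomputable def leftUnitorHom : tensor (unit k H) M ⟶ M :=
  homLift (liftBilin (fun (z : unit k H) (m : M) => unitVal z • m) (by intros; fun_prop)
      (by intros; fun_prop))
    (fun h z m => by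
      simp only [liftBilin_tmul, unit_smul, unitVal_toUnit, smul_smul]
      exact (isRightLeg_unitVal z).sw_targetMap_mul h fun x => x • m)
    (fun z m => by
      simp only [liftBilin_tmul, unit_coact]
      simp (disch := ((repeat intro _); fun_prop)) only [sw_sw, sw_tmul, unitVal_toUnit]
      rw [(isRightLeg_unitVal z).sw_comul_targetMap fun a b => sw (M.coact m) fun v n =>
          (a * v) ⊗ₜ[k] (b • n), (isRightLeg_unitVal z).sw_comul' fun a b => sw (M.coact m)
          fun v n => (a * v) ⊗ₜ[k] (b • n)]
      simp only [mul_assoc]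
      rw [sw_coact_one M m fun v n => (unitVal z * v) ⊗ₜ[k] n,
        ← sw_coact_rightLeg_smul M (isRightLeg_unitVal z) m fun v n => v ⊗ₜ[k] n, sw_tmul_self])

theorem leftUnitorHom_pr (z : unit k H) (m : M) :
    Hom.toLin (leftUnitorHom M) (pr (unit k H) M (z ⊗ₜ m)) = unitVal z • m := by
  rw [leftUnitorHom, homLift_pr, liftBilin_tmul]

/-- The inverse of the left unit constraint. -/
noncomputable def leftUnitorInv : M →ₗ[k] tensor (unit k H) M :=
  pr (unit k H) M ∘ₗ TensorProduct.mk k (unit k H) M (toUnit k H 1)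

theorem leftUnitorInv_apply (m : M) :
    leftUnitorInv M m = pr (unit k H) M (toUnit k H 1 ⊗ₜ m) := rfl

/-- Evaluating ε_t(z₁) ⊗ z₂ in two ways gives ε_t(1₁z) ⊗ 1₂ = ε_t(1₁) ⊗ 1₂z, the two sides once Δ(1)
has been inserted. -/
theorem pr_unit_left (z : unit k H) (m : M) :
    pr (unit k H) M (toUnit k H 1 ⊗ₜ (unitVal z • m)) = pr (unit k H) M (z ⊗ₜ m) := by
  have h1 := sw_targetMap_left (k := k) (unitVal z) fun a b =>
    pr (unit k H) M (toUnit k H a ⊗ₜ (b • m))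
  rw [(isRightLeg_unitVal z).sw_comul fun a b => pr (unit k H) M (toUnit k H (εt a) ⊗ₜ (b • m))]
    at h1
  rw [← pr_one, ← pr_one]
  simp only [toUnit_targetMap, smul_toUnit, mul_one, smul_smul] at h1 ⊢
  simp only [unit_smul]
  exact h1.symm

/-- The left unit constraint as an isomorphism. -/
noncomputable def leftUnitorIso : tensor (unit k H) M ≅ M :=
  isoOfInverse (leftUnitorHom M) (leftUnitorInv M)
    (tensor_ext _ _ (fun x => leftUnitorInv M (Hom.toLin (leftUnitorHom M) x)) (fun x => x)
      (fun z m => by rw [leftUnitorHom_pr, leftUnitorInv_apply, pr_unit_left]) (by fun_prop)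
      (by fun_prop))
    (fun m => by
      rw [leftUnitorInv_apply, leftUnitorHom_pr, unitVal_toUnit, targetMap_one, one_smul])

/-- The right unit constraint. -/
noncomputable def rightUnitorHom : tensor M (unit k H) ⟶ M :=
  homLift (liftBilin (fun (m : M) (z : unit k H) => εs' (unitVal z) • m) (by intros; fun_prop)
      (by intros; fun_prop))
    (fun h m z => by
      simp only [liftBilin_tmul, unit_smul, unitVal_toUnit, smul_smul, sourceMapOp_targetMap]
      exact sw_sourceMapOp_mul h (unitVal z) fun x => x • m)
    (fun m z => by
      simp only [liftBilin_tmul, unit_coact]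
      simp (disch := ((repeat intro _); fun_prop)) only [sw_sw, sw_tmul, unitVal_toUnit,
        sourceMapOp_targetMap]
      -- The left side is m₋₁z ⊗ m₀. On the right, ε̄_s(z₂) moves from m₀ to m₋₁, where ε̄_s(z₂)z₁ =
      -- z.
      conv_lhs => rw [← sw_tmul_self (M.coact _),
        sw_coact_sourceMapOp_smul M (isRightLeg_unitVal z) m fun u n => u ⊗ₜ n]
      rw [sw_comm]
      symm
      calc _ = sw (Δ (unitVal z)) fun a b => sw (M.coact m) fun u n =>
            (u * (εs' b * a)) ⊗ₜ[k] n := by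
            simp only [← mul_assoc]
            exact sw_congr _ fun a b => sw_coact_leftLeg M (isLeftLeg_sourceMapOp b) m fun u n =>
              (u * a) ⊗ₜ[k] n
        _ = _ := sw_sourceMapOp_mul_one (unitVal z) fun x => sw (M.coact m) fun u n =>
            (u * x) ⊗ₜ[k] n)

theorem rightUnitorHom_pr (m : M) (z : unit k H) :
    Hom.toLin (rightUnitorHom M) (pr M (unit k H) (m ⊗ₜ z)) = εs' (unitVal z) • m := by
  rw [rightUnitorHom, homLift_pr, liftBilin_tmul]

/-- The inverse of the right unit constraint. -/
noncomputable def rightUnitorInv : M →ₗ[k] tensor M (unit k H) :=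
  pr M (unit k H) ∘ₗ (TensorProduct.mk k M (unit k H)).flip (toUnit k H 1)

theorem rightUnitorInv_apply (m : M) :
    rightUnitorInv M m = pr M (unit k H) (m ⊗ₜ toUnit k H 1) := rfl

/-- After Δ(1) has been inserted on both sides, this is 1₁ε̄_s(z) ⊗ 1₂ = 1₁ ⊗ ε_t(1₂z). -/
theorem pr_unit_right (m : M) (z : unit k H) :
    pr M (unit k H) ((εs' (unitVal z) • m) ⊗ₜ toUnit k H 1) = pr M (unit k H) (m ⊗ₜ z) := by
  rw [← pr_one, ← pr_one]
  simp only [smul_toUnit, mul_one, smul_smul]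
  simp only [unit_smul]
  rw [← sw_one_targetMap_mul (unitVal z) fun a b => pr M (unit k H) ((a • m) ⊗ₜ toUnit k H b)]
  simp only [toUnit_targetMap]

/-- The right unit constraint as an isomorphism. -/
noncomputable def rightUnitorIso : tensor M (unit k H) ≅ M :=
  isoOfInverse (rightUnitorHom M) (rightUnitorInv M)
    (tensor_ext _ _ (fun x => rightUnitorInv M (Hom.toLin (rightUnitorHom M) x)) (fun x => x)
      (fun z m => by rw [rightUnitorHom_pr, rightUnitorInv_apply, pr_unit_right]) (by fun_prop)
      (by fun_prop))
    (fun m => by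
      rw [rightUnitorInv_apply, rightUnitorHom_pr, unitVal_toUnit, targetMap_one, sourceMapOp_one,
        one_smul])

/-- M ⊗_t N is balanced over H_t, acting on M through ε̄_s, because 1₁ ⊗ 1₂z = 1₁ε̄_s(z) ⊗ 1₂. On
generators this is the triangle axiom. -/
theorem pr_triangle (m : M) (z : unit k H) (n : N) :
    pr M N (m ⊗ₜ (unitVal z • n)) = pr M N ((εs' (unitVal z) • m) ⊗ₜ n) := by
  rw [← pr_one, ← pr_one]
  simp only [smul_smul]
  exact (isRightLeg_unitVal z).sw_one_mul fun a b => pr M N ((a • m) ⊗ₜ (b • n))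

noncomputable instance : MonoidalCategoryStruct (YDModule k H) where
  tensorObj M N := tensor M N
  whiskerLeft M _ _ f := tensorHom (𝟙 M) f
  whiskerRight f N := tensorHom f (𝟙 N)
  tensorHom f g := tensorHom f g
  tensorUnit := unit k H
  associator M N Q := assocIso M N Q
  leftUnitor M := leftUnitorIso M
  rightUnitor M := rightUnitorIso M

theorem tensorHom_id_id : tensorHom (𝟙 M) (𝟙 N) = 𝟙 (tensor M N) :=
  hom_ext (tensor_ext M N (fun x => Hom.toLin (tensorHom (𝟙 M) (𝟙 N)) x)
    (fun x => Hom.toLin (𝟙 (tensor M N)) x) (fun m n => by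
      simp only [tensorHom_pr, id_toLin]) (by fun_prop) (by fun_prop))

theorem tensorHom_comp {M₁ M₂ M₃ N₁ N₂ N₃ : YDModule k H} (f : M₁ ⟶ M₂) (f' : N₁ ⟶ N₂)
    (g : M₂ ⟶ M₃) (g' : N₂ ⟶ N₃) :
    tensorHom f f' ≫ tensorHom g g' = tensorHom (f ≫ g) (f' ≫ g') :=
  hom_ext (tensor_ext _ _ (fun x => Hom.toLin (tensorHom f f' ≫ tensorHom g g') x)
    (fun x => Hom.toLin (tensorHom (f ≫ g) (f' ≫ g')) x) (fun m n => by
      simp only [tensorHom_pr, comp_toLin]) (by fun_prop) (by fun_prop))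

theorem assocHom_naturality {M M' N N' Q Q' : YDModule k H} (f : M ⟶ M') (g : N ⟶ N')
    (h : Q ⟶ Q') : tensorHom (tensorHom f g) h ≫ assocHom M' N' Q' =
      assocHom M N Q ≫ tensorHom f (tensorHom g h) :=
  hom_ext (tensor_ext_left
    (fun x => Hom.toLin (tensorHom (tensorHom f g) h ≫ assocHom M' N' Q') x)
    (fun x => Hom.toLin (assocHom M N Q ≫ tensorHom f (tensorHom g h)) x) (fun m n q => by
      simp only [tensorHom_pr, comp_toLin, assocHom_pr]) (by fun_prop) (by fun_prop))

theorem leftUnitorHom_naturality {M N : YDModule k H} (f : M ⟶ N) :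
    tensorHom (𝟙 (unit k H)) f ≫ leftUnitorHom N = leftUnitorHom M ≫ f :=
  hom_ext (tensor_ext _ _ (fun x => Hom.toLin (tensorHom (𝟙 (unit k H)) f ≫ leftUnitorHom N) x)
    (fun x => Hom.toLin (leftUnitorHom M ≫ f) x) (fun z m => by
      simp only [tensorHom_pr, comp_toLin, leftUnitorHom_pr, id_toLin, f.map_smul]) (by fun_prop)
      (by fun_prop))

theorem rightUnitorHom_naturality {M N : YDModule k H} (f : M ⟶ N) :
    tensorHom f (𝟙 (unit k H)) ≫ rightUnitorHom N = rightUnitorHom M ≫ f :=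
  hom_ext (tensor_ext _ _ (fun x => Hom.toLin (tensorHom f (𝟙 (unit k H)) ≫ rightUnitorHom N) x)
    (fun x => Hom.toLin (rightUnitorHom M ≫ f) x) (fun m z => by
      simp only [tensorHom_pr, comp_toLin, rightUnitorHom_pr, id_toLin, f.map_smul]) (by fun_prop)
      (by fun_prop))

theorem assocHom_pentagon (M N P Q : YDModule k H) :
    tensorHom (assocHom M N P) (𝟙 Q) ≫ assocHom M (tensor N P) Q ≫
        tensorHom (𝟙 M) (assocHom N P Q) =
      assocHom (tensor M N) P Q ≫ assocHom M N (tensor P Q) := by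
  refine hom_ext (tensor_ext_left (fun x => Hom.toLin (tensorHom (assocHom M N P) (𝟙 Q) ≫
    assocHom M (tensor N P) Q ≫ tensorHom (𝟙 M) (assocHom N P Q)) x)
    (fun x => Hom.toLin (assocHom (tensor M N) P Q ≫ assocHom M N (tensor P Q)) x)
    (fun x p q => ?_) (by fun_prop) (by fun_prop))
  refine tensor_ext M N (fun x => Hom.toLin (tensorHom (assocHom M N P) (𝟙 Q) ≫
    assocHom M (tensor N P) Q ≫ tensorHom (𝟙 M) (assocHom N P Q))
      (pr (tensor (tensor M N) P) Q (pr (tensor M N) P (x ⊗ₜ p) ⊗ₜ q)))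
    (fun x => Hom.toLin (assocHom (tensor M N) P Q ≫ assocHom M N (tensor P Q))
      (pr (tensor (tensor M N) P) Q (pr (tensor M N) P (x ⊗ₜ p) ⊗ₜ q)))
    (fun m n => ?_) (by fun_prop) (by fun_prop) x
  simp only [tensorHom_pr, comp_toLin, assocHom_pr, id_toLin]

theorem assocHom_triangle :
    assocHom M (unit k H) N ≫ tensorHom (𝟙 M) (leftUnitorHom N) =
      tensorHom (rightUnitorHom M) (𝟙 N) :=
  hom_ext (tensor_ext_left
    (fun x => Hom.toLin (assocHom M (unit k H) N ≫ tensorHom (𝟙 M) (leftUnitorHom N)) x)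
    (fun x => Hom.toLin (tensorHom (rightUnitorHom M) (𝟙 N)) x) (fun m z n => by
      simp only [tensorHom_pr, comp_toLin, assocHom_pr, leftUnitorHom_pr, rightUnitorHom_pr,
        id_toLin, pr_triangle]) (by fun_prop) (by fun_prop))

noncomputable instance : MonoidalCategory (YDModule k H) :=
  MonoidalCategory.ofTensorHom
    (id_tensorHom_id := tensorHom_id_id)
    (id_tensorHom := fun _ _ _ _ => rfl)
    (tensorHom_id := fun _ _ => rfl)
    (tensorHom_comp_tensorHom := fun f f' g g' => tensorHom_comp f f' g g')
    (associator_naturality := fun f g h => assocHom_naturality f g h)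
    (leftUnitor_naturality := fun f => leftUnitorHom_naturality f)
    (rightUnitor_naturality := fun f => rightUnitorHom_naturality f)
    (pentagon := fun M N P Q => assocHom_pentagon M N P Q)
    (triangle := fun M N => assocHom_triangle M N)

end Unit

/-! ### Finite generation and projectivity over k. -/

section Finite

variable {k H : Type u} [CommRing k] [Ring H] [WeakBialgebra k H]

theorem finite_projective_of_retract {A B : Type u} [AddCommGroup A] [Module k A] [AddCommGroup B]
    [Module k B] [Module.Finite k A] [Module.Projective k A] (i : B →ₗ[k] A) (p : A →ₗ[k] B)
    (h : ∀ b, p (i b) = b) : Module.Finite k B ∧ Module.Projective k B :=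
  ⟨Module.Finite.of_surjective p fun b => ⟨i b, h b⟩,
    Module.Projective.of_split i p (LinearMap.ext h)⟩

theorem tensor_finite_projective (M N : YDModule k H)
    (hM : Module.Finite k M ∧ Module.Projective k M)
    (hN : Module.Finite k N ∧ Module.Projective k N) :
    Module.Finite k (tensor M N) ∧ Module.Projective k (tensor M N) := by
  obtain ⟨_, _⟩ := hM
  obtain ⟨_, _⟩ := hN
  exact finite_projective_of_retract (incl M N) (pr M N) projT_coe

/-- A finite decomposition Δ(1) = ∑ p ⊗ q writes z = ε_t(z) = ∑ ε(pz)q, so H_t is a retract of a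
finite free module. -/
theorem unit_finite_projective : Module.Finite k (unit k H) ∧ Module.Projective k (unit k H) := by
  let s := (TensorProduct.exists_finset (Coalgebra.comul (R := k) (1 : H))).choose
  let i : unit k H →ₗ[k] (s → k) := LinearMap.pi fun p =>
    Coalgebra.counit ∘ₗ LinearMap.mulLeft k p.1.1 ∘ₗ unitVal
  let q : (s → k) →ₗ[k] unit k H := ∑ p : s, (LinearMap.proj p).smulRight (toUnit k H p.1.2)
  refine finite_projective_of_retract i q fun z => ?_
  have h : toUnit k H (targetMap k H (unitVal z)) = z := by rw [toUnit_targetMap, toUnit_unitVal]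
  rw [targetMap_eq, linearMap_sw] at h
  conv_rhs => rw [← h]
  simp only [sw, q, i, LinearMap.sum_apply, LinearMap.smulRight_apply, LinearMap.proj_apply,
    LinearMap.pi_apply, LinearMap.comp_apply, LinearMap.mulLeft_apply, map_smul]
  exact Finset.sum_coe_sort s fun p => Coalgebra.counit (R := k) (p.1 * unitVal z) • toUnit k H p.2

theorem isMonoidal_finite_projective : ObjectProperty.IsMonoidal
    (fun M : YDModule k H => Module.Finite k M ∧ Module.Projective k M) where
  prop_unit := unit_finite_projective
  prop_tensor M N hM hN := tensor_finite_projective M N hM hN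

end Finite

end YDModule

/-! ### The antipode of a weak Hopf algebra -/

namespace WeakHopfAlgebra

open WeakBialgebra

section Antipode

variable {k H P : Type u} [CommRing k] [Ring H] [WeakHopfAlgebra k H] [AddCommGroup P] [Module k P]

local notation "Δ" => Coalgebra.comul (R := k)
local notation "ε" => Coalgebra.counit (R := k)
local notation "εt" => targetMap k H
local notation "εs" => sourceMap k H
local notation "εs'" => sourceMapOp k H
local notation "εt'" => targetMapOp k
local notation "S" => antipode (k := k) (H := H)

theorem sw_antipode_mul (h : H) (F : H → P) (hF : IsLinearMap k F := by fun_prop) :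
    (sw (Δ h) fun a b => F (S a * b)) = F (εs h) := by
  rw [← antipode_conv_id, LinearMap.comp_apply, LinearMap.comp_apply, map_eq_sw, linearMap_sw,
    hF.map_sw]
  simp

theorem sw_mul_antipode (h : H) (F : H → P) (hF : IsLinearMap k F := by fun_prop) :
    (sw (Δ h) fun a b => F (a * S b)) = F (εt h) := by
  rw [← id_conv_antipode, LinearMap.comp_apply, LinearMap.comp_apply, map_eq_sw, linearMap_sw,
    hF.map_sw]
  simp

theorem sw_antipode_mul_targetMap (h : H) (F : H → P) (hF : IsLinearMap k F := by fun_prop) :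
    (sw (Δ h) fun a b => F (S a * εt b)) = F (S h) := by
  conv_rhs => rw [← antipode_conv_id_conv_antipode, id_conv_antipode, LinearMap.comp_apply,
    LinearMap.comp_apply, map_eq_sw, linearMap_sw, hF.map_sw]
  simp

/-- Both S(h₁)ε_t(h₂) and ε_s(h₁)S(h₂) are bracketings of S(h₁)h₂S(h₃). -/
theorem sw_sourceMap_mul_antipode (h : H) (F : H → P) (hF : IsLinearMap k F := by fun_prop) :
    (sw (Δ h) fun a b => F (εs a * S b)) = F (S h) := by
  rw [← sw_antipode_mul_targetMap h F]
  calc _ = sw (Δ h) fun a b => sw (Δ a) fun c d => F (S c * d * S b) :=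
        sw_congr _ fun a b => (sw_antipode_mul a fun x => F (x * S b)).symm
    _ = sw (Δ h) fun a b => sw (Δ b) fun c d => F (S a * c * S d) :=
        sw_coassoc h fun x y z => F (S x * y * S z)
    _ = _ := by
        simp only [mul_assoc]
        exact sw_congr _ fun a b => sw_mul_antipode b fun x => F (S a * x)

/-- S(1) = S(1₁)ε_t(1₂) = S(1₁)1₂ = ε_s(1) = 1. -/
theorem antipode_one : S 1 = 1 := by
  rw [← sw_antipode_mul_targetMap (1 : H) fun x => x, sw_one_targetMap fun a b => S a * b,
    sw_antipode_mul (1 : H) fun x => x, sourceMap_one]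

theorem sw_mul_mul_antipode {z : H} (hz : IsRightLeg k z) (h : H) (F : H → P)
    (hF : IsLinearMap k F := by fun_prop) :
    (sw (Δ h) fun a b => F (a * z * S b)) = F (εt (h * z)) := by
  rw [← sw_mul_antipode (h * z) F, hz.sw_comul_mul_right h fun a b => F (a * S b)]

theorem sourceMap_sourceMap_mul (g h : H) : εs (εs g * h) = εs (g * h) := by
  simp only [sourceMap_eq (_ * h), mul_assoc, counit_sourceMap_mul]

/-- Because ε_s(gh) = ε_s(ε_s(g)h), and the left leg ε_s(g) enters Δ(ε_s(g)h) only in the second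
factor. -/
theorem sw_antipode_mul_mul (g h : H) (F : H → P) (hF : IsLinearMap k F := by fun_prop) :
    (sw (Δ h) fun a b => F (S a * (εs g * b))) = F (εs (g * h)) := by
  rw [← sourceMap_sourceMap_mul, ← sw_antipode_mul (εs g * h) F,
    (isLeftLeg_sourceMap g).sw_comul_mul_left h fun a b => F (S a * b)]

/-- The weak form of uniqueness of convolution inverses: S(g₁h₁) g₂h₂ S(h₃)S(g₃) is evaluated in two
ways. The last four factors give ε_t(g₂h₂), hence S(gh); the first three give ε_s(g₁h₁) =
S(h₁)ε_s(g₁)h₂, which leads to S(h)S(g). -/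
theorem antipode_mul (g h : H) : S (g * h) = S h * S g := by
  calc S (g * h) = sw (Δ (g * h)) fun x y => S x * εt y :=
        (sw_antipode_mul_targetMap (g * h) fun x => x).symm
    _ = sw (Δ g) fun a b => sw (Δ h) fun c d => S (a * c) * εt (b * d) :=
        sw_comul_mul g h fun x y => S x * εt y
    _ = sw (Δ g) fun a b => sw (Δ h) fun c d => sw (Δ b) fun p q =>
          S (a * c) * (p * εt d * S q) := by
        refine sw_congr _ fun a b => sw_congr _ fun c d => ?_
        rw [sw_mul_mul_antipode (isRightLeg_targetMap d) b fun x => S (a * c) * x,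
          targetMap_mul_targetMap]
    _ = sw (Δ g) fun a b => sw (Δ b) fun p q => sw (Δ h) fun c d => sw (Δ d) fun r s =>
          S (a * c) * (p * (r * S s) * S q) := by
        refine sw_congr _ fun a b => ?_
        rw [sw_comm]
        exact sw_congr _ fun p q => sw_congr _ fun c d =>
          (sw_mul_antipode d fun x => S (a * c) * (p * x * S q)).symm
    _ = sw (Δ g) fun a b => sw (Δ a) fun p q => sw (Δ h) fun c d => sw (Δ d) fun r s =>
          S (p * c) * (q * (r * S s) * S b) :=
        (sw_coassoc g fun a p q => sw (Δ h) fun c d => sw (Δ d) fun r s =>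
          S (a * c) * (p * (r * S s) * S q)).symm
    _ = sw (Δ g) fun a b => sw (Δ a) fun p q => sw (Δ h) fun c d => sw (Δ c) fun r s =>
          S (p * r) * (q * (s * S d) * S b) :=
        sw_congr _ fun a b => sw_congr _ fun p q => (sw_coassoc h fun c r s =>
          S (p * c) * (q * (r * S s) * S b)).symm
    _ = sw (Δ g) fun a b => sw (Δ h) fun c d => sw (Δ (a * c)) fun p q =>
          S p * q * (S d * S b) := by
        refine sw_congr _ fun a b => ?_
        rw [sw_comm]
        refine sw_congr _ fun c d => ?_
        rw [sw_comul_mul a c fun p q => S p * q * (S d * S b)]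
        simp only [mul_assoc]
    _ = sw (Δ g) fun a b => sw (Δ h) fun c d => sw (Δ c) fun r s =>
          S r * (εs a * s) * (S d * S b) := by
        refine sw_congr _ fun a b => sw_congr _ fun c d => ?_
        rw [sw_antipode_mul (a * c) fun x => x * (S d * S b),
          sw_antipode_mul_mul a c fun x => x * (S d * S b)]
    _ = sw (Δ g) fun a b => sw (Δ h) fun c d => sw (Δ d) fun r s =>
          S c * (εs a * r) * (S s * S b) :=
        sw_congr _ fun a b => sw_coassoc h fun r s d => S r * (εs a * s) * (S d * S b)
    -- Once h₂S(h₃) has become ε_t(h₂), it commutes past ε_s(g₁), so each variable meets its own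
    -- antipode.
    _ = sw (Δ g) fun a b => sw (Δ h) fun c d => S c * εt d * (εs a * S b) := by
        refine sw_congr _ fun a b => sw_congr _ fun c d => ?_
        have h1 := sw_mul_antipode (k := k) d fun x => S c * (εs a * x) * S b
        simp only [mul_assoc] at h1 ⊢
        rw [h1, ← mul_assoc (εs a), ← mul_assoc (εt d),
          (isRightLeg_targetMap d).mul_comm (isLeftLeg_sourceMap a)]
    _ = sw (Δ g) fun a b => S h * (εs a * S b) :=
        sw_congr _ fun a b => sw_antipode_mul_targetMap h fun x => x * (εs a * S b)
    _ = S h * S g := sw_sourceMap_mul_antipode g fun x => S h * x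

/-- Since Δ(y) = 1₁ ⊗ y1₂, ε_t(y) = 1₁S(y1₂) = 1₁S(1₂)S(y) = S(y). -/
theorem targetMap_of_isLeftLeg {y : H} (hy : IsLeftLeg k y) : εt y = S y := by
  rw [← sw_mul_antipode y fun x => x, hy.sw_comul' fun a b => a * S b]
  simp only [antipode_mul, ← mul_assoc]
  rw [sw_mul_antipode (1 : H) fun x => x * S y, targetMap_one, one_mul]

theorem sourceMap_of_isRightLeg {z : H} (hz : IsRightLeg k z) : εs z = S z := by
  rw [← sw_antipode_mul z fun x => x, hz.sw_comul fun a b => S a * b]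
  simp only [antipode_mul, mul_assoc]
  rw [sw_antipode_mul (1 : H) fun x => S z * x, sourceMap_one, mul_one]

/-- `S(1₍₂₎) ⊗ S(1₍₁₎) = 1₍₁₎ ⊗ 1₍₂₎` -/
theorem sw_one_antipode (F : H → H → P)
    (h1 : ∀ b, IsLinearMap k fun a => F a b := by intros; fun_prop)
    (h2 : ∀ a, IsLinearMap k fun b => F a b := by intros; fun_prop) :
    (sw (Δ (1 : H)) fun a b => F (S b) (S a)) = sw (Δ 1) F := by
  calc (sw (Δ (1 : H)) fun a b => F (S b) (S a))
      = sw (Δ (1 : H)) fun a b => F (S (εt b)) (S (εs' a)) :=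
        (sw_one_targetMap fun a b => F (S b) (S a)).symm.trans
          (sw_one_sourceMapOp fun a b => F (S (εt b)) (S a)).symm
    _ = sw (Δ (1 : H)) fun a b => F (εs (εt b)) (εt (εs' a)) := by
        simp only [sourceMap_of_isRightLeg (isRightLeg_targetMap _),
          targetMap_of_isLeftLeg (isLeftLeg_sourceMapOp _)]
    _ = sw (Δ (1 : H)) fun a b => F (εs b) (εt a) :=
        (sw_one_sourceMapOp fun a b => F (εs (εt b)) (εt a)).trans
          (sw_one_targetMap fun a b => F (εs b) (εt a))
    _ = sw (Δ (1 : H)) fun a b => sw (Δ (1 : H)) fun c d => sw (Δ (1 : H)) fun p q =>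
          (ε (p * a) * ε (b * d)) • F c q := by
        simp (disch := ((repeat intro _); fun_prop)) only [sourceMap_eq, targetMap_eq,
          (h1 _).map_sw, (h1 _).map_smul, (h2 _).map_sw,
          (h2 _).map_smul, smul_sw, smul_smul]
        exact sw_congr _ fun a b => sw_congr _ fun c d => sw_congr _ fun p q =>
          congrArg (· • F c q) (_root_.mul_comm _ _)
    -- The sum over a ⊗ b contracts by ε(p1₁)ε(1₂d) = ε(pd); the other two copies of Δ(1) then form
    -- 1₁ ⊗ ε_t(1₂).
    _ = sw (Δ (1 : H)) fun c d => sw (Δ (1 : H)) fun p q => ε (p * d) • F c q := by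
        rw [sw_comm]
        refine sw_congr _ fun c d => ?_
        rw [sw_comm]
        refine sw_congr _ fun p q => ?_
        rw [← sw_smul_const, counit_mul_left'']
    _ = sw (Δ (1 : H)) fun c d => F c (εt d) := by
        simp (disch := ((repeat intro _); fun_prop)) only [targetMap_eq, (h2 _).map_sw,
          (h2 _).map_smul]
    _ = sw (Δ 1) F := sw_one_targetMap F

/-- `Δ(S(h)) = S(h₍₂₎) ⊗ S(h₍₁₎)` -/
theorem sw_comul_antipode (h : H) (F : H → H → P)
    (h1 : ∀ b, IsLinearMap k fun a => F a b := by intros; fun_prop)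
    (h2 : ∀ a, IsLinearMap k fun b => F a b := by intros; fun_prop) :
    sw (Δ (S h)) F = sw (Δ h) fun a b => F (S b) (S a) := by
  -- In Sweedler notation: Δ(ε_s(a)) = S(a₂)a₃ ⊗ S(a₁)a₄.
  have hεs : ∀ (a : H) (G : H → H → P) (_ : ∀ b, IsLinearMap k fun a => G a b)
      (_ : ∀ a, IsLinearMap k fun b => G a b), sw (Δ (εs a)) G =
        sw (Δ a) fun c d => sw (Δ d) fun p q => sw (Δ p) fun r s => G (S r * s) (S c * q) := by
    intro a G hG1 hG2
    calc sw (Δ (εs a)) G = sw (Δ 1) fun c d => G c (εs a * d) :=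
          (isLeftLeg_sourceMap a).sw_comul' G
      _ = sw (Δ 1) fun p q => sw (Δ a) fun c d => G p (S c * d * q) :=
          sw_congr _ fun p q => (sw_antipode_mul a fun x => G p (x * q)).symm
      _ = sw (Δ a) fun c d => sw (Δ 1) fun p q => G p (S c * (d * q)) := by
          rw [sw_comm]
          simp only [mul_assoc]
      _ = sw (Δ a) fun c d => sw (Δ d) fun p q => G (εs p) (S c * q) :=
          sw_congr _ fun c d => (sw_sourceMap_left d fun p q => G p (S c * q)).symm
      _ = _ := sw_congr _ fun c d => sw_congr _ fun p q =>
          (sw_antipode_mul p fun x => G x (S c * q)).symm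
  -- Start from S(h) = ε_s(h₁)S(h₂). After `hεs`, regrouping forms Δ(h₃S(h₄)) = Δ(ε_t(h₃)) =
  -- ε_t(h₃)1₁ ⊗ 1₂. The factor ε_t(h₃) is absorbed by S(h₂), and the remaining Δ(1), rewritten as
  -- S(1₂) ⊗ S(1₁), by antimultiplicativity.
  calc sw (Δ (S h)) F = sw (Δ h) fun a b => sw (Δ (εs a * S b)) F :=
        (sw_sourceMap_mul_antipode h fun x => sw (Δ x) F).symm
    _ = sw (Δ h) fun a b => sw (Δ (εs a)) fun c d => sw (Δ (S b)) fun u v =>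
          F (c * u) (d * v) := sw_congr _ fun a b => sw_comul_mul _ _ F
    _ = sw (Δ h) fun a b => sw (Δ a) fun c d => sw (Δ d) fun p q => sw (Δ p) fun r s =>
          sw (Δ (S b)) fun u v => F (S r * s * u) (S c * q * v) :=
        sw_congr _ fun a b => hεs a (fun c d => sw (Δ (S b)) fun u v => F (c * u) (d * v))
          (by intros; fun_prop) (by intros; fun_prop)
    _ = sw (Δ h) fun a b => sw (Δ a) fun c d => sw (Δ d) fun r x => sw (Δ x) fun s q =>
          sw (Δ (S b)) fun u v => F (S r * s * u) (S c * q * v) :=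
        sw_congr _ fun a b => sw_congr _ fun c d => sw_coassoc d fun r s q =>
          sw (Δ (S b)) fun u v => F (S r * s * u) (S c * q * v)
    _ = sw (Δ h) fun a b => sw (Δ a) fun c d => sw (Δ d) fun r x =>
          sw (Δ (x * S b)) fun s q => F (S r * s) (S c * q) := by
        refine sw_congr _ fun a b => sw_congr _ fun c d => sw_congr _ fun r x => ?_
        rw [sw_comul_mul x (S b) fun s q => F (S r * s) (S c * q)]
        simp only [mul_assoc]
    _ = sw (Δ h) fun c y => sw (Δ y) fun d b => sw (Δ d) fun r x =>
          sw (Δ (x * S b)) fun s q => F (S r * s) (S c * q) :=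
        sw_coassoc h fun c d b => sw (Δ d) fun r x =>
          sw (Δ (x * S b)) fun s q => F (S r * s) (S c * q)
    _ = sw (Δ h) fun c y => sw (Δ y) fun r w => sw (Δ w) fun x b =>
          sw (Δ (x * S b)) fun s q => F (S r * s) (S c * q) :=
        sw_congr _ fun c y => sw_coassoc y fun r x b =>
          sw (Δ (x * S b)) fun s q => F (S r * s) (S c * q)
    _ = sw (Δ h) fun c y => sw (Δ y) fun r w =>
          sw (Δ (εt w)) fun s q => F (S r * s) (S c * q) :=
        sw_congr _ fun c y => sw_congr _ fun r w => sw_mul_antipode w fun x =>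
          sw (Δ x) fun s q => F (S r * s) (S c * q)
    _ = sw (Δ h) fun c y => sw (Δ y) fun r w =>
          sw (Δ 1) fun s q => F (S r * εt w * s) (S c * q) := by
        refine sw_congr _ fun c y => sw_congr _ fun r w => ?_
        rw [(isRightLeg_targetMap w).sw_comul' fun s q => F (S r * s) (S c * q)]
        simp only [mul_assoc]
    _ = sw (Δ h) fun c y => sw (Δ 1) fun s q => F (S y * s) (S c * q) :=
        sw_congr _ fun c y => sw_antipode_mul_targetMap y fun x =>
          sw (Δ 1) fun s q => F (x * s) (S c * q)
    _ = sw (Δ h) fun a b => sw (Δ 1) fun c d => F (S b * S d) (S a * S c) :=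
        sw_congr _ fun a b => (sw_one_antipode fun s q => F (S b * s) (S a * q)).symm
    _ = sw (Δ h) fun a b => F (S b) (S a) := by
        simp only [← antipode_mul]
        rw [sw_comm, sw_comul_one_mul h fun a b => F (S b) (S a)]

theorem counit_antipode (h : H) : ε (S h) = ε h := by
  rw [← sw_antipode_mul_targetMap h fun x => ε x]
  simp only [counit_mul_targetMap]
  rw [sw_antipode_mul h fun x => ε x, ← mul_one (εs h), counit_sourceMap_mul, mul_one]

/-- On a left leg S is ε_t, and ε_t does not distinguish ε̄_s(h) from h. With `antipode_targetMapOp`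
this gives the counital maps belonging to S⁻¹. -/
theorem antipode_sourceMapOp (h : H) : S (εs' h) = εt h := by
  rw [← targetMap_of_isLeftLeg (isLeftLeg_sourceMapOp h)]
  simp only [targetMap_eq, counit_mul_sourceMapOp]

/-- With Δ(1) = S(1₂) ⊗ S(1₁), ε_s(h) = ε(hS(1₁))S(1₂); on legs S(1₁) is ε_t(1₁), and under ε this
may be replaced by 1₁. -/
theorem antipode_targetMapOp (h : H) : S (εt' h) = εs h := by
  rw [targetMapOp, linearMap_sw, sourceMap_eq, ← sw_one_antipode fun a b => ε (h * b) • a]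
  simp only [map_smul]
  rw [← sw_one_sourceMapOp fun a b => ε (h * a) • S b,
    ← sw_one_sourceMapOp fun a b => ε (h * S a) • S b]
  simp only [← targetMap_of_isLeftLeg (isLeftLeg_sourceMapOp _), counit_mul_targetMap]

/-! ### The inverse of the antipode. -/

section Inverse

variable {T : H →ₗ[k] H}

theorem inverse_mul (hST : ∀ x : H, S (T x) = x) (hTS : ∀ x : H, T (S x) = x)
    (g h : H) : T (g * h) = T h * T g := by
  rw [← hTS (T h * T g), antipode_mul, hST, hST]

theorem sw_comul_inverse (hST : ∀ x : H, S (T x) = x) (hTS : ∀ x : H, T (S x) = x)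
    (h : H) (F : H → H → P)
    (h1 : ∀ b, IsLinearMap k fun a => F a b := by intros; fun_prop)
    (h2 : ∀ a, IsLinearMap k fun b => F a b := by intros; fun_prop) :
    sw (Δ (T h)) F = sw (Δ h) fun a b => F (T b) (T a) := by
  conv_rhs => rw [← hST h, sw_comul_antipode (T h) fun a b => F (T b) (T a)]
  simp only [hTS]

theorem counit_inverse (hST : ∀ x : H, S (T x) = x) (h : H) : ε (T h) = ε h := by
  rw [← counit_antipode, hST]

/-- Apply T to S(h₁)h₂ = ε_s(h) = S(ε̄_t(h)). In the same way `sw_mul_inverse` comes from h₁S(h₂) =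
ε_t(h) = S(ε̄_s(h)). -/
theorem sw_inverse_mul (hST : ∀ x : H, S (T x) = x) (hTS : ∀ x : H, T (S x) = x)
    (h : H) (F : H → P) (hF : IsLinearMap k F := by fun_prop) :
    (sw (Δ h) fun a b => F (T b * a)) = F (εt' h) := by
  have h1 := sw_antipode_mul h fun x => F (T x)
  rw [← antipode_targetMapOp, hTS] at h1
  rw [← h1]
  simp only [inverse_mul hST hTS, hTS]

theorem sw_mul_inverse (hST : ∀ x : H, S (T x) = x) (hTS : ∀ x : H, T (S x) = x)
    (h : H) (F : H → P) (hF : IsLinearMap k F := by fun_prop) :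
    (sw (Δ h) fun a b => F (b * T a)) = F (εs' h) := by
  have h1 := sw_mul_antipode h fun x => F (T x)
  rw [← antipode_sourceMapOp, hTS] at h1
  rw [← h1]
  simp only [inverse_mul hST hTS, hTS]

end Inverse

end Antipode

end WeakHopfAlgebra

namespace YDModule

open WeakBialgebra WeakHopfAlgebra

/-- `λ(ym) = m₍₋₁₎ S(y) ⊗ m₍₀₎` for `y` in the source space -/
theorem sw_coact_leftLeg_smul {k H P : Type u} [CommRing k] [Ring H] [WeakHopfAlgebra k H]
    [AddCommGroup P] [Module k P] (M : YDModule k H) {y : H} (hy : IsLeftLeg k y) (m : M)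
    (F : H → M → P)
    (h1 : ∀ b, IsLinearMap k fun a => F a b := by intros; fun_prop)
    (h2 : ∀ a, IsLinearMap k fun b => F a b := by intros; fun_prop) :
    sw (M.coact (y • m)) F = sw (M.coact m) fun u n => F (u * antipode (k := k) y) n := by
  rw [← targetMap_of_isLeftLeg hy, ← sw_coact_sourceMapOp_smul M (isRightLeg_targetMap y) m F,
    sourceMapOp_targetMap, hy.sourceMapOp_eq_self]

end YDModule

/-! ### Dual bases -/

section Sums

variable {k : Type*} [CommSemiring k] {A B P X ι : Type*} [AddCommMonoid A] [Module k A]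
  [AddCommMonoid B] [Module k B] [AddCommMonoid P] [Module k P] [AddCommMonoid X] [Module k X]

@[fun_prop]
theorem isLinearMap_sum (s : Finset ι) {F : ι → X → P} (h : ∀ i, IsLinearMap k (F i)) :
    IsLinearMap k fun x => ∑ i ∈ s, F i x :=
  ⟨fun x y => by simp [(h _).map_add, Finset.sum_add_distrib],
    fun c x => by simp [(h _).map_smul, Finset.smul_sum]⟩

theorem IsLinearMap.map_finset_sum {f : X → P} (hf : IsLinearMap k f) (s : Finset ι) (g : ι → X) :
    f (∑ i ∈ s, g i) = ∑ i ∈ s, f (g i) :=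
  map_sum (hf.mk' f) g s

theorem sw_sum (s : Finset ι) (t : ι → A ⊗[k] B) (F : A → B → P)
    (h1 : ∀ b, IsLinearMap k fun a => F a b := by intros; fun_prop)
    (h2 : ∀ a, IsLinearMap k fun b => F a b := by intros; fun_prop) :
    sw (∑ i ∈ s, t i) F = ∑ i ∈ s, sw (t i) F :=
  (isLinearMap_sw_left isLinearMap_id' h1 h2).map_finset_sum s t

theorem sum_sw {Q : Type*} [AddCommMonoid Q] (s : Finset ι) (t : A ⊗[k] B) (F : ι → A → B → Q) :
    ∑ i ∈ s, sw t (F i) = sw t fun a b => ∑ i ∈ s, F i a b :=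
  Finset.sum_comm

end Sums

/-- A finite dual basis of a module. -/
structure DualBasis (k M : Type*) [CommRing k] [AddCommGroup M] [Module k M] where
  /-- the number of elements -/
  card : ℕ
  /-- the vectors `nᵢ` -/
  vec : Fin card → M
  /-- the linear forms `nᵢ*` -/
  coord : Fin card → Module.Dual k M
  /-- `∑ᵢ ⟨nᵢ*, m⟩ nᵢ = m` -/
  sum_coord_smul_vec : ∀ m : M, ∑ i, coord i m • vec i = m

namespace DualBasis

section

variable {k M : Type*} [CommRing k] [AddCommGroup M] [Module k M] {A B P : Type*} [AddCommGroup A]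
  [Module k A] [AddCommGroup B] [Module k B] [AddCommGroup P] [Module k P]

theorem nonempty_of_finite_of_projective [Module.Finite k M] [Module.Projective k M] :
    Nonempty (DualBasis k M) := by
  obtain ⟨r, f, g, -, -, hfg⟩ := Module.Finite.exists_comp_eq_id_of_projective k M
  refine ⟨⟨r, fun i => f (Pi.single i 1), fun i => LinearMap.proj i ∘ₗ g, fun m => ?_⟩⟩
  conv_rhs => rw [← LinearMap.id_apply (R := k) m, ← hfg, LinearMap.comp_apply,
    pi_eq_sum_univ' (g m), map_sum]
  refine Finset.sum_congr rfl fun i _ => ?_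
  rw [map_smul]
  congr 2

theorem sum_apply (b : DualBasis k M) (F : M → P) (m : M) (hF : IsLinearMap k F := by fun_prop) :
    ∑ i, b.coord i m • F (b.vec i) = F m := by
  conv_rhs => rw [← b.sum_coord_smul_vec m, hF.map_finset_sum]
  simp only [hF.map_smul]

/-- A tensor in A ⊗ M* is recovered from the map M → A that it induces; hence such tensors may be
compared on vectors. -/
theorem sum_tmul (b : DualBasis k M) (s : A ⊗[k] Module.Dual k M) :
    ∑ i, (sw s fun a f => f (b.vec i) • a) ⊗ₜ[k] b.coord i = s := by
  conv_rhs => rw [← sw_tmul_self s]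
  simp only [sw, TensorProduct.sum_tmul]
  rw [Finset.sum_comm]
  refine Finset.sum_congr rfl fun p _ => ?_
  simp only [TensorProduct.smul_tmul, ← TensorProduct.tmul_sum]
  congr 1
  ext m
  simp only [LinearMap.sum_apply, LinearMap.smul_apply, smul_eq_mul]
  rw [← b.sum_apply (fun m => p.2 m) m]
  simp only [smul_eq_mul, mul_comm]

theorem tensor_ext (b : DualBasis k M) {s t : A ⊗[k] Module.Dual k M}
    (h : ∀ m, (sw s fun a f => f m • a) = sw t fun a f => f m • a) : s = t := by
  rw [← b.sum_tmul s, ← b.sum_tmul t]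
  simp only [h]

theorem tensor_ext' (b : DualBasis k M) {s t : A ⊗[k] (B ⊗[k] Module.Dual k M)}
    (h : ∀ m, (sw s fun p y => sw y fun q f => f m • (p ⊗ₜ[k] q)) =
      sw t fun p y => sw y fun q f => f m • (p ⊗ₜ[k] q)) : s = t := by
  refine (TensorProduct.assoc k A B (Module.Dual k M)).symm.injective (b.tensor_ext fun m => ?_)
  have key : ∀ s : A ⊗[k] (B ⊗[k] Module.Dual k M),
      (sw ((TensorProduct.assoc k A B (Module.Dual k M)).symm s) fun z f => f m • z) =
        sw s fun p y => sw y fun q f => f m • (p ⊗ₜ[k] q) := by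
    intro s
    conv_rhs => rw [← (TensorProduct.assoc k A B (Module.Dual k M)).apply_symm_apply s]
    simp (disch := ((repeat intro _); fun_prop)) only [sw_assoc, sw_tmul, ← smul_sw, sw_tmul_self]
  rw [key, key, h]

end

end DualBasis

/-! ### The dual of a Yetter-Drinfeld module -/

namespace YDModule

open WeakBialgebra WeakHopfAlgebra

section Dual

variable {k H P : Type u} [CommRing k] [Ring H] [WeakHopfAlgebra k H] [AddCommGroup P] [Module k P]

local notation "Δ" => Coalgebra.comul (R := k)
local notation "ε" => Coalgebra.counit (R := k)
local notation "εt" => targetMap k H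
local notation "εs" => sourceMap k H
local notation "εs'" => sourceMapOp k H
local notation "S" => antipode (k := k) (H := H)

/-- The action `⟨h · f, m⟩ = ⟨f, S(h) m⟩` on the dual of a module. -/
noncomputable instance dualAction (M : YDModule k H) : Module H (Module.Dual k M) where
  smul h f := f ∘ₗ Algebra.lsmul k k M (S h)
  one_smul f := LinearMap.ext fun m => by
    change f (S 1 • m) = f m
    rw [antipode_one, one_smul]
  mul_smul g h f := LinearMap.ext fun m => by
    change f (S (g * h) • m) = f (S h • S g • m)
    rw [antipode_mul, mul_smul]
  smul_zero _ := rfl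
  smul_add _ _ _ := rfl
  add_smul g h f := LinearMap.ext fun m => by
    change f (S (g + h) • m) = f (S g • m) + f (S h • m)
    rw [map_add, add_smul, map_add]
  zero_smul f := LinearMap.ext fun m => by
    change f (S 0 • m) = 0
    rw [map_zero, zero_smul, map_zero]

theorem dualAction_apply {M : YDModule k H} (h : H) (f : Module.Dual k M) (m : M) :
    (h • f) m = f (S h • m) := rfl

instance (M : YDModule k H) : IsScalarTower k H (Module.Dual k M) where
  smul_assoc c h f := LinearMap.ext fun m => by
    change f (S (c • h) • m) = c • f (S h • m)
    rw [LinearMap.map_smul, smul_assoc, LinearMap.map_smul]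

variable {M : YDModule k H} (b : DualBasis k M) (T : H →ₗ[k] H)

/-- The coaction on the dual, `⟨f₍₀₎, m⟩ f₍₋₁₎ = ⟨f, m₍₀₎⟩ T(m₍₋₁₎)`. -/
noncomputable def dualCoact : Module.Dual k M →ₗ[k] H ⊗[k] Module.Dual k M :=
  IsLinearMap.mk' (fun f => ∑ i, sw (M.coact (b.vec i)) fun u x => f x • (T u ⊗ₜ[k] b.coord i))
    (by fun_prop)

/-- By `DualBasis.tensor_ext` this formula determines the coaction, so the coaction does not depend
on the dual basis. Later arguments use the coaction only through it. -/
theorem sw_dualCoact (f : Module.Dual k M) (m : M) (F : H → P)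
    (hF : IsLinearMap k F := by fun_prop) :
    (sw (dualCoact b T f) fun u g => g m • F u) = sw (M.coact m) fun u x => f x • F (T u) := by
  rw [← b.sum_apply (fun m => sw (M.coact m) fun u x => f x • F (T u)) m]
  simp only [dualCoact, IsLinearMap.mk'_apply]
  rw [sw_sum _ _ fun u (g : Module.Dual k M) => g m • F u]
  refine Finset.sum_congr rfl fun i _ => ?_
  rw [sw_sw _ _ fun u (g : Module.Dual k M) => g m • F u, smul_sw]
  refine sw_congr _ fun u x => ?_
  rw [TensorProduct.smul_tmul', sw_tmul _ _ fun u (g : Module.Dual k M) => g m • F u, hF.map_smul]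

/-- Writing h₁ = T(S(h₁)), h₁T(u) becomes T(uS(h₁)), while h₂ acts on the form through S(h₂). Thus
Δ(S(h)) appears, and the right side is T applied to one side of the compatibility of M at S(h). -/
theorem sw_diagAct_dualCoact {T : H →ₗ[k] H} (hST : ∀ x : H, S (T x) = x)
    (hTS : ∀ x : H, T (S x) = x) (h : H) (f : Module.Dual k M) (m : M) :
    (sw (diagAct k H (Module.Dual k M) h (dualCoact b T f)) fun u g => g m • u) =
      sw (Δ (S h)) fun c d => sw (M.coact (c • m)) fun u x => f x • T (u * d) := by
  rw [diagAct_eq_sw, sw_comul_antipode h fun c d => sw (M.coact (c • m)) fun u x =>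
    f x • T (u * d), sw_sw _ _ fun u (g : Module.Dual k M) => g m • u]
  refine sw_congr _ fun p q => ?_
  rw [sw_sw _ _ fun u (g : Module.Dual k M) => g m • u]
  simp (disch := ((repeat intro _); fun_prop)) only [sw_tmul, inverse_mul hST hTS, hTS,
    dualAction_apply]
  exact sw_dualCoact b T f (S q • m) fun u => p * u

theorem sw_dualCoact_dualCoact (f : Module.Dual k M) (m : M) :
    (sw (dualCoact b T f) fun u g => sw (dualCoact b T g) fun q g' => g' m • (u ⊗ₜ[k] q)) =
      sw (M.coact m) fun v x => sw (M.coact x) fun w y => f y • (T w ⊗ₜ[k] T v) := by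
  calc _ = sw (dualCoact b T f) fun u g => sw (M.coact m) fun v x => g x • (u ⊗ₜ[k] T v) :=
        sw_congr _ fun u g => sw_dualCoact b T g m fun q => u ⊗ₜ[k] q
    _ = sw (M.coact m) fun v x => sw (dualCoact b T f) fun u g => g x • (u ⊗ₜ[k] T v) :=
        sw_comm _ _ _
    _ = _ := sw_congr _ fun v x => sw_dualCoact b T f x fun u => u ⊗ₜ[k] T v

/-- Pairing with a vector reverses the order of two successive coactions; anticomultiplicativity of
T compensates for it. -/
theorem dualCoact_coassoc {T : H →ₗ[k] H} (hST : ∀ x : H, S (T x) = x)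
    (hTS : ∀ x : H, T (S x) = x) (f : Module.Dual k M) :
    TensorProduct.assoc k H H (Module.Dual k M)
        ((Coalgebra.comul (R := k) (A := H)).rTensor (Module.Dual k M) (dualCoact b T f)) =
      (dualCoact b T).lTensor H (dualCoact b T f) := by
  refine b.tensor_ext' fun m => ?_
  simp (disch := ((repeat intro _); fun_prop)) only [sw_assoc, sw_rTensor, sw_lTensor, sw_tmul]
  rw [sw_dualCoact_dualCoact]
  calc _ = sw (dualCoact b T f) fun u g => g m • Δ u :=
        sw_congr _ fun u g => by rw [← smul_sw, sw_tmul_self]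
    _ = sw (M.coact m) fun u x => f x • Δ (T u) := sw_dualCoact b T f m fun u => Δ u
    _ = sw (M.coact m) fun u x => sw (Δ u) fun p q => f x • (T q ⊗ₜ[k] T p) := by
        refine sw_congr _ fun u x => ?_
        rw [← smul_sw, ← sw_comul_inverse hST hTS u fun p q => p ⊗ₜ[k] q, sw_tmul_self]
    _ = _ := sw_coact_coassoc M m fun p q x => f x • (T q ⊗ₜ[k] T p)

/-- The dual of a Yetter-Drinfeld module. -/
noncomputable def dual {T : H →ₗ[k] H} (hST : ∀ x : H, S (T x) = x)
    (hTS : ∀ x : H, T (S x) = x) : YDModule k H where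
  carrier := Module.Dual k M
  coact := dualCoact b T
  coassoc := dualCoact_coassoc b hST hTS
  counit f := by
    refine LinearMap.ext fun m => ?_
    rw [lid_eq_sw, sw_rTensor _ _ fun c (g : Module.Dual k M) => c • g,
      map_sw (fun g : Module.Dual k M => g m)]
    simp only [LinearMap.smul_apply, smul_eq_mul, _root_.mul_comm (ε _)]
    simp only [← smul_eq_mul]
    rw [sw_dualCoact b T f m fun u => ε u]
    simp only [counit_inverse hST, smul_eq_mul, _root_.mul_comm (f _)]
    exact sw_coact_counit M m fun x => f x
  coact_mem f := by
    refine mem_tensorT_iff.2 (b.tensor_ext fun m => ?_)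
    rw [sw_diagAct_dualCoact b hST hTS, antipode_one, sw_coact_one' M m fun u x => f x • T u,
      sw_dualCoact b T f m fun u => u]
  compat h f := by
    refine b.tensor_ext fun m => ?_
    rw [sw_diagAct_dualCoact b hST hTS, sw_compat M (S h) m fun u x => f x • T u,
      coactMulRight_eq_sw, sw_comul_antipode h fun a b => sw (M.coact m) fun u n =>
        f (b • n) • T (a * u), sw_sw _ _ fun u (g : Module.Dual k M) => g m • u]
    refine sw_congr _ fun p q => ?_
    rw [sw_sw _ _ fun u (g : Module.Dual k M) => g m • u]
    simp (disch := ((repeat intro _); fun_prop)) only [sw_tmul]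
    rw [sw_dualCoact b T (p • f) m fun u => u * q]
    simp only [inverse_mul hST hTS, hTS, dualAction_apply]

end Dual

end YDModule

/-! ### The coaction of M ⊗_t N inside H ⊗ (M ⊗ N). -/

namespace YDModule

open WeakBialgebra WeakHopfAlgebra

section InclCoact

variable {k H : Type u} [CommRing k] [Ring H] [WeakBialgebra k H] (M N : YDModule k H)

local notation "Δ" => Coalgebra.comul (R := k)
local notation "εs'" => sourceMapOp k H

/-- The Δ(1) in front of m₀ ⊗ n₀ is redundant: 1₁ passes from m₀ to m₋₁, and 1₁n₋₁ ⊗ 1₂n₀ = λ(n). -/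
theorem lTensor_incl_coact_pr (m : M) (n : N) :
    (incl M N).lTensor H ((tensor M N).coact (pr M N (m ⊗ₜ n))) = tensorCoact M N (m ⊗ₜ n) := by
  rw [coact_pr, tensorCoact_tmul]
  simp only [linearMap_sw, LinearMap.lTensor_tmul, incl_pr_tmul, tmul_sw]
  calc _ = sw (Δ (1 : H)) fun a b => sw (M.coact m) fun u m' => sw (N.coact n) fun v n' =>
          (u * v) ⊗ₜ[k] ((a • m') ⊗ₜ[k] (b • n')) := by
        rw [sw_comm (Δ (1 : H))]
        exact sw_congr _ fun u m' => sw_comm _ _ _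
    _ = sw (Δ (1 : H)) fun a b => sw (M.coact m) fun u m' => sw (N.coact n) fun v n' =>
          (u * v) ⊗ₜ[k] ((εs' a • m') ⊗ₜ[k] (b • n')) :=
        (sw_one_sourceMapOp fun a b => sw (M.coact m) fun u m' => sw (N.coact n) fun v n' =>
          (u * v) ⊗ₜ[k] ((a • m') ⊗ₜ[k] (b • n'))).symm
    _ = sw (Δ (1 : H)) fun a b => sw (M.coact m) fun u m' => sw (N.coact n) fun v n' =>
          (u * εs' a * v) ⊗ₜ[k] (m' ⊗ₜ[k] (b • n')) :=
        sw_congr _ fun a b => sw_coact_leftLeg M (isLeftLeg_sourceMapOp a) m fun u m' =>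
          sw (N.coact n) fun v n' => (u * v) ⊗ₜ[k] (m' ⊗ₜ[k] (b • n'))
    _ = sw (Δ (1 : H)) fun a b => sw (M.coact m) fun u m' => sw (N.coact n) fun v n' =>
          (u * a * v) ⊗ₜ[k] (m' ⊗ₜ[k] (b • n')) :=
        sw_one_sourceMapOp fun a b => sw (M.coact m) fun u m' => sw (N.coact n) fun v n' =>
          (u * a * v) ⊗ₜ[k] (m' ⊗ₜ[k] (b • n'))
    _ = _ := by
        rw [sw_comm (Δ (1 : H))]
        refine sw_congr _ fun u m' => ?_
        simp only [mul_assoc]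
        exact sw_coact_one N n fun v n' => (u * v) ⊗ₜ[k] (m' ⊗ₜ[k] n')

/-- H need not be flat over k; injectivity survives because the inclusion is split by the
projection. -/
theorem lTensor_incl_injective :
    Function.Injective ((incl M N).lTensor H) := by
  have h : pr M N ∘ₗ incl M N = LinearMap.id := LinearMap.ext projT_coe
  refine Function.LeftInverse.injective (g := (pr M N).lTensor H) fun x => ?_
  rw [← LinearMap.comp_apply, ← LinearMap.lTensor_comp, h, LinearMap.lTensor_id,
    LinearMap.id_apply]

end InclCoact

/-! ### Evaluation, coevaluation and the triangle identities. -/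

section Duality

variable {k H P : Type u} [CommRing k] [Ring H] [WeakHopfAlgebra k H] [AddCommGroup P] [Module k P]

local notation "Δ" => Coalgebra.comul (R := k)
local notation "ε" => Coalgebra.counit (R := k)
local notation "εt" => targetMap k H
local notation "εs" => sourceMap k H
local notation "εs'" => sourceMapOp k H
local notation "εt'" => targetMapOp k
local notation "S" => antipode (k := k) (H := H)

variable {M : YDModule k H} (b : DualBasis k M) {T : H →ₗ[k] H} 
  (hST : ∀ x : H, antipode (k := k) (T x) = x) (hTS : ∀ x : H, T (antipode (k := k) x) = x)

/-- The linear form given by an element of the dual. -/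
noncomputable def dualEquiv : dual b hST hTS ≃ₗ[k] Module.Dual k M := LinearEquiv.refl k _

variable {b hST hTS}

theorem dualEquiv_smul (h : H) (f : dual b hST hTS) (m : M) :
    dualEquiv b hST hTS (h • f) m = dualEquiv b hST hTS f (S h • m) := rfl

theorem sw_dual_coact (f : dual b hST hTS) (m : M) (F : H → P)
    (hF : IsLinearMap k F := by fun_prop) :
    (sw ((dual b hST hTS).coact f) fun u g => dualEquiv b hST hTS g m • F u) =
      sw (M.coact m) fun u x => dualEquiv b hST hTS f x • F (T u) :=
  sw_dualCoact b T f m F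

theorem dual_tensor_ext {s t : M ⊗[k] dual b hST hTS}
    (h : ∀ m, (sw s fun x g => dualEquiv b hST hTS g m • x) =
      sw t fun x g => dualEquiv b hST hTS g m • x) : s = t :=
  b.tensor_ext h

theorem dual_tensor_ext' {s t : H ⊗[k] (M ⊗[k] dual b hST hTS)}
    (h : ∀ m, (sw s fun u y => sw y fun x g => dualEquiv b hST hTS g m • (u ⊗ₜ[k] x)) =
      sw t fun u y => sw y fun x g => dualEquiv b hST hTS g m • (u ⊗ₜ[k] x)) : s = t :=
  b.tensor_ext' h

/-- With M ⊗ M* read as endomorphisms of M, the diagonal action is the adjoint one, h₁ t S(h₂). -/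
theorem sw_diagAct_dual (h : H) (t : M ⊗[k] dual b hST hTS) (m : M) :
    (sw (diagAct k M (dual b hST hTS) h t) fun x g => dualEquiv b hST hTS g m • x) =
      sw (Δ h) fun p q => p • sw t fun x g => dualEquiv b hST hTS g (S q • m) • x := by
  rw [diagAct_eq_sw, sw_sw _ _ fun x g => dualEquiv b hST hTS g m • x]
  refine sw_congr _ fun p q => ?_
  rw [sw_sw _ _ fun x g => dualEquiv b hST hTS g m • x, act_sw]
  have := IsScalarTower.to_smulCommClass (R := k) (A := H) (M := M)
  simp (disch := ((repeat intro _); fun_prop)) only [sw_tmul, dualEquiv_smul, smul_comm p (_ : k)]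

theorem sum_dualEquiv_symm_coord (F : M → P) (m : M) (hF : IsLinearMap k F := by fun_prop) :
    ∑ i, dualEquiv b hST hTS ((dualEquiv b hST hTS).symm (b.coord i)) m • F (b.vec i) = F m :=
  b.sum_apply F m

/-- The evaluation pairing `f ⊗ m ↦ ⟨f, 1₍₁₎ m⟩ 1₍₂₎`. -/
noncomputable def evLin : (dual b hST hTS : Type u) ⊗[k] M →ₗ[k] unit k H :=
  liftBilin (fun (f : dual b hST hTS) (m : M) => sw (Δ (1 : H)) fun p q =>
    dualEquiv b hST hTS f (p • m) • toUnit k H q) (by intros; fun_prop) (by intros; fun_prop)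

theorem evLin_tmul (f : dual b hST hTS) (m : M) :
    evLin (f ⊗ₜ m) = sw (Δ (1 : H)) fun p q => dualEquiv b hST hTS f (p • m) • toUnit k H q :=
  liftBilin_tmul _ _ _ _ _

/-- The pairing involves S(h₁)1₁h₂ ⊗ 1₂ = S(h₁)h₂ ⊗ ε_t(h₃), and ε_s(h₁) ⊗ h₂ = 1₁ ⊗ h1₂ brings h to
the value. -/
theorem sw_evLin (h : H) (f : dual b hST hTS) (m : M) :
    (sw (Δ h) fun p q => evLin ((p • f) ⊗ₜ (q • m))) = h • evLin (f ⊗ₜ m) := by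
  simp only [evLin_tmul, dualEquiv_smul, smul_smul, act_sw]
  have := IsScalarTower.to_smulCommClass (R := k) (A := H) (M := unit k H)
  calc _ = sw (Δ h) fun p q => sw (Δ q) fun c d =>
          dualEquiv b hST hTS f ((S p * c) • m) • toUnit k H d := by
        refine sw_congr _ fun p q => ?_
        rw [← sw_targetMap_right q fun c d =>
          dualEquiv b hST hTS f ((S p * c) • m) • toUnit k H d]
        simp only [toUnit_targetMap]
    _ = sw (Δ h) fun x d => sw (Δ x) fun p c =>
          dualEquiv b hST hTS f ((S p * c) • m) • toUnit k H d :=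
        (sw_coassoc h fun p c d => dualEquiv b hST hTS f ((S p * c) • m) • toUnit k H d).symm
    _ = sw (Δ h) fun x d => dualEquiv b hST hTS f (εs x • m) • toUnit k H d :=
        sw_congr _ fun x d => sw_antipode_mul x fun y =>
          dualEquiv b hST hTS f (y • m) • toUnit k H d
    _ = sw (Δ 1) fun p q => dualEquiv b hST hTS f (p • m) • toUnit k H (h * q) :=
        sw_sourceMap_left h fun p q => dualEquiv b hST hTS f (p • m) • toUnit k H q
    _ = _ := by simp only [smul_comm h (_ : k), smul_toUnit]

theorem unit_coact_evLin (f : dual b hST hTS) (m : M) :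
    (unit k H).coact (evLin (f ⊗ₜ m)) =
      sw ((dual b hST hTS).coact f) fun u g => sw (M.coact m) fun v x =>
        (u * v) ⊗ₜ evLin (g ⊗ₜ x) := by
  simp only [evLin_tmul, linearMap_sw, map_smul, unit_coact, unitVal_toUnit, tmul_sw]
  symm
  calc _ = sw (Δ (1 : H)) fun p q => sw (M.coact m) fun v x => sw ((dual b hST hTS).coact f)
          fun u g => dualEquiv b hST hTS g (p • x) • ((u * v) ⊗ₜ[k] toUnit k H q) := by
        rw [sw_comm ((dual b hST hTS).coact f), sw_comm (Δ (1 : H))]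
        refine sw_congr _ fun v x => ?_
        rw [sw_comm (Δ (1 : H))]
        simp only [TensorProduct.tmul_smul]
    _ = sw (Δ (1 : H)) fun p q => sw (M.coact m) fun v x => sw (M.coact (p • x))
          fun u y => dualEquiv b hST hTS f y • ((T u * v) ⊗ₜ[k] toUnit k H q) :=
        sw_congr _ fun p q => sw_congr _ fun v x => sw_dual_coact f (p • x) fun u =>
          (u * v) ⊗ₜ[k] toUnit k H q
    _ = sw (Δ (1 : H)) fun p q => sw (M.coact m) fun v x => sw (M.coact (εs' p • x))
          fun u y => dualEquiv b hST hTS f y • ((T u * v) ⊗ₜ[k] toUnit k H q) :=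
        (sw_one_sourceMapOp fun p q => sw (M.coact m) fun v x => sw (M.coact (p • x))
          fun u y => dualEquiv b hST hTS f y • ((T u * v) ⊗ₜ[k] toUnit k H q)).symm
    _ = sw (Δ (1 : H)) fun p q => sw (M.coact m) fun v x => sw (M.coact x)
          -- For a left leg y, λ(yx) carries S(y) on the right of x₋₁, and T turns it into y on the
          -- left.
          fun u y => dualEquiv b hST hTS f y • ((εs' p * (T u * v)) ⊗ₜ[k] toUnit k H q) := by
        refine sw_congr _ fun p q => sw_congr _ fun v x => ?_
        rw [sw_coact_leftLeg_smul M (isLeftLeg_sourceMapOp p) x fun u y =>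
          dualEquiv b hST hTS f y • ((T u * v) ⊗ₜ[k] toUnit k H q)]
        simp only [inverse_mul hST hTS, hTS, mul_assoc]
    _ = sw (Δ (1 : H)) fun p q => sw (M.coact m) fun v x => sw (M.coact x)
          fun u y => dualEquiv b hST hTS f y • ((p * (T u * v)) ⊗ₜ[k] toUnit k H q) :=
        sw_one_sourceMapOp fun p q => sw (M.coact m) fun v x => sw (M.coact x)
          fun u y => dualEquiv b hST hTS f y • ((p * (T u * v)) ⊗ₜ[k] toUnit k H q)
    _ = sw (Δ (1 : H)) fun p q => sw (M.coact m) fun w y => sw (Δ w) fun v u =>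
          dualEquiv b hST hTS f y • ((p * (T u * v)) ⊗ₜ[k] toUnit k H q) :=
        sw_congr _ fun p q => (sw_coact_coassoc M m fun v u y =>
          dualEquiv b hST hTS f y • ((p * (T u * v)) ⊗ₜ[k] toUnit k H q)).symm
    _ = sw (Δ (1 : H)) fun p q => sw (M.coact m) fun w y =>
          dualEquiv b hST hTS f y • ((p * εt' w) ⊗ₜ[k] toUnit k H q) :=
        sw_congr _ fun p q => sw_congr _ fun w y => sw_inverse_mul hST hTS w fun x =>
          dualEquiv b hST hTS f y • ((p * x) ⊗ₜ[k] toUnit k H q)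
    -- Expanding ε̄_t(m₋₁) = ε(m₋₁1₁)1₂, the scalar turns m₀ into 1₁m. The two copies of Δ(1) then
    -- combine to Δ²(1).
    _ = sw (Δ (1 : H)) fun c d => sw (Δ (1 : H)) fun p q =>
          dualEquiv b hST hTS f (c • m) • ((p * d) ⊗ₜ[k] toUnit k H q) := by
        rw [sw_comm (Δ (1 : H)) (Δ (1 : H))]
        refine sw_congr _ fun p q => ?_
        rw [← sw_one_sourceMapOp fun c d =>
          dualEquiv b hST hTS f (c • m) • ((p * d) ⊗ₜ[k] toUnit k H q)]
        have key : ∀ c d : H, dualEquiv b hST hTS f (εs' c • m) • ((p * d) ⊗ₜ[k] toUnit k H q) =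
            sw (M.coact m) fun w y =>
              ε (w * c) • dualEquiv b hST hTS f y • ((p * d) ⊗ₜ[k] toUnit k H q) := fun c d =>
          (sw_counit_coact_mul M c m fun y =>
            dualEquiv b hST hTS f y • ((p * d) ⊗ₜ[k] toUnit k H q)).symm
        simp only [key]
        rw [sw_comm (Δ (1 : H))]
        refine sw_congr _ fun w y => ?_
        simp only [targetMapOp, mul_sw, sw_tmul_const, smul_sw, mul_smul_comm,
          ← TensorProduct.smul_tmul', smul_comm (ε _)]
    _ = sw (Δ (1 : H)) fun p q => sw (Δ q) fun c d =>
          dualEquiv b hST hTS f (p • m) • (c ⊗ₜ[k] toUnit k H d) :=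
        (sw_comul_one_right fun p c d =>
          dualEquiv b hST hTS f (p • m) • (c ⊗ₜ[k] toUnit k H d)).symm
    _ = sw (Δ (1 : H)) fun p q => sw (Δ (εt q)) fun c d =>
          dualEquiv b hST hTS f (p • m) • (c ⊗ₜ[k] toUnit k H d) :=
        (sw_one_targetMap fun p q => sw (Δ q) fun c d =>
          dualEquiv b hST hTS f (p • m) • (c ⊗ₜ[k] toUnit k H d)).symm
    _ = _ := by simp only [smul_sw]

variable (b hST hTS) in
/-- The evaluation. -/
noncomputable def ev : tensor (dual b hST hTS) M ⟶ unit k H :=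
  homLift evLin sw_evLin unit_coact_evLin

theorem ev_pr (f : dual b hST hTS) (m : M) :
    Hom.toLin (ev b hST hTS) (pr _ M (f ⊗ₜ m)) =
      sw (Δ (1 : H)) fun p q => dualEquiv b hST hTS f (p • m) • toUnit k H q := by
  rw [ev, homLift_pr, evLin_tmul]

variable (b hST hTS) in
/-- The underlying map of the coevaluation. -/
noncomputable def coevLin : unit k H →ₗ[k] tensor M (dual b hST hTS) :=
  IsLinearMap.mk' (fun z => ∑ i, pr M (dual b hST hTS)
    ((unitVal z • b.vec i) ⊗ₜ (dualEquiv b hST hTS).symm (b.coord i))) (by fun_prop)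

theorem coevLin_apply (z : unit k H) : coevLin b hST hTS z = ∑ i, pr M (dual b hST hTS)
    ((unitVal z • b.vec i) ⊗ₜ (dualEquiv b hST hTS).symm (b.coord i)) := rfl

/-- As an endomorphism of M, coev(z) is multiplication by z, since 1₁zS(1₂) = ε_t(z) = z. -/
theorem sw_incl_coevLin (z : unit k H) (m : M) :
    (sw (incl M _ (coevLin b hST hTS z)) fun x g => dualEquiv b hST hTS g m • x) =
      unitVal z • m := by
  rw [coevLin_apply, map_sum, sw_sum _ _ fun x g => dualEquiv b hST hTS g m • x]
  simp only [incl_pr, sw_diagAct_dual]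
  simp (disch := ((repeat intro _); fun_prop)) only [sw_tmul]
  have key := sw_mul_mul_antipode (isRightLeg_unitVal z) 1 fun x => x • m
  rw [one_mul, (isRightLeg_unitVal z).targetMap_eq_self] at key
  rw [← key]
  rw [sum_sw]
  refine sw_congr _ fun p q => ?_
  rw [← Finset.smul_sum, sum_dualEquiv_symm_coord (fun x => unitVal z • x) (S q • m),
    mul_smul, mul_smul]

theorem tensor_dual_ext {s t : tensor M (dual b hST hTS)}
    (h : ∀ m, (sw (incl M _ s) fun x g => dualEquiv b hST hTS g m • x) =
      sw (incl M _ t) fun x g => dualEquiv b hST hTS g m • x) : s = t :=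
  Subtype.ext (dual_tensor_ext h)

/-- For the adjoint action this is h₁zS(h₂) = ε_t(hz). -/
theorem coevLin_smul (h : H) (z : unit k H) :
    coevLin b hST hTS (h • z) = h • coevLin b hST hTS z := by
  refine tensor_dual_ext fun m => ?_
  rw [incl_smul, sw_diagAct_dual]
  simp only [sw_incl_coevLin, unit_smul, unitVal_toUnit, smul_smul, ← mul_assoc]
  exact (sw_mul_mul_antipode (isRightLeg_unitVal z) h fun x => x • m).symm

theorem coact_coevLin (z : unit k H) :
    (tensor M (dual b hST hTS)).coact (coevLin b hST hTS z) =
      (coevLin b hST hTS).lTensor H ((unit k H).coact z) := by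
  refine lTensor_incl_injective _ _ (dual_tensor_ext' fun m => ?_)
  -- The common value on m. On the left, m₋₁₂T(m₋₁₁) = ε̄_s(m₋₁) and ε̄_s(m₋₁) ⊗ m₀ = 1₁ ⊗ 1₂m. On
  -- the right, Δ(z) = z1₁ ⊗ 1₂ and coev acts by multiplication.
  trans sw (Δ (1 : H)) fun p q => (unitVal z * p) ⊗ₜ[k] (q • m)
  · rw [coevLin_apply]
    simp only [map_sum, lTensor_incl_coact_pr, tensorCoact_tmul]
    rw [sw_sum _ _ fun u y => sw y fun x g => dualEquiv b hST hTS g m • (u ⊗ₜ[k] x)]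
    simp (disch := ((repeat intro _); fun_prop)) only [sw_sw, sw_tmul]
    calc _ = ∑ i, sw (M.coact (unitVal z • b.vec i)) fun u x => sw (M.coact m) fun v y =>
            dualEquiv b hST hTS ((dualEquiv b hST hTS).symm (b.coord i)) y •
              ((u * T v) ⊗ₜ[k] x) :=
          Finset.sum_congr rfl fun i _ => sw_congr _ fun u x => sw_dual_coact _ m fun v =>
            (u * v) ⊗ₜ[k] x
      _ = sw (M.coact m) fun v y => ∑ i,
            dualEquiv b hST hTS ((dualEquiv b hST hTS).symm (b.coord i)) y •
              sw (M.coact (unitVal z • b.vec i)) fun u x => (u * T v) ⊗ₜ[k] x := by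
          simp only [smul_sw]
          simp only [sw_comm (M.coact (unitVal z • _)) (M.coact m)]
          exact Finset.sum_comm
      _ = sw (M.coact m) fun v y => sw (M.coact (unitVal z • y)) fun u x => (u * T v) ⊗ₜ[k] x :=
          sw_congr _ fun v y => sum_dualEquiv_symm_coord (fun y =>
            sw (M.coact (unitVal z • y)) fun u x => (u * T v) ⊗ₜ[k] x) y
      _ = sw (M.coact m) fun v y => sw (M.coact y) fun u x =>
            (unitVal z * (u * T v)) ⊗ₜ[k] x := by
          refine sw_congr _ fun v y => ?_
          rw [sw_coact_rightLeg_smul M (isRightLeg_unitVal z) y fun u x => (u * T v) ⊗ₜ[k] x]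
          simp only [mul_assoc]
      _ = sw (M.coact m) fun w x => sw (Δ w) fun v u => (unitVal z * (u * T v)) ⊗ₜ[k] x :=
          (sw_coact_coassoc M m fun v u x => (unitVal z * (u * T v)) ⊗ₜ[k] x).symm
      _ = sw (M.coact m) fun w x => (unitVal z * εs' w) ⊗ₜ[k] x :=
          sw_congr _ fun w x => sw_mul_inverse hST hTS w fun y => (unitVal z * y) ⊗ₜ[k] x
      _ = sw (Δ (1 : H)) fun p q => sw (M.coact m) fun w x =>
            ε (q * w) • ((unitVal z * p) ⊗ₜ[k] x) := by
          rw [sw_comm (Δ (1 : H))]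
          simp only [sourceMapOp_eq, mul_sw, sw_tmul_const, mul_smul_comm,
            TensorProduct.smul_tmul']
      _ = sw (Δ (1 : H)) fun p q => sw (M.coact m) fun w x =>
            ε (εt q * w) • ((unitVal z * p) ⊗ₜ[k] x) :=
          (sw_one_targetMap fun p q => sw (M.coact m) fun w x =>
            ε (q * w) • ((unitVal z * p) ⊗ₜ[k] x)).symm
      _ = sw (Δ (1 : H)) fun p q => (unitVal z * p) ⊗ₜ[k] (εt q • m) :=
          sw_congr _ fun p q => sw_counit_mul_coact M (isRightLeg_targetMap q) m fun x =>
            (unitVal z * p) ⊗ₜ[k] x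
      _ = _ := sw_one_targetMap fun p q => (unitVal z * p) ⊗ₜ[k] (q • m)
  · rw [unit_coact]
    simp only [linearMap_sw, LinearMap.lTensor_tmul]
    simp (disch := ((repeat intro _); fun_prop)) only [sw_sw, sw_tmul]
    rw [← (isRightLeg_unitVal z).sw_comul' fun p q => p ⊗ₜ[k] (q • m),
      ← (isRightLeg_unitVal z).sw_comul_targetMap fun p q => p ⊗ₜ[k] (q • m)]
    refine sw_congr _ fun p q => ?_
    rw [← unitVal_toUnit, ← sw_incl_coevLin (b := b) (hST := hST) (hTS := hTS), tmul_sw]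
    simp only [TensorProduct.tmul_smul]

variable (b hST hTS) in
/-- The coevaluation. -/
noncomputable def coev : unit k H ⟶ tensor M (dual b hST hTS) :=
  Hom.mk (coevLin b hST hTS) coevLin_smul coact_coevLin

theorem coev_apply (z : unit k H) : Hom.toLin (coev b hST hTS) z = ∑ i,
    pr M (dual b hST hTS) ((unitVal z • b.vec i) ⊗ₜ (dualEquiv b hST hTS).symm (b.coord i)) := rfl

/-- The composite is ε̄_s(1₂)z1₁m; the two bases commute, and ε̄_s(1₂)1₁ = 1. -/
theorem coev_ev (z : unit k H) (m : M) :
    Hom.toLin (tensorHom (coev b hST hTS) (𝟙 M) ≫ assocHom M _ M ≫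
      tensorHom (𝟙 M) (ev b hST hTS) ≫ rightUnitorHom M) (pr _ M (z ⊗ₜ m)) = unitVal z • m := by
  simp only [comp_toLin, tensorHom_pr, coev_apply, TensorProduct.sum_tmul, map_sum, assocHom_pr,
    id_toLin, ev_pr, rightUnitorHom_pr, linearMap_sw, map_smul, unitVal_toUnit,
    isLinearMap_sourceMapOp.map_sw, isLinearMap_sourceMapOp.map_smul, sourceMapOp_targetMap,
    sw_act_const, smul_assoc, sum_sw]
  calc _ = sw (Δ (1 : H)) fun p q => εs' q • unitVal z • p • m :=
        sw_congr _ fun p q => sum_dualEquiv_symm_coord (fun x => εs' q • unitVal z • x) (p • m)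
    _ = sw (Δ (1 : H)) fun p q => unitVal z • (εs' q * p) • m := by
        refine sw_congr _ fun p q => ?_
        rw [smul_smul, ← (isRightLeg_unitVal z).mul_comm (isLeftLeg_sourceMapOp q), mul_smul,
          mul_smul]
    _ = unitVal z • (1 : H) • m := sw_sourceMapOp_mul_one (1 : H) fun x => unitVal z • x • m
    _ = _ := by rw [one_smul]

/-- On m the composite is ⟨f, 1₁zS(1₂)m⟩ = ⟨f, zm⟩, and S(ε̄_s(z)) = z makes this the value of
ε̄_s(z)f. -/
theorem ev_coev (f : dual b hST hTS) (z : unit k H) :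
    Hom.toLin (leftUnitorHom _) (Hom.toLin (tensorHom (ev b hST hTS) (𝟙 (dual b hST hTS)))
      (assocInv _ M _ (Hom.toLin (tensorHom (𝟙 (dual b hST hTS)) (coev b hST hTS))
        (pr _ _ (f ⊗ₜ z))))) = εs' (unitVal z) • f := by
  simp only [tensorHom_pr, coev_apply, TensorProduct.tmul_sum, map_sum, assocInv_pr,
    id_toLin, ev_pr, leftUnitorHom_pr, linearMap_sw, map_smul, unitVal_toUnit,
    sw_act_const, smul_assoc, sum_sw]
  refine (dualEquiv b hST hTS).injective (LinearMap.ext fun m => ?_)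
  rw [dualEquiv_smul, antipode_sourceMapOp, (isRightLeg_unitVal z).targetMap_eq_self,
    linearEquiv_sw, map_sw (fun g : Module.Dual k M => g m)]
  calc _ = sw (Δ (1 : H)) fun p q =>
          dualEquiv b hST hTS f (p • unitVal z • S (εt q) • m) := by
        refine sw_congr _ fun p q => ?_
        rw [← sum_dualEquiv_symm_coord (b := b) (hST := hST) (hTS := hTS)
          (fun x => dualEquiv b hST hTS f (p • unitVal z • x)) (S (εt q) • m)]
        simp only [map_sum, map_smul, LinearMap.sum_apply, LinearMap.smul_apply, dualEquiv_smul,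
          smul_eq_mul, _root_.mul_comm]
    _ = sw (Δ (1 : H)) fun p q => dualEquiv b hST hTS f (p • unitVal z • S q • m) :=
        sw_one_targetMap fun p q => dualEquiv b hST hTS f (p • unitVal z • S q • m)
    _ = _ := by
        have key := sw_mul_mul_antipode (isRightLeg_unitVal z) 1 fun x =>
          dualEquiv b hST hTS f (x • m)
        rw [one_mul, (isRightLeg_unitVal z).targetMap_eq_self] at key
        simpa only [mul_smul] using key

variable (b hST hTS) in
/-- The duality between a Yetter-Drinfeld module and its dual. -/
@[reducible]
noncomputable def exactPairing : ExactPairing M (dual b hST hTS) where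
  coevaluation' := coev b hST hTS
  evaluation' := ev b hST hTS
  coevaluation_evaluation' := by
    -- With the inverse unit constraint moved to the other side, both maps start at M* ⊗_t H_t and
    -- end at M*; they are compared on generators.
    rw [← Category.assoc, Iso.eq_comp_inv]
    exact hom_ext (tensor_ext _ _ (fun x => Hom.toLin (leftUnitorHom _)
      (Hom.toLin (tensorHom (ev b hST hTS) (𝟙 (dual b hST hTS)))
        (assocInv _ M _ (Hom.toLin (tensorHom (𝟙 (dual b hST hTS)) (coev b hST hTS)) x))))
      (fun x => Hom.toLin (rightUnitorHom _) x)
      (fun f z => by rw [ev_coev, rightUnitorHom_pr]) (by fun_prop) (by fun_prop))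
  evaluation_coevaluation' := by
    rw [← Category.assoc, Iso.eq_comp_inv]
    exact hom_ext (tensor_ext _ _ (fun x => Hom.toLin (tensorHom (coev b hST hTS) (𝟙 M) ≫
      assocHom M _ M ≫ tensorHom (𝟙 M) (ev b hST hTS) ≫ rightUnitorHom M) x)
      (fun x => Hom.toLin (leftUnitorHom _) x)
      (fun z m => by rw [coev_ev, leftUnitorHom_pr]) (by fun_prop) (by fun_prop))

end Duality

end YDModule

/-! ### Explicit formulas for the constraints and the duality. -/

namespace YDModule

open WeakBialgebra WeakHopfAlgebra

section Constraints

variable {k H : Type u} [CommRing k] [Ring H] [WeakBialgebra k H] (M N Q : YDModule k H)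

local notation "Δ" => Coalgebra.comul (R := k)

theorem incl_smul_pr_tmul (h : H) (m : M) (n : N) :
    incl M N (h • pr M N (m ⊗ₜ n)) = sw (Δ h) fun a b => (a • m) ⊗ₜ (b • n) := by
  rw [incl_smul, incl_pr, diagAct_diagAct_one, diagAct_tmul]

/-- The associativity constraint is the restriction of the one of `k`-modules. -/
theorem incl_assocHom (x : tensor (tensor M N) Q) :
    TensorProduct.assoc k M N Q ((incl M N).rTensor Q (incl (tensor M N) Q x)) =
      (incl N Q).lTensor M (incl M (tensor N Q) (Hom.toLin (assocHom M N Q) x)) := by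
  refine tensor_ext_left
    (fun x => TensorProduct.assoc k M N Q ((incl M N).rTensor Q (incl (tensor M N) Q x)))
    (fun x => (incl N Q).lTensor M (incl M (tensor N Q) (Hom.toLin (assocHom M N Q) x)))
    (fun m n q => ?_) (by fun_prop) (by fun_prop) x
  simp only [assocHom_pr, incl_pr_tmul _ Q, incl_pr_tmul M, linearMap_sw, linearEquiv_sw,
    LinearMap.rTensor_tmul, LinearMap.lTensor_tmul, incl_smul_pr_tmul, sw_tmul_const, tmul_sw,
    TensorProduct.assoc_tmul]
  exact sw_coassoc (1 : H) fun a b c => (a • m) ⊗ₜ[k] ((b • n) ⊗ₜ[k] (c • q))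

theorem lTensor_unitVal_coact (z : unit k H) :
    unitVal.lTensor H ((unit k H).coact z) = Δ (unitVal z) := by
  rw [unit_coact, linearMap_sw]
  simp only [LinearMap.lTensor_tmul, unitVal_toUnit]
  rw [(isRightLeg_unitVal z).sw_comul_targetMap fun a b => a ⊗ₜ[k] b, sw_tmul_self]

end Constraints

section Duality

variable {k H : Type u} [CommRing k] [Ring H] [WeakHopfAlgebra k H]

local notation "Δ" => Coalgebra.comul (R := k)
local notation "S" => antipode (k := k) (H := H)

variable {M : YDModule k H} {b : DualBasis k M} {T : H →ₗ[k] H}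
  {hST : ∀ x : H, antipode (k := k) (T x) = x} {hTS : ∀ x : H, T (antipode (k := k) x) = x}

theorem rid_map_antipode_coact (f : dual b hST hTS) (m : M) :
    TensorProduct.rid k H (TensorProduct.map S ((dualEquiv b hST hTS).toLinearMap.flip m)
        ((dual b hST hTS).coact f)) =
      TensorProduct.rid k H ((dualEquiv b hST hTS f).lTensor H (M.coact m)) := by
  rw [rid_eq_sw, rid_eq_sw]
  simp (disch := ((repeat intro _); fun_prop)) only [sw_map, sw_lTensor]
  simp only [LinearMap.flip_apply, LinearEquiv.coe_coe]
  rw [sw_dual_coact f m fun u => S u]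
  simp only [hST]

theorem unitVal_ev_pr (f : dual b hST hTS) (m : M) :
    unitVal (Hom.toLin (ev b hST hTS) (pr _ M (f ⊗ₜ m))) =
      TensorProduct.lid k H ((dualEquiv b hST hTS f ∘ₗ
        (LinearMap.toSpanSingleton H M m).restrictScalars k).rTensor H (Δ 1)) := by
  rw [ev_pr, lid_eq_sw]
  simp (disch := ((repeat intro _); fun_prop)) only [sw_rTensor]
  simp only [linearMap_sw, map_smul, unitVal_toUnit, LinearMap.comp_apply,
    LinearMap.restrictScalars_apply, LinearMap.toSpanSingleton_apply]
  exact sw_one_targetMap fun p q => dualEquiv b hST hTS f (p • m) • q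

/-- The coevaluation in terms of an arbitrary dual basis. -/
theorem incl_coev (b' : DualBasis k M) (z : unit k H) :
    incl M _ (Hom.toLin (coev b hST hTS) z) =
      diagAct k M (dual b hST hTS) (unitVal z)
        (∑ i, b'.vec i ⊗ₜ (dualEquiv b hST hTS).symm (b'.coord i)) := by
  refine dual_tensor_ext fun m => (sw_incl_coevLin z m).trans ?_
  -- For every dual basis ∑ nᵢ ⊗ nᵢ* is the identity endomorphism, on which z acts as z₁S(z₂) =
  -- ε_t(z) = z.
  have key : ∀ m, (sw (∑ i, b'.vec i ⊗ₜ[k] (dualEquiv b hST hTS).symm (b'.coord i))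
      fun x g => dualEquiv b hST hTS g m • x) = m := by
    intro m
    rw [sw_sum _ _ fun x g => dualEquiv b hST hTS g m • x]
    simp (disch := ((repeat intro _); fun_prop)) only [sw_tmul]
    simp only [LinearEquiv.apply_symm_apply, b'.sum_coord_smul_vec]
  simp only [sw_diagAct_dual, key, smul_smul]
  rw [sw_mul_antipode (unitVal z) fun x => x • m, (isRightLeg_unitVal z).targetMap_eq_self]

end Duality

end YDModule

/-! ### The finitely generated projective objects and their duals. -/

namespace FGPYDModule

open WeakBialgebra WeakHopfAlgebra

section Monoidal

variable (k H : Type u) [CommRing k] [Ring H]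

/-- The monoidal category of finitely generated projective Yetter-Drinfeld modules. -/
@[reducible]
noncomputable def monoidalCategory [WeakBialgebra k H] : MonoidalCategory (FGPYDModule k H) :=
  have := YDModule.isMonoidal_finite_projective (k := k) (H := H)
  ObjectProperty.fullMonoidalSubcategory _

attribute [local instance] monoidalCategory

/-- The monoidal structure of the finitely generated projective Yetter-Drinfeld modules is the
standard one. -/
noncomputable def standardMonoidal [WeakBialgebra k H] : StandardMonoidal k H where
  tensorEquiv M N := LinearEquiv.refl k (tensorT k H M N)
  unitEquiv := LinearEquiv.refl k (targetSpace k H)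
  tensor_smul _ _ _ _ := rfl
  tensor_coact M N m n := YDModule.lTensor_incl_coact_pr M.obj N.obj m n
  tensor_hom f g x := YDModule.incl_tensorHom f.hom g.hom x
  unit_smul _ _ := rfl
  unit_coact z := YDModule.lTensor_unitVal_coact z
  associator M N P x := YDModule.incl_assocHom M.obj N.obj P.obj x
  leftUnitor M z m := YDModule.leftUnitorHom_pr M.obj z m
  rightUnitor M m z := YDModule.rightUnitorHom_pr M.obj m z

variable {k H} [WeakHopfAlgebra k H]

/-- A dual basis of a finitely generated projective Yetter-Drinfeld module. -/
noncomputable def dualBasis (M : FGPYDModule k H) : DualBasis k M :=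
  haveI := M.property.1
  haveI := M.property.2
  DualBasis.nonempty_of_finite_of_projective.some

variable {T : H →ₗ[k] H} (hST : ∀ x : H, antipode (k := k) (T x) = x)
  (hTS : ∀ x : H, T (antipode (k := k) x) = x)

/-- The dual of a finitely generated projective Yetter-Drinfeld module. -/
noncomputable def dual (M : FGPYDModule k H) : FGPYDModule k H where
  obj := YDModule.dual M.dualBasis hST hTS
  property := by
    have := M.property.1
    have := M.property.2
    exact ⟨inferInstanceAs (Module.Finite k (Module.Dual k M)),
      inferInstanceAs (Module.Projective k (Module.Dual k M))⟩

/-- The duality between a finitely generated projective Yetter-Drinfeld module and its dual. -/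
@[reducible]
noncomputable def exactPairing (M : FGPYDModule k H) : ExactPairing M (dual hST hTS M) where
  coevaluation' := ObjectProperty.homMk (YDModule.coev M.dualBasis hST hTS)
  evaluation' := ObjectProperty.homMk (YDModule.ev M.dualBasis hST hTS)
  coevaluation_evaluation' := ObjectProperty.hom_ext _
    (YDModule.exactPairing M.dualBasis hST hTS).coevaluation_evaluation'
  evaluation_coevaluation' := ObjectProperty.hom_ext _
    (YDModule.exactPairing M.dualBasis hST hTS).evaluation_coevaluation'

/-- Every finitely generated projective Yetter-Drinfeld module has a dual. -/
@[reducible]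
noncomputable def rightRigidCategory : RightRigidCategory (FGPYDModule k H) where
  rightDual M :=
    { rightDual := dual hST hTS M
      exact := exactPairing hST hTS M }

end Monoidal

end FGPYDModule

theorem proposition5p3 (k H : Type u) [CommRing k] [Ring H] [WeakHopfAlgebra k H]
    (hS : Function.Bijective (WeakHopfAlgebra.antipode (k := k) (H := H))) :
    ∃ (_ : MonoidalCategory (FGPYDModule k H)) (T : FGPYDModule.StandardMonoidal k H)
      (_ : RightRigidCategory (FGPYDModule k H)),
      ∀ M : FGPYDModule k H,
        ∃ d : ((Mᘁ : FGPYDModule k H) : Type u) ≃ₗ[k] Module.Dual k M,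
          -- the action on the dual: `⟨h · f, m⟩ = ⟨f, S(h) m⟩`
          (∀ (h : H) (f : (Mᘁ : FGPYDModule k H)) (m : M),
            d (h • f) m = d f (WeakHopfAlgebra.antipode (k := k) h • m)) ∧
          -- the coaction on the dual: `⟨f₍₀₎, m⟩ S(f₍₋₁₎) = ⟨f, m₍₀₎⟩ m₍₋₁₎`
          (∀ (f : (Mᘁ : FGPYDModule k H)) (m : M),
            TensorProduct.rid k H (TensorProduct.map (WeakHopfAlgebra.antipode (k := k) (H := H))
                (d.toLinearMap.flip m) ((Mᘁ : FGPYDModule k H).obj.coact f)) =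
              TensorProduct.rid k H ((d f).lTensor H (M.obj.coact m))) ∧
          -- the evaluation: `ev (1₍₁₎ · f ⊗ 1₍₂₎ m) = ⟨f, 1₍₁₎ m⟩ 1₍₂₎`
          (∀ (f : (Mᘁ : FGPYDModule k H)) (m : M),
            (T.unitEquiv (FGPYDModule.lin (ε_ M Mᘁ) ((T.tensorEquiv Mᘁ M).symm
                (WeakBialgebra.projT k H (Mᘁ : FGPYDModule k H) M (f ⊗ₜ[k] m)))) : H) =
              TensorProduct.lid k H
                ((d f ∘ₗ (LinearMap.toSpanSingleton H M m).restrictScalars k).rTensor H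
                  (Coalgebra.comul (R := k) (1 : H)))) ∧
          -- the coevaluation: `coev z = z · ∑ᵢ nᵢ ⊗ nᵢ*` for every finite dual basis of `M`
          (∀ (r : ℕ) (n : Fin r → M) (n' : Fin r → Module.Dual k M),
            (∀ m : M, ∑ i, n' i m • n i = m) →
            ∀ z : (𝟙_ (FGPYDModule k H) : FGPYDModule k H),
              (T.tensorEquiv M Mᘁ (FGPYDModule.lin (η_ M Mᘁ) z) :
                  (M : Type u) ⊗[k] ((Mᘁ : FGPYDModule k H) : Type u)) =
                WeakBialgebra.diagAct k M (Mᘁ : FGPYDModule k H) (T.unitEquiv z : H)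
                  (∑ i, n i ⊗ₜ[k] d.symm (n' i))) := by
  -- The parameter T of the preceding constructions becomes S⁻¹.
  let e := LinearEquiv.ofBijective (WeakHopfAlgebra.antipode (k := k) (H := H)) hS
  have hST : ∀ x : H, WeakHopfAlgebra.antipode (k := k) (e.symm.toLinearMap x) = x :=
    e.apply_symm_apply
  have hTS : ∀ x : H, e.symm.toLinearMap (WeakHopfAlgebra.antipode (k := k) x) = x :=
    e.symm_apply_apply
  refine ⟨FGPYDModule.monoidalCategory k H, FGPYDModule.standardMonoidal k H,
    FGPYDModule.rightRigidCategory hST hTS, fun M =>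
    ⟨YDModule.dualEquiv M.dualBasis hST hTS, fun _ _ _ => rfl,
      fun f m => YDModule.rid_map_antipode_coact f m, fun f m => YDModule.unitVal_ev_pr f m,
      fun r n n' hn z => YDModule.incl_coev ⟨r, n, n', hn⟩ z⟩⟩
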